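/- Let $I=[0,1]$, let $p\ge 2$, $0=a_0<a_1<\dots<a_p=1$, $S=\{a_0,\dots,a_p\}$, $I_j=(a_j,a_{j+1})$, and let $f\colon I\to I$ be a (possibly discontinuous) map whose restriction to each $I_j$, $0\le j<p$, is continuous and strictly monotonic. Let $I'=I\setminus\bigcup_{k\ge0}f^{-k}S$ and let $i\colon I'\to\{0,\dots,p-1\}^{\mathbb N}$, $\mathbb N=\{0,1,2,\dots\}$, be the coding map, $i(x)_k=j$ iff $f^k(x)\in I_j$. Assume that $i$ is injective. Let $\Sigma_f=\overline{i(I')}$, with shift map $\sigma$, and let $\pi\colon\Sigma_f\to I$ be the continuous extension of $i^{-1}$, that is, $\pi(\xi)$ is the unique point of $\bigcap_{n\ge 1}\overline{\bigcap_{k<n}f^{-k}I_{\xi_k}}$. Assume moreover that every periodic orbit of $f$ is the image of an orbit of $\sigma$: if $f^n(x)=x$ for some $n\ge1$, then there is $\xi\in\Sigma_f$ with $\pi(\sigma^k\xi)=f^k(x)$ for all $k\ge0$ (this is automatic for periodic orbits that avoid $S$). For $\xi\in\Sigma_f$ and a finite word $w=w_0\cdots w_{n-1}$ write $\xi\in[w]$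 if $\xi_k=w_k$ for $k<n=|w|$; let $\mathcal L=\{w : [w]\neq\emptyset\}$ be the language of $\Sigma_f$ (including the empty word), and for a word $w$ let $\pi(w)=\bigcap_{k<|w|}f^{-k}\overline{I_{w_k}}\subset I$. Let $\varphi\colon I\to\mathbb R$ be such that $\varphi\circ\pi$ is continuous on $\Sigma_f$, and put $S_n\varphi=\sum_{k<n}\varphi\circ f^k$. For $|w|=n$ and $\mathcal D\subset\mathcal L$ put $$\varphi_n(\pi(w))=\sup_{x\in\pi(w)}S_n\varphi(x),\qquad \Lambda_n(I,\mathcal D,\varphi)=\sum_{w\in\mathcal D,\ |w|=n}e^{\varphi_n(\pi(w))},\qquad P(\varphi)=\lim_{n\to\infty}\tfrac1n\log\Lambda_n(I,\mathcal L,\varphi).$$ Suppose that there are $\mathcal C^p,\mathcal G,\mathcal C^s\subset\mathcal L$ such that $\mathcal L=\{uvw\in\mathcal L : u\in\mathcal C^p, v\in\mathcal G, w\in\mathcal C^s\}$ and, with $\mathcal G(M)=\{uvw\in\mathcal L : u\in\mathcal C^p, v\in\mathcal G, w\in\mathcal C^s, |u|\le M, |w|\le M\}$, (I) for every $M\in\mathbb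 N$, $\mathcal G(M)$ has (S)-specification: there is $t\in\mathbb N$ such that for all $m\ge1$ and $w^1,\dots,w^m\in\mathcal G(M)$ there are $v^1,\dots,v^{m-1}\in\mathcal L$ of length exactly $t$ with $w^1v^1w^2\cdots v^{m-1}w^m\in\mathcal L$; (II) there is $V<\infty$ such that $|S_n\varphi(x)-S_n\varphi(y)|\le V$ for all $n$, all $w\in\mathcal G$ with $|w|=n$ and all $x,y\in\pi(w)$; (III) $\sum_{n\ge1}\Lambda_n(I,\mathcal C^p\cup\mathcal C^s,\varphi)e^{-nP(\varphi)}<\infty$. Then $\varphi$ has a unique equilibrium state $\mu_\varphi$, that is, there is exactly one $f$-invariant Borel probability measure on $I$ that maximises $h_\mu(f)+\int\varphi\,d\mu$ among all $f$-invariant Borel probability measures. The support of $\mu_\varphi$ is $I$, and $\mu_\varphi$ has the weak Gibbs property: there are constants $K'>0$ and $K_M>0$ ($M\in\mathbb N$) such that for all $M$, $n$ and all $w\in\mathcal G(M)$ with $|w|=n$ $$K_M\le\frac{\mu_\varphi(\pi(w))}{e^{-nP(\varphi)+\varphi_n(\pi(w))}}\le K'.$$ If moreover each $\mathcal G(M)$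 has (Per)-specification (in (I) the words $v^i$ can be chosen such that, in addition, for $x=w^1v^1\cdots v^{m-1}w^m$ the cylinder $[x]$ contains a point $\xi$ with $\sigma^{|x|+t}\xi=\xi$), then, with $\mathrm{Per}_n=\{x\in I : f^n(x)=x\}$, $\mu_\varphi$ is the weak* limit as $n\to\infty$ of the measures $$\frac1{\sum_{x\in\mathrm{Per}_n}e^{S_n\varphi(x)}}\sum_{x\in\mathrm{Per}_n}e^{S_n\varphi(x)}\delta_x .$$ -/

import Mathlib

open MeasureTheory Filter Topology Set

namespace PMM

/-! ### Words, languages, decompositions and specification -/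

section Symbolic

variable {A : Type*}

/-- The one-sided shift map. -/
def shift (ξ : ℕ → A) : ℕ → A := fun n => ξ (n + 1)

/-- The cylinder `[w]` in a set `X` of sequences. -/
def cylinder (X : Set (ℕ → A)) (w : List A) : Set (ℕ → A) :=
  {ξ | ξ ∈ X ∧ ∀ (k : ℕ) (hk : k < w.length), ξ k = w[k]}

/-- The language of a shift space: the words whose cylinder is nonempty. -/
def language (X : Set (ℕ → A)) : Set (List A) :=
  {w | (cylinder X w).Nonempty}

/-- The set of words `uvw` in `L` with `u ∈ P`, `v ∈ G`, `w ∈ S`. -/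
def tripleConcat (L P G S : Set (List A)) : Set (List A) :=
  {x | x ∈ L ∧ ∃ u ∈ P, ∃ v ∈ G, ∃ w ∈ S, x = u ++ v ++ w}

/-- The fattened collection `G(M)`: words `uvw` in `L` with `u ∈ P`, `v ∈ G`, `w ∈ S` and
`|u| ≤ M`, `|w| ≤ M`. -/
def fatten (L P G S : Set (List A)) (M : ℕ) : Set (List A) :=
  {x | x ∈ L ∧ ∃ u ∈ P, ∃ v ∈ G, ∃ w ∈ S, u.length ≤ M ∧ w.length ≤ M ∧ x = u ++ v ++ w}

/-- The word `w⁰ v⁰ w¹ v¹ ⋯ vᵐ⁻¹ wᵐ`. -/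
def glue {m : ℕ} (w : Fin (m + 1) → List A) (v : Fin m → List A) : List A :=
  w 0 ++ (List.ofFn fun i : Fin m => v i ++ w i.succ).flatten

/-- (S)-specification on `G`: any finite nonempty family of words of `G` can be glued to a word of
the language by connecting words of the language, all of length exactly `t`. -/
def SpecS (X : Set (ℕ → A)) (G : Set (List A)) : Prop :=
  ∃ t : ℕ, ∀ (m : ℕ) (w : Fin (m + 1) → List A), (∀ i, w i ∈ G) →
    ∃ v : Fin m → List A, (∀ i, v i ∈ language X ∧ (v i).length = t) ∧ glue w v ∈ language X

/-- (Per)-specification on `G`: in addition the cylinder of the glued word `x` contains a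
periodic point of period `|x| + t`. -/
def SpecPer (X : Set (ℕ → A)) (G : Set (List A)) : Prop :=
  ∃ t : ℕ, ∀ (m : ℕ) (w : Fin (m + 1) → List A), (∀ i, w i ∈ G) →
    ∃ v : Fin m → List A, (∀ i, v i ∈ language X ∧ (v i).length = t) ∧ glue w v ∈ language X ∧
      ∃ ξ ∈ cylinder X (glue w v), shift^[(glue w v).length + t] ξ = ξ

end Symbolic

/-! ### Entropy and equilibrium states -/

section Entropy

variable {Y : Type*} [MeasurableSpace Y]

/-- The Shannon entropy of the `n`-th refinement `⋁_{k < n} f⁻ᵏ Q` of the finite measurable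
partition `Q = {q⁻¹(i)}`; its elements are indexed by names `u : Fin n → Fin r`. -/
noncomputable def refinementEntropy (f : Y → Y) (μ : Measure Y) {r : ℕ} (q : Y → Fin r)
    (n : ℕ) : ℝ :=
  ∑ u : Fin n → Fin r, Real.negMulLog (μ.real {x | ∀ k : Fin n, q (f^[k] x) = u k})

/-- The Kolmogorov–Sinai entropy: the supremum over all finite measurable partitions of
`lim (1/n) H(⋁_{k < n} f⁻ᵏ Q)`. (For an invariant probability measure the limit exists.) -/
noncomputable def entropy (f : Y → Y) (μ : Measure Y) : EReal :=
  ⨆ (r : ℕ) (q : Y → Fin r) (_ : Measurable q),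
    limsup (fun n : ℕ => ((refinementEntropy f μ q n / n : ℝ) : EReal)) atTop

/-- `μ` is an `f`-invariant probability measure. -/
def IsInvariantProb (f : Y → Y) (μ : Measure Y) : Prop :=
  IsProbabilityMeasure μ ∧ MeasurePreserving f μ μ

/-- `μ` is an equilibrium state: it maximises `h(ν) + ∫ φ dν` among all invariant probability
measures. -/
def IsEquilibriumState (f : Y → Y) (φ : Y → ℝ) (μ : Measure Y) : Prop :=
  IsInvariantProb f μ ∧ ∀ ν : Measure Y, IsInvariantProb f ν →
    entropy f ν + ((∫ x, φ x ∂ν : ℝ) : EReal) ≤ entropy f μ + ((∫ x, φ x ∂μ : ℝ) : EReal)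

/-- The points of period `n`, i.e. the fixed points of `f^n`. -/
def perPoints (f : Y → Y) (n : ℕ) : Set Y := {x | f^[n] x = x}

/-- The unnormalised periodic orbit measure `∑_{x ∈ Per_n} e^{S_n φ(x)} δ_x`. -/
noncomputable def rawPeriodicMeasure (f : Y → Y) (φ : Y → ℝ) (n : ℕ) : Measure Y :=
  Measure.sum fun x : perPoints f n =>
    ENNReal.ofReal (Real.exp (birkhoffSum f φ n (x : Y))) • Measure.dirac (x : Y)

/-- The periodic orbit measure, normalised by `∑_{x ∈ Per_n} e^{S_n φ(x)}`. -/
noncomputable def periodicMeasure (f : Y → Y) (φ : Y → ℝ) (n : ℕ) : Measure Y :=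
  (rawPeriodicMeasure f φ n univ)⁻¹ • rawPeriodicMeasure f φ n

end Entropy

/-! ### Piecewise monotonic interval maps -/

section Interval

variable {p : ℕ}

/-- The open interval `I_j = (a_j, a_{j+1})`. -/
def piece (a : Fin (p + 1) → unitInterval) (j : Fin p) : Set unitInterval :=
  Ioo (a j.castSucc) (a j.succ)

/-- `f` is piecewise monotonic with respect to `0 = a_0 < a_1 < ⋯ < a_p = 1`; nothing is required
of the values of `f` at the points `a_j`. -/
structure PiecewiseMonotonic (f : unitInterval → unitInterval)
    (a : Fin (p + 1) → unitInterval) : Prop where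
  two_le : 2 ≤ p
  strictMono : StrictMono a
  first : a 0 = 0
  last : a (Fin.last p) = 1
  continuousOn : ∀ j, ContinuousOn f (piece a j)
  monotonic : ∀ j, StrictMonoOn f (piece a j) ∨ StrictAntiOn f (piece a j)

/-- `I' = I ∖ ⋃_k f⁻ᵏ {a_0, …, a_p}`. -/
def regularPoints (f : unitInterval → unitInterval) (a : Fin (p + 1) → unitInterval) :
    Set unitInterval :=
  {x | ∀ k : ℕ, f^[k] x ∉ range a}

/-- The sequence `ξ` is the itinerary `i(x)` of `x`. (The intervals `I_j` are disjoint and cover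
the complement of `{a_0, …, a_p}`, so that a point of `I'` has exactly one itinerary.) -/
def IsItinerary (f : unitInterval → unitInterval) (a : Fin (p + 1) → unitInterval)
    (x : unitInterval) (ξ : ℕ → Fin p) : Prop :=
  ∀ k : ℕ, f^[k] x ∈ piece a (ξ k)

/-- The coding map `i` is injective on `I'`. -/
def AdmitsSymbolicDynamics (f : unitInterval → unitInterval)
    (a : Fin (p + 1) → unitInterval) : Prop :=
  ∀ x ∈ regularPoints f a, ∀ y ∈ regularPoints f a, ∀ ξ : ℕ → Fin p,
    IsItinerary f a x ξ → IsItinerary f a y ξ → x = y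

/-- The symbolic space `Σ_f`, the closure of `i(I')`. -/
def codeSpace (f : unitInterval → unitInterval) (a : Fin (p + 1) → unitInterval) :
    Set (ℕ → Fin p) :=
  closure {ξ | ∃ x ∈ regularPoints f a, IsItinerary f a x ξ}

/-- The points that follow `ξ_0, …, ξ_{n-1}` through the open intervals. -/
def openCylinder (f : unitInterval → unitInterval) (a : Fin (p + 1) → unitInterval)
    (ξ : ℕ → Fin p) (n : ℕ) : Set unitInterval :=
  {x | ∀ k < n, f^[k] x ∈ piece a (ξ k)}

/-- The projection `π : Σ_f → I`: `π(ξ)` is the unique point of `⋂_n closure (openCylinder ξ n)`,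
a decreasing intersection of nonempty compact intervals, which is a single point for `ξ ∈ Σ_f` when
`f` admits symbolic dynamics. It is the continuous extension of `i⁻¹`. -/
noncomputable def proj (f : unitInterval → unitInterval) (a : Fin (p + 1) → unitInterval)
    (ξ : ℕ → Fin p) : unitInterval :=
  Classical.epsilon fun x => ∀ n : ℕ, x ∈ closure (openCylinder f a ξ n)

/-- Every periodic orbit of `f` is the image under `π` of an orbit of the shift on `Σ_f`. Periodic
orbits in `I'` have this property automatically, so this restricts only the finitely many periodic
orbits through the points `a_j`. -/
def CodesPeriodicOrbits (f : unitInterval → unitInterval)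
    (a : Fin (p + 1) → unitInterval) : Prop :=
  ∀ (x : unitInterval) (n : ℕ), 0 < n → f^[n] x = x →
    ∃ ξ ∈ codeSpace f a, ∀ k : ℕ, proj f a (shift^[k] ξ) = f^[k] x

/-- The class `Ĉ(I)` of functions `φ` for which `φ ∘ π` is continuous on `Σ_f`. -/
def LiftContinuous (f : unitInterval → unitInterval) (a : Fin (p + 1) → unitInterval)
    (φ : unitInterval → ℝ) : Prop :=
  ContinuousOn (fun ξ => φ (proj f a ξ)) (codeSpace f a)

/-- The cylinder set `π(w) = ⋂_{k < |w|} f⁻ᵏ (closure I_{w_k})` in the interval. -/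
def wordSet (f : unitInterval → unitInterval) (a : Fin (p + 1) → unitInterval)
    (w : List (Fin p)) : Set unitInterval :=
  {x | ∀ (k : ℕ) (hk : k < w.length), f^[k] x ∈ closure (piece a w[k])}

/-- The Bowen property on `G` in the interval: the variation of `S_n φ` on `π(w)`, `w ∈ G_n`, is
bounded uniformly in `n`. -/
def BowenOn (f : unitInterval → unitInterval) (a : Fin (p + 1) → unitInterval)
    (φ : unitInterval → ℝ) (G : Set (List (Fin p))) : Prop :=
  LiftContinuous f a φ ∧ ∃ V : ℝ, ∀ w ∈ G, ∀ x ∈ wordSet f a w, ∀ y ∈ wordSet f a w,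
    |birkhoffSum f φ w.length x - birkhoffSum f φ w.length y| ≤ V

/-- `φ_n(π(w)) = sup_{x ∈ π(w)} S_n φ(x)` with `n = |w|`. -/
noncomputable def supSum (f : unitInterval → unitInterval) (a : Fin (p + 1) → unitInterval)
    (φ : unitInterval → ℝ) (w : List (Fin p)) : ℝ :=
  sSup (birkhoffSum f φ w.length '' wordSet f a w)

/-- `Λ_n(I, D, φ) = ∑_{w ∈ D_n} exp φ_n(π(w))`; the alphabet is finite, so this is a finite sum. -/
noncomputable def partitionSum (f : unitInterval → unitInterval)
    (a : Fin (p + 1) → unitInterval) (φ : unitInterval → ℝ) (D : Set (List (Fin p)))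
    (n : ℕ) : ℝ :=
  ∑ᶠ w ∈ {w : List (Fin p) | w ∈ D ∧ w.length = n}, Real.exp (supSum f a φ w)

/-- The pressure `P(φ) = lim (1/n) log Λ_n(I, L(Σ_f), φ)`. (The limit exists by
subadditivity.) -/
noncomputable def pressure (f : unitInterval → unitInterval) (a : Fin (p + 1) → unitInterval)
    (φ : unitInterval → ℝ) : ℝ :=
  limsup (fun n : ℕ =>
    Real.log (partitionSum f a φ (language (codeSpace f a)) n) / n) atTop

/-- The weak Gibbs property of `μ` with respect to the collections `G(M)`: the lower constant may
depend on `M`, the upper one may not. -/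
def WeakGibbs (f : unitInterval → unitInterval) (a : Fin (p + 1) → unitInterval)
    (φ : unitInterval → ℝ) (GM : ℕ → Set (List (Fin p))) (μ : Measure unitInterval) : Prop :=
  ∃ (K' : ℝ) (K : ℕ → ℝ), 0 < K' ∧ (∀ M, 0 < K M) ∧ ∀ M, ∀ w ∈ GM M,
    K M ≤ μ.real (wordSet f a w) /
        Real.exp (-(w.length * pressure f a φ) + supSum f a φ w) ∧
      μ.real (wordSet f a w) /
        Real.exp (-(w.length * pressure f a φ) + supSum f a φ w) ≤ K'

end Interval

end PMM

/-! The thermodynamics is carried out on the subshift `codeSpace f a` and then transported to the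
interval by the projection π.

Symbolic side. A word has as weight the exponential of the supremum of the Birkhoff sums over its
cylinder, and e^{nP} is the growth of the total weight of the words of length n. Words with
specification and bounded distortion can be glued at a bounded cost per word. If their total weight
exceeded a large multiple of e^{nP}, repeated gluing would beat the growth rate
(`wordSum_le_of_specS`). With the summability of the prefix and suffix weights, a convolution
estimate shows that the language has weight at most a multiple of e^{nP}, and that the words outside
G(M) have at most an arbitrarily small multiple of e^{nP} once M is large
(`wordSum_decomposition_bounds`). Subadditivity gives the lower bound e^{nP}. Hence it suffices to
control the words of G(M).

Limits of averaged weighted point masses give an invariant measure μ with an upper Gibbs bound on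
all words and a lower bound for pairs of words of G(M) at every large distance
(`exists_gibbsMeasure`). The two-word bound forces ergodicity. The upper bound gives μ free energy
at least P, and the Gibbs inequality bounds every free energy by P. If ν has free energy P, a set
with ν-mass bounded below must contain a fixed share of the weighted words. Some of these lie in
G(M), so the set has μ-mass bounded below. Hence ν ≪ μ, and ν = μ by ergodicity
(`eq_of_le_wordEntropy_add`).

Transport. Only countably many points of the interval ever hit the endpoints a_j, the fibres of π
are finite and μ has no atoms. So π is injective off a μ-null set and intertwines the dynamics
μ-almost everywhere. Conversely every f-invariant measure lifts to the subshift (`exists_lift`), and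
entropy does not increase under π, so the maximum and its uniqueness descend (`entropy_add_le`).

Periodic points. Periodic specification makes the weight of the points of period n at least a
multiple of e^{nP}, so the normalised periodic measures inherit the upper Gibbs bound and every
limit of them is μ. Periodic points on the interval and in the subshift differ only along finitely
many orbits, which have free energy below P and are negligible. -/

namespace PMM

/-! ### Words, cylinders and prefixes of sequences. -/

section Words

variable {A : Type*} {X : Set (ℕ → A)}

theorem shift_iterate_apply (n : ℕ) (ξ : ℕ → A) (k : ℕ) : shift^[n] ξ k = ξ (k + n) := by
  induction n generalizing ξ k with
  | zero => rfl
  | succ n ih => rw [Function.iterate_succ_apply, ih]; simp only [shift]; congr 1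

theorem shift_iterate_mem (hX : MapsTo shift X X) (n : ℕ) {ξ : ℕ → A} (h : ξ ∈ X) :
    shift^[n] ξ ∈ X :=
  hX.iterate n h

theorem mem_cylinder_append {u v : List A} {ξ : ℕ → A} :
    ξ ∈ cylinder X (u ++ v) ↔ ξ ∈ cylinder X u ∧ shift^[u.length] ξ ∈ cylinder univ v := by
  simp only [cylinder, mem_ofPred_eq, mem_univ, true_and, shift_iterate_apply]
  constructor
  · rintro ⟨hξ, h⟩
    refine ⟨⟨hξ, fun k hk => ?_⟩, fun k hk => ?_⟩
    · rw [h k (by simp; omega), List.getElem_append_left hk]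
    · rw [h (k + u.length) (by simp; omega), List.getElem_append_right (by omega)]
      simp
  · rintro ⟨⟨hξ, h1⟩, h2⟩
    refine ⟨hξ, fun k hk => ?_⟩
    by_cases hku : k < u.length
    · rw [h1 k hku, List.getElem_append_left hku]
    · rw [List.getElem_append_right (by omega), ← h2 (k - u.length) (by simp at hk; omega)]
      congr 1; omega

theorem cylinder_eq_inter (w : List A) : cylinder X w = X ∩ cylinder univ w := by
  ext ξ; simp [cylinder]

theorem mem_cylinder_append_right (hX : MapsTo shift X X) {u v : List A} {ξ : ℕ → A}
    (h : ξ ∈ cylinder X (u ++ v)) : shift^[u.length] ξ ∈ cylinder X v := by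
  rw [mem_cylinder_append] at h
  rw [cylinder_eq_inter]
  exact ⟨shift_iterate_mem hX _ h.1.1, h.2⟩

theorem language_append_left {u v : List A} (h : u ++ v ∈ language X) : u ∈ language X := by
  obtain ⟨ξ, hξ⟩ := h
  exact ⟨ξ, (mem_cylinder_append.1 hξ).1⟩

theorem language_append_right (hX : MapsTo shift X X) {u v : List A} (h : u ++ v ∈ language X) :
    v ∈ language X := by
  obtain ⟨ξ, hξ⟩ := h
  exact ⟨_, mem_cylinder_append_right hX hξ⟩

/-- The word of the first `n` letters of `ξ`. -/
def pre (ξ : ℕ → A) (n : ℕ) : List A := List.ofFn fun i : Fin n => ξ i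

@[simp] theorem length_pre (ξ : ℕ → A) (n : ℕ) : (pre ξ n).length = n := by simp [pre]

theorem mem_cylinder_iff_pre {w : List A} {ξ : ℕ → A} :
    ξ ∈ cylinder X w ↔ ξ ∈ X ∧ pre ξ w.length = w := by
  simp only [cylinder, mem_ofPred_eq]
  refine and_congr_right fun _ => ⟨fun h => ?_, fun h k hk => ?_⟩
  · apply List.ext_getElem (by simp)
    intro i h1 h2
    simp [pre, h i h2]
  · have : (pre ξ w.length)[k]'(by simpa using hk) = w[k] := by simp only [h]
    rw [← this]; simp [pre]

theorem mem_cylinder_pre {ξ : ℕ → A} (h : ξ ∈ X) (n : ℕ) : ξ ∈ cylinder X (pre ξ n) := by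
  rw [mem_cylinder_iff_pre]; simp [h]

theorem pre_mem_language {ξ : ℕ → A} (h : ξ ∈ X) (n : ℕ) : pre ξ n ∈ language X :=
  ⟨ξ, mem_cylinder_pre h n⟩

theorem pre_eq_of_mem_cylinder {w : List A} {ξ : ℕ → A} (h : ξ ∈ cylinder X w) {n : ℕ}
    (hn : w.length = n) : pre ξ n = w := by
  subst hn; exact (mem_cylinder_iff_pre.1 h).2

theorem pre_add (ξ : ℕ → A) (m n : ℕ) : pre ξ (m + n) = pre ξ m ++ pre (shift^[m] ξ) n := by
  have h : ξ ∈ cylinder univ (pre ξ m ++ pre (shift^[m] ξ) n) := by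
    rw [mem_cylinder_append]
    exact ⟨mem_cylinder_pre (mem_univ _) _, by simpa using mem_cylinder_pre (mem_univ _) _⟩
  exact pre_eq_of_mem_cylinder h (by simp)

theorem pre_eq_pre_iff {ξ η : ℕ → A} {n : ℕ} : pre ξ n = pre η n ↔ ∀ k < n, ξ k = η k := by
  rw [pre, pre, List.ofFn_inj, funext_iff]
  exact ⟨fun h k hk => h ⟨k, hk⟩, fun h i => h i i.2⟩

end Words

/-! ### Weighted counts of words. -/

section WordSum

variable {A : Type*} [Finite A]

/-- The finite set of words of length `n`. -/
noncomputable def words (A : Type*) [Finite A] (n : ℕ) : Finset (List A) :=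
  (List.finite_length_eq A n).toFinset

@[simp] theorem mem_words {n : ℕ} {w : List A} : w ∈ words A n ↔ w.length = n := by
  simp [words]

open Classical in
/-- The words of length `n` in `D`. -/
noncomputable def wordsIn (D : Set (List A)) (n : ℕ) : Finset (List A) :=
  (words A n).filter (· ∈ D)

@[simp] theorem mem_wordsIn {D : Set (List A)} {n : ℕ} {w : List A} :
    w ∈ wordsIn D n ↔ w.length = n ∧ w ∈ D := by
  simp [wordsIn]

/-- The weighted number of words of length `n` in `D`, a word `w` having weight `exp (c w)`. -/
noncomputable def wordSum (c : List A → ℝ) (D : Set (List A)) (n : ℕ) : ℝ :=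
  ∑ w ∈ wordsIn D n, Real.exp (c w)

theorem wordSum_nonneg (c : List A → ℝ) (D : Set (List A)) (n : ℕ) : 0 ≤ wordSum c D n :=
  Finset.sum_nonneg fun _ _ => (Real.exp_pos _).le

theorem wordSum_mono (c : List A → ℝ) {D E : Set (List A)} (h : D ⊆ E) (n : ℕ) :
    wordSum c D n ≤ wordSum c E n :=
  Finset.sum_le_sum_of_subset_of_nonneg
    (fun w hw => by simp only [mem_wordsIn] at hw ⊢; exact ⟨hw.1, h hw.2⟩)
    fun _ _ _ => (Real.exp_pos _).le

theorem exp_le_wordSum (c : List A → ℝ) {D : Set (List A)} {w : List A} (h : w ∈ D) :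
    Real.exp (c w) ≤ wordSum c D w.length :=
  Finset.single_le_sum (f := fun w => Real.exp (c w)) (fun _ _ => (Real.exp_pos _).le)
    (mem_wordsIn.2 ⟨rfl, h⟩)

theorem wordSum_le_add (c : List A → ℝ) (D E : Set (List A)) (n : ℕ) :
    wordSum c D n ≤ wordSum c (D ∩ E) n + wordSum c (D \ E) n := by
  classical
  rw [wordSum, ← Finset.sum_filter_add_sum_filter_not _ (· ∈ E)]
  refine add_le_add (le_of_eq ?_) (le_of_eq ?_)
  all_goals
    refine Finset.sum_congr ?_ fun _ _ => rfl
    ext w; simp [and_assoc]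

theorem wordSum_le_mul {c d : List A → ℝ} {D : Set (List A)} {V : ℝ}
    (h : ∀ w ∈ D, c w ≤ d w + V) (n : ℕ) :
    wordSum c D n ≤ Real.exp V * wordSum d D n := by
  rw [wordSum, wordSum, Finset.mul_sum]
  refine Finset.sum_le_sum fun w hw => ?_
  rw [← Real.exp_add, Real.exp_le_exp, add_comm]
  exact h w (mem_wordsIn.1 hw).2

/-- If the words of `E` decompose into three factors, then so do the weighted counts. -/
theorem wordSum_le_of_decomposition {c : List A → ℝ} {E C G : Set (List A)}
    {Q : ℕ → ℕ → Prop} [DecidableRel Q]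
    (hsub : ∀ u v w, u ++ v ++ w ∈ E → c (u ++ v ++ w) ≤ c u + c v + c w)
    (h : ∀ x ∈ E, ∃ u ∈ C, ∃ v ∈ G, ∃ w ∈ C, Q u.length w.length ∧ x = u ++ v ++ w) (n : ℕ) :
    wordSum c E n ≤ ∑ i ∈ (Finset.range (n + 1) ×ˢ Finset.range (n + 1)).filter
      (fun i => i.1 + i.2 ≤ n ∧ Q i.1 i.2),
      wordSum c C i.1 * wordSum c G (n - i.1 - i.2) * wordSum c C i.2 := by
  classical
  choose! u hu v hv w hw hQ hx using h
  set s := (Finset.range (n + 1) ×ˢ Finset.range (n + 1)).filter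
      (fun i : ℕ × ℕ => i.1 + i.2 ≤ n ∧ Q i.1 i.2) with hs
  set T := s.sigma fun i => wordsIn C i.1 ×ˢ (wordsIn G (n - i.1 - i.2) ×ˢ wordsIn C i.2) with hT
  have h1 : ∑ i ∈ s, wordSum c C i.1 * wordSum c G (n - i.1 - i.2) * wordSum c C i.2
      = ∑ x ∈ T, Real.exp (c x.2.1) * (Real.exp (c x.2.2.1) * Real.exp (c x.2.2.2)) := by
    rw [hT, Finset.sum_sigma]
    refine Finset.sum_congr rfl fun i _ => ?_
    rw [Finset.sum_product, wordSum, wordSum, wordSum, mul_assoc, Finset.sum_mul]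
    refine Finset.sum_congr rfl fun a _ => ?_
    rw [Finset.sum_product, Finset.sum_mul_sum, Finset.mul_sum]
    refine Finset.sum_congr rfl fun b _ => ?_
    rw [Finset.mul_sum]
  rw [h1]
  -- One decomposition has been fixed for each word. A word is the concatenation of its factors, so
  -- `F` is injective and no triple is used twice.
  let F : List A → (_ : ℕ × ℕ) × (List A × (List A × List A)) := fun x =>
    ⟨((u x).length, (w x).length), (u x, v x, w x)⟩
  have hlen : ∀ x ∈ wordsIn E n, (u x).length + (v x).length + (w x).length = n := by
    intro x hxE
    rw [mem_wordsIn] at hxE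
    have := congrArg List.length (hx x hxE.2)
    simp at this
    omega
  have hF : ∀ x ∈ wordsIn E n, F x ∈ T := by
    intro x hxE
    have hl := hlen x hxE
    have hE := (mem_wordsIn.1 hxE).2
    simp only [F, hT, hs, Finset.mem_sigma, Finset.mem_filter, Finset.mem_product,
      Finset.mem_range, mem_wordsIn]
    exact ⟨⟨⟨by omega, by omega⟩, by omega, hQ x hE⟩, ⟨trivial, hu x hE⟩,
      ⟨by omega, hv x hE⟩, trivial, hw x hE⟩
  have hinj : Set.InjOn F (wordsIn E n) := by
    intro x hxE y hyE hxy
    simp only [F, Sigma.mk.injEq, Prod.mk.injEq, heq_eq_eq] at hxy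
    rw [hx x (mem_wordsIn.1 hxE).2, hx y (mem_wordsIn.1 hyE).2, hxy.2.1, hxy.2.2.1, hxy.2.2.2]
  calc wordSum c E n
      ≤ ∑ x ∈ wordsIn E n, Real.exp (c (F x).2.1) *
          (Real.exp (c (F x).2.2.1) * Real.exp (c (F x).2.2.2)) := by
        refine Finset.sum_le_sum fun x hxE => ?_
        have hE := (mem_wordsIn.1 hxE).2
        rw [← Real.exp_add, ← Real.exp_add, Real.exp_le_exp, ← add_assoc]
        simp only [F]
        calc c x = c (u x ++ v x ++ w x) := by rw [← hx x hE]
          _ ≤ _ := hsub _ _ _ (by rw [← hx x hE]; exact hE)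
    _ = ∑ x ∈ (wordsIn E n).image F, Real.exp (c x.2.1) *
          (Real.exp (c x.2.2.1) * Real.exp (c x.2.2.2)) := by
        rw [Finset.sum_image hinj]
    _ ≤ _ := by
        refine Finset.sum_le_sum_of_subset_of_nonneg ?_ fun _ _ _ => by positivity
        intro y hy
        obtain ⟨x, hxE, rfl⟩ := Finset.mem_image.1 hy
        exact hF x hxE

/-- Cutting a word after `m` letters is injective, and the weight is subadditive along the cut. This
submultiplicativity feeds Fekete's lemma. -/
theorem wordSum_add_le {c : List A → ℝ} {E : Set (List A)}
    (hsub : ∀ u v, u ++ v ∈ E → c (u ++ v) ≤ c u + c v)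
    (hl : ∀ u v, u ++ v ∈ E → u ∈ E) (hr : ∀ u v, u ++ v ∈ E → v ∈ E) (m n : ℕ) :
    wordSum c E (m + n) ≤ wordSum c E m * wordSum c E n := by
  classical
  rw [wordSum, wordSum, wordSum, Finset.sum_mul_sum, ← Finset.sum_product']
  have hcat : ∀ x ∈ wordsIn E (m + n), x.take m ++ x.drop m ∈ E := by
    intro x hx; rw [List.take_append_drop]; exact (mem_wordsIn.1 hx).2
  calc ∑ x ∈ wordsIn E (m + n), Real.exp (c x)
      ≤ ∑ x ∈ wordsIn E (m + n), Real.exp (c (x.take m)) * Real.exp (c (x.drop m)) := by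
        refine Finset.sum_le_sum fun x hx => ?_
        rw [← Real.exp_add, Real.exp_le_exp]
        simpa only [List.take_append_drop] using hsub _ _ (hcat x hx)
    _ = ∑ y ∈ (wordsIn E (m + n)).image fun x => (x.take m, x.drop m),
          Real.exp (c y.1) * Real.exp (c y.2) := by
        rw [Finset.sum_image]
        intro x _ y _ hxy
        simp only [Prod.mk.injEq] at hxy
        rw [← List.take_append_drop m x, ← List.take_append_drop m y, hxy.1, hxy.2]
    _ ≤ _ := by
        refine Finset.sum_le_sum_of_subset_of_nonneg ?_ fun _ _ _ => by positivity
        intro y hy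
        obtain ⟨x, hx, rfl⟩ := Finset.mem_image.1 hy
        have hlen := (mem_wordsIn.1 hx).1
        simp only [Finset.mem_product, mem_wordsIn, List.length_take, List.length_drop]
        exact ⟨⟨by omega, hl _ _ (hcat x hx)⟩, by omega, hr _ _ (hcat x hx)⟩

end WordSum

end PMM

namespace PMM

/-! ### Gluing words and the bound for collections with specification. -/

section Glue

variable {A : Type*}

theorem glue_zero (w : Fin 1 → List A) (v : Fin 0 → List A) : glue w v = w 0 := by
  simp [glue]

theorem glue_succ {m : ℕ} (w : Fin (m + 2) → List A) (v : Fin (m + 1) → List A) :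
    glue w v = w 0 ++ (v 0 ++ glue (fun i => w i.succ) (fun i => v i.succ)) := by
  simp [glue, List.ofFn_succ]

/-- With all lengths prescribed, a glued word can be parsed back. Hence different families of words
give different glued words, even though the connecting words depend on the family. -/
theorem glue_injective {m : ℕ} {w w' : Fin (m + 1) → List A} {v v' : Fin m → List A}
    (hw : ∀ i, (w i).length = (w' i).length) (hv : ∀ i, (v i).length = (v' i).length)
    (h : glue w v = glue w' v') : w = w' := by
  induction m with
  | zero =>
    ext1 i
    rw [glue_zero, glue_zero] at h
    rw [show i = 0 from Fin.fin_one_eq_zero i, h]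
  | succ m ih =>
    rw [glue_succ, glue_succ] at h
    obtain ⟨h0, h1⟩ := List.append_inj h (hw 0)
    obtain ⟨-, h2⟩ := List.append_inj h1 (hv 0)
    have := ih (fun i => hw i.succ) (fun i => hv i.succ) h2
    ext1 i
    refine Fin.cases h0 (fun j => ?_) i
    exact congrFun this j

theorem length_glue {m t : ℕ} {w : Fin (m + 1) → List A} {v : Fin m → List A}
    (hv : ∀ i, (v i).length = t) : (glue w v).length = ∑ i, (w i).length + m * t := by
  induction m with
  | zero => simp [glue_zero]
  | succ m ih =>
    rw [glue_succ, List.length_append, List.length_append, ih (fun i => hv i.succ), hv,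
      Fin.sum_univ_succ (n := m + 1)]
    ring

end Glue

section SymSup

variable {A : Type*} {X : Set (ℕ → A)} {ψ : (ℕ → A) → ℝ} {B : ℝ}

/-- The supremum of the Birkhoff sums over the cylinder of a word. -/
noncomputable def symSup (X : Set (ℕ → A)) (ψ : (ℕ → A) → ℝ) (w : List A) : ℝ :=
  sSup (birkhoffSum shift ψ w.length '' cylinder X w)

theorem abs_birkhoffSum_le {Y : Type*} {T : Y → Y} {g : Y → ℝ} {B : ℝ} (hB : ∀ y, |g y| ≤ B)
    (n : ℕ) (y : Y) : |birkhoffSum T g n y| ≤ n * B := by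
  unfold birkhoffSum
  calc |∑ k ∈ Finset.range n, g (T^[k] y)| ≤ ∑ k ∈ Finset.range n, |g (T^[k] y)| :=
        Finset.abs_sum_le_sum_abs _ _
    _ ≤ ∑ _k ∈ Finset.range n, B := Finset.sum_le_sum fun k _ => hB _
    _ = n * B := by simp

theorem le_symSup (hB : ∀ y, |ψ y| ≤ B) {w : List A} {ξ : ℕ → A} (h : ξ ∈ cylinder X w) :
    birkhoffSum shift ψ w.length ξ ≤ symSup X ψ w := by
  refine le_csSup ⟨w.length * B, ?_⟩ (mem_image_of_mem _ h)
  rintro _ ⟨η, -, rfl⟩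
  exact (abs_le.1 (abs_birkhoffSum_le hB _ _)).2

theorem symSup_le {w : List A} (hw : w ∈ language X) {r : ℝ}
    (h : ∀ ξ ∈ cylinder X w, birkhoffSum shift ψ w.length ξ ≤ r) : symSup X ψ w ≤ r := by
  refine csSup_le (Set.Nonempty.image _ hw) ?_
  rintro _ ⟨ξ, hξ, rfl⟩
  exact h ξ hξ

theorem symSup_append_le (hX : MapsTo shift X X) (hB : ∀ y, |ψ y| ≤ B) {u v : List A}
    (h : u ++ v ∈ language X) : symSup X ψ (u ++ v) ≤ symSup X ψ u + symSup X ψ v := by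
  refine symSup_le h fun ξ hξ => ?_
  rw [List.length_append, birkhoffSum_add]
  exact add_le_add (le_symSup hB (mem_cylinder_append.1 hξ).1)
    (le_symSup hB (mem_cylinder_append_right hX hξ))

theorem symSup_append_append_le (hX : MapsTo shift X X) (hB : ∀ y, |ψ y| ≤ B) {u v w : List A}
    (h : u ++ v ++ w ∈ language X) :
    symSup X ψ (u ++ v ++ w) ≤ symSup X ψ u + symSup X ψ v + symSup X ψ w :=
  (symSup_append_le hX hB h).trans
    (add_le_add_left (symSup_append_le hX hB (language_append_left h)) _)

theorem abs_symSup_le (hB : ∀ y, |ψ y| ≤ B) {w : List A} (hw : w ∈ language X) :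
    |symSup X ψ w| ≤ w.length * B := by
  rw [abs_le]
  obtain ⟨ξ, hξ⟩ := id hw
  exact ⟨(abs_le.1 (abs_birkhoffSum_le hB _ ξ)).1.trans (le_symSup hB hξ),
    symSup_le hw fun η _ => (abs_le.1 (abs_birkhoffSum_le hB _ η)).2⟩

/-- A Birkhoff sum along a glued word is at least the sum of the contributions of its parts, up to
a bounded error for each part. -/
theorem sum_symSup_le_of_mem_glue (hX : MapsTo shift X X) (hB : ∀ y, |ψ y| ≤ B) {V : ℝ} {m t : ℕ}
    {w : Fin (m + 1) → List A} {v : Fin m → List A} (hv : ∀ i, (v i).length = t)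
    (hV : ∀ i, ∀ ξ ∈ cylinder X (w i), symSup X ψ (w i) ≤ birkhoffSum shift ψ (w i).length ξ + V)
    {ξ : ℕ → A} (hξ : ξ ∈ cylinder X (glue w v)) :
    ∑ i, symSup X ψ (w i) ≤
      birkhoffSum shift ψ (glue w v).length ξ + ((m + 1) * V + m * (t * B)) := by
  induction m generalizing ξ with
  | zero =>
    rw [glue_zero] at hξ ⊢
    simpa using hV 0 ξ hξ
  | succ m ih =>
    rw [glue_succ] at hξ ⊢
    have h1 := mem_cylinder_append_right hX hξ
    have h2 := mem_cylinder_append_right hX h1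
    have i1 := hV 0 ξ (mem_cylinder_append.1 hξ).1
    have i2 := ih (fun i => hv i.succ) (fun i => hV i.succ) h2
    have i3 := (abs_le.1 (abs_birkhoffSum_le (T := shift) hB (v 0).length
      (shift^[(w 0).length] ξ))).1
    rw [Fin.sum_univ_succ, List.length_append, List.length_append, birkhoffSum_add,
      birkhoffSum_add]
    rw [hv] at i2 i3 ⊢
    push_cast
    linarith

/-- The words of the language obtained by gluing words of lengths `n i` in `E i` with gaps of
length `t`. -/
def gluedWords (X : Set (ℕ → A)) {m : ℕ} (E : Fin (m + 1) → Set (List A)) (n : Fin (m + 1) → ℕ)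
    (t : ℕ) : Set (List A) :=
  {x | x ∈ language X ∧ ∃ (w : Fin (m + 1) → List A) (v : Fin m → List A),
    (∀ i, w i ∈ E i ∧ (w i).length = n i) ∧ (∀ i, (v i).length = t) ∧ x = glue w v}

variable [Finite A]

/-- Expanding the product gives a sum over families of words, and gluing maps these injectively to
longer words. The loss is a factor e^V for each of the `m + 1` blocks and e^{tB} for each of the `m`
gaps. -/
theorem prod_wordSum_le (hX : MapsTo shift X X) (hB : ∀ y, |ψ y| ≤ B) {V : ℝ} {m t : ℕ}
    {E : Fin (m + 1) → Set (List A)} (n : Fin (m + 1) → ℕ)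
    (hV : ∀ i, ∀ w ∈ E i, ∀ ξ ∈ cylinder X w,
      symSup X ψ w ≤ birkhoffSum shift ψ w.length ξ + V)
    (hglue : ∀ w : Fin (m + 1) → List A, (∀ i, w i ∈ E i) →
      ∃ v : Fin m → List A, (∀ i, v i ∈ language X ∧ (v i).length = t) ∧ glue w v ∈ language X) :
    ∏ i, wordSum (symSup X ψ) (E i) (n i) ≤
      Real.exp ((m + 1) * V + m * (t * B)) *
        wordSum (symSup X ψ) (gluedWords X E n t) (∑ i, n i + m * t) := by
  classical
  unfold wordSum
  rw [Finset.prod_univ_sum, Finset.mul_sum]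
  choose! v hv hL using hglue
  have hmem : ∀ w ∈ Fintype.piFinset fun i => wordsIn (E i) (n i),
      (∀ i, w i ∈ E i) ∧ ∀ i, (w i).length = n i := by
    intro w hw
    rw [Fintype.mem_piFinset] at hw
    exact ⟨fun i => (mem_wordsIn.1 (hw i)).2, fun i => (mem_wordsIn.1 (hw i)).1⟩
  have hlen : ∀ w ∈ Fintype.piFinset fun i => wordsIn (E i) (n i),
      (glue w (v w)).length = ∑ i, n i + m * t := by
    intro w hw
    rw [length_glue fun i => (hv w (hmem w hw).1 i).2]
    simp only [(hmem w hw).2]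
  calc ∑ w ∈ Fintype.piFinset fun i => wordsIn (E i) (n i), ∏ i, Real.exp (symSup X ψ (w i))
      ≤ ∑ w ∈ Fintype.piFinset fun i => wordsIn (E i) (n i),
          Real.exp ((m + 1) * V + m * (t * B)) * Real.exp (symSup X ψ (glue w (v w))) := by
        refine Finset.sum_le_sum fun w hw => ?_
        have hE := (hmem w hw).1
        rw [← Real.exp_sum, ← Real.exp_add, Real.exp_le_exp]
        obtain ⟨ξ, hξ⟩ := hL w hE
        have := sum_symSup_le_of_mem_glue hX hB (fun i => (hv w hE i).2)
          (fun i => hV i (w i) (hE i)) hξ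
        linarith [le_symSup hB hξ]
    _ = ∑ x ∈ (Fintype.piFinset fun i => wordsIn (E i) (n i)).image fun w => glue w (v w),
          Real.exp ((m + 1) * V + m * (t * B)) * Real.exp (symSup X ψ x) := by
        rw [Finset.sum_image]
        intro w hw w' hw' h
        refine glue_injective (fun i => ?_) (fun i => ?_) h
        · rw [(hmem w hw).2, (hmem w' hw').2]
        · rw [(hv w (hmem w hw).1 i).2, (hv w' (hmem w' hw').1 i).2]
    _ ≤ _ := by
        refine Finset.sum_le_sum_of_subset_of_nonneg ?_ fun _ _ _ => by positivity
        intro x hx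
        obtain ⟨w, hw, rfl⟩ := Finset.mem_image.1 hx
        obtain ⟨hE, hl⟩ := hmem w hw
        exact mem_wordsIn.2 ⟨hlen w hw, hL w hE, w, v w, fun i => ⟨hE i, hl i⟩,
          fun i => (hv w hE i).2, rfl⟩

/-- Words with specification and bounded distortion cannot be more numerous than the growth rate
of the language allows. -/
theorem wordSum_le_of_specS (hX : MapsTo shift X X) (hB : ∀ y, |ψ y| ≤ B) {G : Set (List A)}
    {V : ℝ} (hV : ∀ w ∈ G, ∀ ξ ∈ cylinder X w,
      symSup X ψ w ≤ birkhoffSum shift ψ w.length ξ + V)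
    (hspec : SpecS X G) {P : ℝ}
    (hP : ∀ ε > 0, ∀ᶠ n : ℕ in atTop,
      wordSum (symSup X ψ) (language X) n ≤ Real.exp (n * (P + ε))) :
    ∃ K : ℝ, ∀ n : ℕ, wordSum (symSup X ψ) G n ≤ K * Real.exp (n * P) := by
  obtain ⟨t, ht⟩ := hspec
  refine ⟨max 1 (Real.exp (|V| + t * |B| + t * |P| + 1)), fun n => ?_⟩
  -- The case `n = 0` is separate because the glued length (m+1)n + mt has to tend to infinity with
  -- `m`, and `t` may be 0.
  rcases Nat.eq_zero_or_pos n with rfl | hn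
  · have : wordSum (symSup X ψ) G 0 ≤ 1 := by
      calc wordSum (symSup X ψ) G 0 ≤ wordSum (symSup X ψ) {([] : List A)} 0 := by
            refine Finset.sum_le_sum_of_subset_of_nonneg ?_ fun _ _ _ => (Real.exp_pos _).le
            intro w hw
            have := (mem_wordsIn.1 hw).1
            exact mem_wordsIn.2 ⟨this, List.length_eq_zero_iff.1 this⟩
        _ ≤ 1 := by
            have : wordsIn {([] : List A)} 0 = {[]} := by
              ext w; simp
            have h0 : symSup X ψ [] = sSup ((fun _ => (0 : ℝ)) '' cylinder X []) := by
              simp [symSup]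
            rw [wordSum, this, Finset.sum_singleton, h0]
            -- The supremum of the empty set is 0 by convention, so the empty word has weight 1 even
            -- if `X` is empty.
            rcases (cylinder X []).eq_empty_or_nonempty with h | h
            · simp [h]
            · rw [h.image_const]; simp
    simpa using this.trans (le_max_left _ _)
  · refine le_trans ?_ (mul_le_mul_of_nonneg_right (le_max_right _ _) (Real.exp_pos _).le)
    rw [← Real.exp_add]
    -- With this ε the error ((m+1)n + mt)ε in the growth rate is at most `m + 1`. That is one unit
    -- per block and explains the summand 1 in the constant.
    set ε : ℝ := 1 / (n + t) with hε
    have hnt : (0 : ℝ) < n + t := by positivity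
    have hε0 : 0 < ε := by positivity
    have hεnt : (n + t) * ε = 1 := by rw [hε]; field_simp
    have hN : Tendsto (fun m : ℕ => (m + 1) * n + m * t) atTop atTop :=
      tendsto_atTop_mono (fun m => by simp only [id]; nlinarith [Nat.zero_le (m * t), Nat.mul_le_mul_left m hn]) tendsto_id
    obtain ⟨m, hm⟩ := (hN.eventually (hP ε hε0)).exists
    have h1 := prod_wordSum_le hX hB (m := m) (E := fun _ => G) (fun _ => n) (fun _ => hV)
      (t := t) (fun w hw => ht m w hw)
    simp only [Finset.prod_const, Finset.sum_const, Finset.card_univ, Fintype.card_fin,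
      smul_eq_mul] at h1
    have h2 := h1.trans (mul_le_mul_of_nonneg_left
      ((wordSum_mono _ (fun x hx => hx.1) _).trans hm) (Real.exp_pos _).le)
    rw [← Real.exp_add] at h2
    -- The bound is for the power `m + 1` of the count. Taking the root turns the total cost of
    -- gluing into a cost per block.
    refine le_of_pow_le_pow_left₀ (Nat.succ_ne_zero m) (Real.exp_pos _).le (h2.trans ?_)
    rw [← Real.exp_nat_mul, Real.exp_le_exp]
    push_cast
    have hm0 : (0 : ℝ) ≤ m := Nat.cast_nonneg m
    have e1 : (m + 1) * V ≤ (m + 1) * |V| := by gcongr; exact le_abs_self V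
    have hmt : ∀ r : ℝ, m * (t * r) ≤ (m + 1 : ℝ) * (t * |r|) := fun r =>
      (mul_le_mul_of_nonneg_left (mul_le_mul_of_nonneg_left (le_abs_self r) t.cast_nonneg) hm0).trans
        (mul_le_mul_of_nonneg_right (by linarith) (by positivity))
    have e2 := hmt B
    have e3 := hmt P
    have e4 : ((m + 1) * n + m * t : ℝ) * ε ≤ (m + 1) * 1 := by
      rw [← hεnt]
      have : (0 : ℝ) ≤ t * ε := by positivity
      nlinarith
    nlinarith

end SymSup

/-! ### From the core collection to the whole language. -/

section Decomposition

variable {A : Type*} [Finite A]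

theorem sum_mul_le_tsum {d : ℕ → ℝ} (hd0 : ∀ i, 0 ≤ d i) (hd : Summable d)
    (s : Finset (ℕ × ℕ)) : ∑ i ∈ s, d i.1 * d i.2 ≤ (∑' i, d i) * ∑' i, d i := by
  classical
  calc ∑ i ∈ s, d i.1 * d i.2
      ≤ ∑ i ∈ s.image Prod.fst ×ˢ s.image Prod.snd, d i.1 * d i.2 :=
        Finset.sum_le_sum_of_subset_of_nonneg Finset.subset_product
          fun _ _ _ => mul_nonneg (hd0 _) (hd0 _)
    _ = (∑ i ∈ s.image Prod.fst, d i) * ∑ i ∈ s.image Prod.snd, d i := by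
        rw [Finset.sum_mul_sum, ← Finset.sum_product']
    _ ≤ _ := mul_le_mul (hd.sum_le_tsum _ fun i _ => hd0 i) (hd.sum_le_tsum _ fun i _ => hd0 i)
        (Finset.sum_nonneg fun i _ => hd0 i) (tsum_nonneg hd0)

/-- The pairs with a coordinate beyond `M` lie in two strips. Each strip contributes at most a tail
of the series times its full sum, whence the factor 2. -/
theorem sum_mul_le_tail {d : ℕ → ℝ} (hd0 : ∀ i, 0 ≤ d i) (hd : Summable d) (M : ℕ)
    (s : Finset (ℕ × ℕ)) (hs : ∀ i ∈ s, M < i.1 ∨ M < i.2) :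
    ∑ i ∈ s, d i.1 * d i.2 ≤ 2 * ((∑' i, d (i + M)) * ∑' i, d i) := by
  classical
  have tail : ∀ u : Finset ℕ, (∀ i ∈ u, M < i) → ∑ i ∈ u, d i ≤ ∑' i, d (i + M) := by
    intro u hu
    calc ∑ i ∈ u, d i = ∑ i ∈ u.image fun i => i - M, d (i + M) := by
          rw [Finset.sum_image]
          · exact Finset.sum_congr rfl fun i hi => by rw [Nat.sub_add_cancel (hu i hi).le]
          · intro i hi j hj hij
            have := hu i hi
            have := hu j hj
            simp only at hij
            omega
      _ ≤ _ := ((summable_nat_add_iff M).2 hd).sum_le_tsum _ fun i _ => hd0 _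
  have half : ∀ u : Finset (ℕ × ℕ), (∀ i ∈ u, M < i.1) →
      ∑ i ∈ u, d i.1 * d i.2 ≤ (∑' i, d (i + M)) * ∑' i, d i := by
    intro u hu
    calc ∑ i ∈ u, d i.1 * d i.2
        ≤ ∑ i ∈ u.image Prod.fst ×ˢ u.image Prod.snd, d i.1 * d i.2 :=
          Finset.sum_le_sum_of_subset_of_nonneg Finset.subset_product
            fun _ _ _ => mul_nonneg (hd0 _) (hd0 _)
      _ = (∑ i ∈ u.image Prod.fst, d i) * ∑ i ∈ u.image Prod.snd, d i := by
          rw [Finset.sum_mul_sum, ← Finset.sum_product']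
      _ ≤ _ := by
          refine mul_le_mul (tail _ fun i hi => ?_) (hd.sum_le_tsum _ fun i _ => hd0 i)
            (Finset.sum_nonneg fun i _ => hd0 i) (tsum_nonneg fun i => hd0 _)
          obtain ⟨j, hj, rfl⟩ := Finset.mem_image.1 hi
          exact hu j hj
  rw [← Finset.sum_filter_add_sum_filter_not s (fun i => M < i.1), two_mul]
  refine add_le_add (half _ fun i hi => (Finset.mem_filter.1 hi).2) ?_
  have h2 := half ((s.filter fun i => ¬ M < i.1).image Prod.swap) (by
    intro i hi
    obtain ⟨j, hj, rfl⟩ := Finset.mem_image.1 hi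
    obtain ⟨hj, hj'⟩ := Finset.mem_filter.1 hj
    exact (hs j hj).resolve_left hj')
  rw [Finset.sum_image (fun _ _ _ _ h => Prod.swap_injective h)] at h2
  refine le_trans (le_of_eq (Finset.sum_congr rfl fun i _ => ?_)) h2
  simp [mul_comm]

/-- Summing over the lengths of prefix and suffix bounds the weight of the language by a
convolution. Divided by e^{nP}, it is dominated by the square of the convergent series of prefix and
suffix weights. A word outside `fatten L Cp G Cs M` has a prefix or suffix longer than `M` in each
of its decompositions, so only tails of that series count. -/
theorem wordSum_decomposition_bounds {c : List A → ℝ} {L Cp G Cs : Set (List A)} {P K : ℝ}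
    (hdec : tripleConcat L Cp G Cs = L)
    (hsub : ∀ u v w, u ++ v ++ w ∈ L → c (u ++ v ++ w) ≤ c u + c v + c w)
    (hG : ∀ n : ℕ, wordSum c G n ≤ K * Real.exp (n * P))
    (hs : Summable fun n : ℕ => wordSum c (Cp ∪ Cs) n * Real.exp (-(n * P))) :
    (∃ K' : ℝ, ∀ n : ℕ, wordSum c L n ≤ K' * Real.exp (n * P)) ∧
    ∀ ε > 0, ∃ M : ℕ, ∀ n : ℕ,
      wordSum c (L \ fatten L Cp G Cs M) n ≤ ε * Real.exp (n * P) := by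
  classical
  set d : ℕ → ℝ := fun n => wordSum c (Cp ∪ Cs) n * Real.exp (-(n * P)) with hd
  have hd0 : ∀ i, 0 ≤ d i := fun i => mul_nonneg (wordSum_nonneg _ _ _) (Real.exp_pos _).le
  have hK : 0 ≤ K := by
    have := (wordSum_nonneg c G 0).trans (hG 0)
    simpa using this
  have hC : ∀ n : ℕ, wordSum c (Cp ∪ Cs) n = d n * Real.exp (n * P) := by
    intro n
    rw [hd]
    simp only
    rw [mul_assoc, ← Real.exp_add]
    simp
  -- The condition `Q` on the outer lengths lets one estimate serve twice: it is void for the whole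
  -- language and says that one length exceeds `M` for the tail.
  have key : ∀ (E : Set (List A)) (Q : ℕ → ℕ → Prop), E ⊆ L →
      (∀ x ∈ E, ∃ u ∈ Cp ∪ Cs, ∃ v ∈ G, ∃ w ∈ Cp ∪ Cs,
        Q u.length w.length ∧ x = u ++ v ++ w) → ∀ n : ℕ, ∃ s : Finset (ℕ × ℕ),
      (∀ i ∈ s, Q i.1 i.2) ∧
        wordSum c E n ≤ K * Real.exp (n * P) * ∑ i ∈ s, d i.1 * d i.2 := by
    intro E Q hE h n
    refine ⟨(Finset.range (n + 1) ×ˢ Finset.range (n + 1)).filter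
      (fun i => i.1 + i.2 ≤ n ∧ Q i.1 i.2), fun i hi => (Finset.mem_filter.1 hi).2.2,
      (wordSum_le_of_decomposition (fun u v w hx => hsub u v w (hE hx)) h n).trans ?_⟩
    rw [Finset.mul_sum]
    refine Finset.sum_le_sum fun i hi => ?_
    have hin := (Finset.mem_filter.1 hi).2.1
    calc wordSum c (Cp ∪ Cs) i.1 * wordSum c G (n - i.1 - i.2) * wordSum c (Cp ∪ Cs) i.2
        ≤ wordSum c (Cp ∪ Cs) i.1 * (K * Real.exp ((n - i.1 - i.2 : ℕ) * P)) *
            wordSum c (Cp ∪ Cs) i.2 := by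
          gcongr
          · exact wordSum_nonneg _ _ _
          · exact wordSum_nonneg _ _ _
          · exact hG _
      _ = K * (Real.exp (i.1 * P) * Real.exp ((n - i.1 - i.2 : ℕ) * P) * Real.exp (i.2 * P)) *
            (d i.1 * d i.2) := by
          rw [hC, hC]; ring
      _ = _ := by
          rw [← Real.exp_add, ← Real.exp_add]
          congr 3
          rw [Nat.cast_sub (by omega), Nat.cast_sub (by omega)]
          ring
  constructor
  · refine ⟨K * ((∑' i, d i) * ∑' i, d i), fun n => ?_⟩
    obtain ⟨s, -, hsum⟩ := key L (fun _ _ => True) Subset.rfl (by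
      intro x hx
      rw [← hdec] at hx
      obtain ⟨-, u, hu, v, hv, w, hw, rfl⟩ := hx
      exact ⟨u, Or.inl hu, v, hv, w, Or.inr hw, trivial, rfl⟩) n
    refine hsum.trans ?_
    rw [mul_right_comm]
    gcongr
    exact sum_mul_le_tsum hd0 hs s
  · intro ε hε
    have htail : Tendsto (fun M : ℕ => K * (2 * ((∑' i, d (i + M)) * ∑' i, d i))) atTop (𝓝 0) := by
      have := (((tendsto_sum_nat_add d).mul_const (∑' i, d i)).const_mul 2).const_mul K
      simpa using this
    obtain ⟨M, hM⟩ := (htail.eventually (gt_mem_nhds hε)).exists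
    refine ⟨M, fun n => ?_⟩
    obtain ⟨s, hsQ, hsum⟩ := key (L \ fatten L Cp G Cs M) (fun i k => M < i ∨ M < k)
      sdiff_subset (by
        rintro x ⟨hx, hxM⟩
        have hx' := hx
        rw [← hdec] at hx'
        obtain ⟨-, u, hu, v, hv, w, hw, rfl⟩ := hx'
        refine ⟨u, Or.inl hu, v, hv, w, Or.inr hw, ?_, rfl⟩
        by_contra hcon
        push Not at hcon
        exact hxM ⟨hx, u, hu, v, hv, w, hw, hcon.1, hcon.2, rfl⟩) n
    refine hsum.trans ?_
    rw [mul_right_comm]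
    refine mul_le_mul_of_nonneg_right (le_trans ?_ hM.le) (Real.exp_pos _).le
    gcongr
    exact sum_mul_le_tail hd0 hs M s hsQ

end Decomposition

end PMM

namespace PMM

/-! ### Gibbs inequality and Shannon entropy. -/

section Gibbs

/-- This is log(y/x) ≤ y/x − 1 multiplied by x. Since `Real.log 0 = 0`, the case y = 0 has to be
restricted to x = 0. -/
theorem negMulLog_add_mul_log_le {x y : ℝ} (hx : 0 ≤ x) (hy : 0 ≤ y) (h : y = 0 → x = 0) :
    Real.negMulLog x + x * Real.log y ≤ y - x := by
  rcases hx.eq_or_lt with rfl | hx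
  · simpa using hy
  have hy' : 0 < y := lt_of_le_of_ne hy fun h0 => hx.ne' (h h0.symm)
  have h1 := Real.log_le_sub_one_of_pos (div_pos hy' hx)
  rw [Real.log_div hy'.ne' hx.ne'] at h1
  have h2 := mul_le_mul_of_nonneg_left h1 hx.le
  have h3 : x * (y / x - 1) = y - x := by field_simp
  rw [h3] at h2
  rw [Real.negMulLog]
  linarith

/-- The Gibbs inequality. -/
theorem sum_negMulLog_add_mul_le {ι : Type*} (s : Finset ι) {x : ι → ℝ} (c : ι → ℝ)
    (hx : ∀ i ∈ s, 0 ≤ x i) (hsum : ∑ i ∈ s, x i = 1) :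
    ∑ i ∈ s, (Real.negMulLog (x i) + x i * c i) ≤ Real.log (∑ i ∈ s, Real.exp (c i)) := by
  have hs : s.Nonempty := by
    by_contra h
    rw [Finset.not_nonempty_iff_eq_empty] at h
    simp [h] at hsum
  set Z := ∑ i ∈ s, Real.exp (c i) with hZ
  have hZ0 : 0 < Z := Finset.sum_pos (fun i _ => Real.exp_pos _) hs
  have h1 : ∑ i ∈ s, (Real.negMulLog (x i) + x i * (c i - Real.log Z)) ≤
      ∑ i ∈ s, (Real.exp (c i) / Z - x i) := by
    refine Finset.sum_le_sum fun i hi => ?_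
    have h0 : 0 < Real.exp (c i) / Z := div_pos (Real.exp_pos _) hZ0
    have := negMulLog_add_mul_log_le (hx i hi) h0.le fun h => absurd h h0.ne'
    rwa [Real.log_div (Real.exp_pos _).ne' hZ0.ne', Real.log_exp] at this
  have h2 : ∑ i ∈ s, (Real.exp (c i) / Z - x i) = 0 := by
    rw [Finset.sum_sub_distrib, ← Finset.sum_div, ← hZ, div_self hZ0.ne', hsum, sub_self]
  have h3 : ∑ i ∈ s, (Real.negMulLog (x i) + x i * (c i - Real.log Z)) =
      ∑ i ∈ s, (Real.negMulLog (x i) + x i * c i) - Real.log Z := by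
    simp only [mul_sub, ← add_sub_assoc]
    rw [Finset.sum_sub_distrib, ← Finset.sum_mul, hsum, one_mul]
  linarith

theorem negMulLog_sum_le {ι : Type*} (s : Finset ι) {x : ι → ℝ} (hx : ∀ i ∈ s, 0 ≤ x i) :
    Real.negMulLog (∑ i ∈ s, x i) ≤ ∑ i ∈ s, Real.negMulLog (x i) := by
  rw [Real.negMulLog, neg_mul, Finset.sum_mul, ← Finset.sum_neg_distrib]
  refine Finset.sum_le_sum fun i hi => ?_
  rw [Real.negMulLog, neg_mul, neg_le_neg_iff]
  rcases (hx i hi).eq_or_lt with h | h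
  · simp [← h]
  · exact mul_le_mul_of_nonneg_left
      (Real.log_le_log h (Finset.single_le_sum (f := x) hx hi)) h.le

end Gibbs

section Shannon

variable {Ω : Type*} [MeasurableSpace Ω] {μ : Measure Ω}
variable {S T : Type*} [Fintype S] [Fintype T]

/-- The Shannon entropy of the partition of `Ω` into the fibres of a map to a finite set. -/
noncomputable def shannon (μ : Measure Ω) (g : Ω → S) : ℝ :=
  ∑ s, Real.negMulLog (μ.real (g ⁻¹' {s}))

theorem refinementEntropy_eq_shannon (f : Ω → Ω) (μ : Measure Ω) {r : ℕ} (q : Ω → Fin r) (n : ℕ) :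
    refinementEntropy f μ q n = shannon μ fun x => fun k : Fin n => q (f^[k] x) := by
  unfold refinementEntropy shannon
  refine Finset.sum_congr rfl fun u _ => ?_
  congr 2
  ext x
  simp [funext_iff]

theorem shannon_nonneg [IsProbabilityMeasure μ] (g : Ω → S) : 0 ≤ shannon μ g :=
  Finset.sum_nonneg fun _ _ => Real.negMulLog_nonneg measureReal_nonneg measureReal_le_one

variable [MeasurableSpace S] [MeasurableSingletonClass S]

open Classical in
theorem measureReal_preimage_eq_sum [IsFiniteMeasure μ] {g : Ω → S} (hg : Measurable g)
    (E : Set S) : μ.real (g ⁻¹' E) = ∑ s with s ∈ E, μ.real (g ⁻¹' {s}) := by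
  rw [sum_measureReal_preimage_singleton _ fun s _ => hg (measurableSet_singleton s)]
  congr 1
  ext x; simp

theorem sum_measureReal_fiber [IsProbabilityMeasure μ] {g : Ω → S} (hg : Measurable g) :
    ∑ s, μ.real (g ⁻¹' {s}) = 1 := by
  rw [sum_measureReal_preimage_singleton _ fun s _ => hg (measurableSet_singleton s)]
  simp

/-- Merging fibres lowers entropy, because −x log x is subadditive on nonnegative numbers. -/
theorem shannon_comp_le [IsFiniteMeasure μ] {g : Ω → S} (hg : Measurable g) (F : S → T) :
    shannon μ (F ∘ g) ≤ shannon μ g := by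
  classical
  unfold shannon
  calc ∑ t, Real.negMulLog (μ.real ((F ∘ g) ⁻¹' {t}))
      = ∑ t, Real.negMulLog (∑ s with F s = t, μ.real (g ⁻¹' {s})) := by
        refine Finset.sum_congr rfl fun t _ => ?_
        rw [preimage_comp, measureReal_preimage_eq_sum hg]
        simp
    _ ≤ ∑ t, ∑ s with F s = t, Real.negMulLog (μ.real (g ⁻¹' {s})) :=
        Finset.sum_le_sum fun t _ => negMulLog_sum_le _ fun _ _ => measureReal_nonneg
    _ = _ := Finset.sum_fiberwise _ _ _

/-- Gibbs inequality for the joint distribution against the product of its marginals. Where a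
marginal vanishes, so does the joint mass. -/
theorem shannon_prodMk_le [MeasurableSpace T] [MeasurableSingletonClass T] [IsProbabilityMeasure μ] {g : Ω → S} {h : Ω → T} (hg : Measurable g)
    (hh : Measurable h) : shannon μ (fun x => (g x, h x)) ≤ shannon μ g + shannon μ h := by
  classical
  have hgh : Measurable fun x => (g x, h x) := hg.prodMk hh
  set P : S × T → ℝ := fun st => μ.real ((fun x => (g x, h x)) ⁻¹' {st}) with hP
  set x : S → ℝ := fun s => μ.real (g ⁻¹' {s}) with hx
  set y : T → ℝ := fun t => μ.real (h ⁻¹' {t}) with hy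
  have hPx : ∀ s, x s = ∑ t, P (s, t) := by
    intro s
    have := measureReal_preimage_eq_sum (μ := μ) hgh (Prod.fst ⁻¹' {s})
    rw [← preimage_comp] at this
    refine this.trans ?_
    rw [Finset.sum_filter, Fintype.sum_prod_type_right]
    simp [hP]
  have hPy : ∀ t, y t = ∑ s, P (s, t) := by
    intro t
    have := measureReal_preimage_eq_sum (μ := μ) hgh (Prod.snd ⁻¹' {t})
    rw [← preimage_comp] at this
    refine this.trans ?_
    rw [Finset.sum_filter, Fintype.sum_prod_type]
    simp [hP]
  have hP0 : ∀ st, 0 ≤ P st := fun _ => measureReal_nonneg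
  have hPlex : ∀ s t, P (s, t) ≤ x s := fun s t => by
    rw [hPx]; exact Finset.single_le_sum (f := fun t => P (s, t)) (fun _ _ => hP0 _) (Finset.mem_univ t)
  have hPley : ∀ s t, P (s, t) ≤ y t := fun s t => by
    rw [hPy]; exact Finset.single_le_sum (f := fun s => P (s, t)) (fun _ _ => hP0 _) (Finset.mem_univ s)
  have key : ∑ st : S × T, (Real.negMulLog (P st) + P st * Real.log (x st.1 * y st.2)) ≤
      ∑ st : S × T, (x st.1 * y st.2 - P st) := by
    refine Finset.sum_le_sum fun st _ => negMulLog_add_mul_log_le (hP0 _)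
      (mul_nonneg measureReal_nonneg measureReal_nonneg) fun h0 => ?_
    rcases mul_eq_zero.1 h0 with h0 | h0
    · exact le_antisymm (h0 ▸ hPlex st.1 st.2) (hP0 _)
    · exact le_antisymm (h0 ▸ hPley st.1 st.2) (hP0 _)
  have hzero : ∑ st : S × T, (x st.1 * y st.2 - P st) = 0 := by
    rw [Finset.sum_sub_distrib, sum_measureReal_fiber hgh, Fintype.sum_prod_type,
      ← Finset.sum_mul_sum, sum_measureReal_fiber hg, sum_measureReal_fiber hh]
    norm_num
  have hlog : ∀ st : S × T, P st * Real.log (x st.1 * y st.2) =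
      P st * Real.log (x st.1) + P st * Real.log (y st.2) := by
    rintro ⟨s, t⟩
    by_cases h0 : P (s, t) = 0
    · simp [h0]
    · have hpos := lt_of_le_of_ne (hP0 (s, t)) (Ne.symm h0)
      rw [Real.log_mul (hpos.trans_le (hPlex s t)).ne' (hpos.trans_le (hPley s t)).ne', mul_add]
  have e1 : ∑ st : S × T, P st * Real.log (x st.1) = -shannon μ g := by
    rw [Fintype.sum_prod_type, shannon, ← Finset.sum_neg_distrib]
    refine Finset.sum_congr rfl fun s _ => ?_
    simp only
    rw [← Finset.sum_mul, ← hPx, Real.negMulLog]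
    ring
  have e2 : ∑ st : S × T, P st * Real.log (y st.2) = -shannon μ h := by
    rw [Fintype.sum_prod_type_right, shannon, ← Finset.sum_neg_distrib]
    refine Finset.sum_congr rfl fun t _ => ?_
    simp only
    rw [← Finset.sum_mul, ← hPy, Real.negMulLog]
    ring
  have e3 : ∑ st : S × T, Real.negMulLog (P st) = shannon μ fun x => (g x, h x) := rfl
  simp only [hlog] at key
  rw [Finset.sum_add_distrib, Finset.sum_add_distrib, hzero, e1, e2, e3] at key
  linarith

theorem shannon_comp_measurePreserving {f : Ω → Ω} (hf : MeasurePreserving f μ μ) {g : Ω → S}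
    (hg : Measurable g) : shannon μ (g ∘ f) = shannon μ g := by
  unfold shannon
  refine Finset.sum_congr rfl fun s _ => ?_
  rw [preimage_comp, measureReal_def, hf.measure_preimage (hg (measurableSet_singleton s)).nullMeasurableSet,
    measureReal_def]

end Shannon

/-! ### Entropy of refined partitions. -/

section Refinement

variable {Y : Type*} [MeasurableSpace Y] {μ : Measure Y} {f : Y → Y} {r : ℕ} {q : Y → Fin r}

theorem measurable_names (hf : Measurable f) (hq : Measurable q) (n : ℕ) :
    Measurable fun x => fun k : Fin n => q (f^[k] x) :=
  measurable_pi_lambda _ fun k => hq.comp (hf.iterate k)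

theorem refinementEntropy_nonneg [IsProbabilityMeasure μ] (n : ℕ) :
    0 ≤ refinementEntropy f μ q n := by
  rw [refinementEntropy_eq_shannon]; exact shannon_nonneg _

theorem refinementEntropy_subadditive [IsProbabilityMeasure μ] (hf : MeasurePreserving f μ μ)
    (hq : Measurable q) : Subadditive (refinementEntropy f μ q) := by
  intro m n
  simp only [refinementEntropy_eq_shannon]
  let N : ∀ n : ℕ, Y → Fin n → Fin r := fun n x k => q (f^[k] x)
  have hN : ∀ n, Measurable (N n) := measurable_names hf.measurable hq
  let F : (Fin m → Fin r) × (Fin n → Fin r) → Fin (m + n) → Fin r := fun uv => Fin.append uv.1 uv.2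
  have h1 : N (m + n) = F ∘ fun x => (N m x, (N n ∘ f^[m]) x) := by
    funext x
    refine funext fun k => ?_
    refine Fin.addCases (fun i => ?_) (fun i => ?_) k
    · simp [F, N]
    · simp [F, N, ← Function.iterate_add_apply, add_comm]
  calc shannon μ (N (m + n)) ≤ shannon μ fun x => (N m x, (N n ∘ f^[m]) x) := by
        rw [h1]
        exact shannon_comp_le ((hN m).prodMk ((hN n).comp (hf.measurable.iterate m))) F
    _ ≤ shannon μ (N m) + shannon μ (N n ∘ f^[m]) :=
        shannon_prodMk_le (hN m) ((hN n).comp (hf.measurable.iterate m))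
    _ = _ := by rw [shannon_comp_measurePreserving (hf.iterate m) (hN n)]

theorem refinementEntropy_div_tendsto [IsProbabilityMeasure μ] (hf : MeasurePreserving f μ μ)
    (hq : Measurable q) :
    Tendsto (fun n : ℕ => refinementEntropy f μ q n / n) atTop
      (𝓝 (refinementEntropy_subadditive hf hq).lim) := by
  refine (refinementEntropy_subadditive hf hq).tendsto_lim ⟨0, ?_⟩
  rintro _ ⟨n, rfl⟩
  exact div_nonneg (refinementEntropy_nonneg n) n.cast_nonneg

theorem refinementEntropy_lim_le [IsProbabilityMeasure μ] (hf : MeasurePreserving f μ μ)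
    (hq : Measurable q) {n : ℕ} (hn : n ≠ 0) :
    (refinementEntropy_subadditive hf hq).lim ≤ refinementEntropy f μ q n / n := by
  refine (refinementEntropy_subadditive hf hq).lim_le_div ⟨0, ?_⟩ hn
  rintro _ ⟨n, rfl⟩
  exact div_nonneg (refinementEntropy_nonneg n) n.cast_nonneg

theorem refinementEntropy_le_mul [IsProbabilityMeasure μ] (hf : MeasurePreserving f μ μ)
    (hq : Measurable q) (n : ℕ) : refinementEntropy f μ q n ≤ n * shannon μ q := by
  induction n with
  | zero =>
    have : refinementEntropy f μ q 0 = 0 := by simp [refinementEntropy]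
    simp [this]
  | succ n ih =>
    have h1 : refinementEntropy f μ q 1 ≤ shannon μ q := by
      have e : (fun x => fun k : Fin 1 => q (f^[k] x)) = (fun a => fun _ : Fin 1 => a) ∘ q := by
        funext x k
        rw [show k = 0 from Fin.fin_one_eq_zero k]
        rfl
      rw [refinementEntropy_eq_shannon, e]
      exact shannon_comp_le (μ := μ) (g := q) hq fun (a : Fin r) => fun _ : Fin 1 => a
    have := refinementEntropy_subadditive hf hq n 1
    push_cast
    linarith

/-- The entropy with respect to two partitions that rarely differ. -/
theorem refinementEntropy_le_add [IsProbabilityMeasure μ] (hf : MeasurePreserving f μ μ)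
    (hq : Measurable q) {q' : Y → Fin r} (hq' : Measurable q') (n : ℕ) :
    refinementEntropy f μ q n ≤ refinementEntropy f μ q' n +
      n * shannon μ fun x => if q x = q' x then (0 : Fin (r + 1)) else (q x).succ := by
  -- The map `d` is 0 where the partitions agree and otherwise records the value of `q`. Thus `q` is
  -- recovered from `q'` and `d`, and `d` has small entropy when disagreement is rare.
  set d : Y → Fin (r + 1) := fun x => if q x = q' x then (0 : Fin (r + 1)) else (q x).succ with hd
  have hdm : Measurable d :=
    Measurable.ite (measurableSet_eq_fun hq hq') measurable_const
      ((measurable_of_finite Fin.succ).comp hq)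
  let F : (Fin n → Fin r) × (Fin n → Fin (r + 1)) → Fin n → Fin r := fun uv k =>
    Fin.cases (motive := fun _ => Fin r) (uv.1 k) (fun i => i) (uv.2 k)
  have h1 : (fun x => fun k : Fin n => q (f^[k] x)) =
      F ∘ fun x => ((fun k : Fin n => q' (f^[k] x)), fun k : Fin n => d (f^[k] x)) := by
    funext x
    funext k
    simp only [F, Function.comp, hd]
    split_ifs with h
    · exact h
    · rfl
  have hm1 := measurable_names hf.measurable hq' n
  have hm2 := measurable_names hf.measurable hdm n
  calc refinementEntropy f μ q n
      ≤ shannon μ fun x => ((fun k : Fin n => q' (f^[k] x)), fun k : Fin n => d (f^[k] x)) := by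
        rw [refinementEntropy_eq_shannon, h1]
        exact shannon_comp_le (hm1.prodMk hm2) F
    _ ≤ refinementEntropy f μ q' n + refinementEntropy f μ d n := by
        rw [refinementEntropy_eq_shannon, refinementEntropy_eq_shannon]
        exact shannon_prodMk_le hm1 hm2
    _ ≤ _ := by gcongr; exact refinementEntropy_le_mul hf hdm n

end Refinement

end PMM

namespace PMM

/-! ### Sets that depend on finitely many letters. -/

section Determined

variable {p : ℕ}

/-- The set `C` of sequences depends on the first `n` letters only. -/
def IsDetermined (n : ℕ) (C : Set (ℕ → Fin p)) : Prop :=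
  ∀ ξ η, pre ξ n = pre η n → ξ ∈ C → η ∈ C

/-- The restriction of a sequence to its first `n` letters. -/
def initial (n : ℕ) (ξ : ℕ → Fin p) : Fin n → Fin p := fun i => ξ i

theorem continuous_initial (n : ℕ) : Continuous (initial (p := p) n) :=
  continuous_pi fun i => continuous_apply (i : ℕ)

theorem measurable_initial (n : ℕ) : Measurable (initial (p := p) n) :=
  measurable_pi_lambda _ fun i => measurable_pi_apply (i : ℕ)

theorem initial_eq_iff {n : ℕ} {ξ η : ℕ → Fin p} : initial n ξ = initial n η ↔ pre ξ n = pre η n := by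
  rw [pre, pre, List.ofFn_inj]; rfl

theorem IsDetermined.eq_preimage {n : ℕ} {C : Set (ℕ → Fin p)} (h : IsDetermined n C) :
    C = initial n ⁻¹' (initial n '' C) := by
  refine Subset.antisymm (subset_preimage_image _ _) ?_
  rintro η ⟨ξ, hξ, he⟩
  exact h ξ η (initial_eq_iff.1 he) hξ

theorem IsDetermined.isClopen {n : ℕ} {C : Set (ℕ → Fin p)} (h : IsDetermined n C) :
    IsClopen C := by
  rw [h.eq_preimage]
  exact (isClopen_discrete _).preimage (continuous_initial n)

theorem IsDetermined.measurableSet {n : ℕ} {C : Set (ℕ → Fin p)} (h : IsDetermined n C) :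
    MeasurableSet C :=
  h.isClopen.isOpen.measurableSet

theorem IsDetermined.mono {m n : ℕ} {C : Set (ℕ → Fin p)} (h : IsDetermined m C) (hmn : m ≤ n) :
    IsDetermined n C := fun ξ η he =>
  h ξ η (pre_eq_pre_iff.2 fun k hk => pre_eq_pre_iff.1 he k (hk.trans_le hmn))

theorem IsDetermined.compl {n : ℕ} {C : Set (ℕ → Fin p)} (h : IsDetermined n C) :
    IsDetermined n Cᶜ := fun ξ η he hξ hη => hξ (h η ξ he.symm hη)

theorem IsDetermined.union {n : ℕ} {C D : Set (ℕ → Fin p)} (h : IsDetermined n C)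
    (h' : IsDetermined n D) : IsDetermined n (C ∪ D) := fun ξ η he hξ =>
  hξ.imp (h ξ η he) (h' ξ η he)

theorem IsDetermined.inter {n : ℕ} {C D : Set (ℕ → Fin p)} (h : IsDetermined n C)
    (h' : IsDetermined n D) : IsDetermined n (C ∩ D) := fun ξ η he hξ =>
  ⟨h ξ η he hξ.1, h' ξ η he hξ.2⟩

theorem IsDetermined.shift_preimage {n : ℕ} {C : Set (ℕ → Fin p)} (h : IsDetermined n C) (k : ℕ) :
    IsDetermined (n + k) (shift^[k] ⁻¹' C) := fun ξ η he =>
  h _ _ (pre_eq_pre_iff.2 fun i hi => by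
    rw [shift_iterate_apply, shift_iterate_apply]
    exact pre_eq_pre_iff.1 he (i + k) (by omega))

theorem isDetermined_cylinder (w : List (Fin p)) : IsDetermined w.length (cylinder univ w) := by
  intro ξ η he hξ
  rw [mem_cylinder_iff_pre] at hξ ⊢
  exact ⟨mem_univ _, he ▸ hξ.2⟩

theorem isClopen_cylinder (w : List (Fin p)) : IsClopen (cylinder univ w) :=
  (isDetermined_cylinder w).isClopen

theorem measurableSet_cylinder (w : List (Fin p)) : MeasurableSet (cylinder univ w) :=
  (isDetermined_cylinder w).measurableSet

theorem continuous_shift : Continuous (shift : (ℕ → Fin p) → ℕ → Fin p) :=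
  continuous_pi fun i => continuous_apply (i + 1)

theorem measurable_shift : Measurable (shift : (ℕ → Fin p) → ℕ → Fin p) :=
  measurable_pi_lambda _ fun i => measurable_pi_apply (i + 1)

theorem isSetRing_determined : IsSetRing {C : Set (ℕ → Fin p) | ∃ n, IsDetermined n C} where
  empty_mem := ⟨0, fun _ _ _ h => h⟩
  union_mem := by
    rintro C D ⟨m, hC⟩ ⟨n, hD⟩
    exact ⟨max m n, (hC.mono (le_max_left _ _)).union (hD.mono (le_max_right _ _))⟩
  sdiff_mem := by
    rintro C D ⟨m, hC⟩ ⟨n, hD⟩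
    exact ⟨max m n, (hC.mono (le_max_left _ _)).inter (hD.mono (le_max_right _ _)).compl⟩

theorem generateFrom_determined :
    (inferInstance : MeasurableSpace (ℕ → Fin p)) =
      MeasurableSpace.generateFrom {C : Set (ℕ → Fin p) | ∃ n, IsDetermined n C} := by
  refine le_antisymm ?_ (MeasurableSpace.generateFrom_le ?_)
  · refine iSup_le fun i => ?_
    rintro _ ⟨s, -, rfl⟩
    refine MeasurableSpace.measurableSet_generateFrom ⟨i + 1, fun ξ η he hξ => ?_⟩
    have := pre_eq_pre_iff.1 he i (Nat.lt_succ_self i)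
    simp only [mem_preimage] at hξ ⊢
    exact this ▸ hξ
  · rintro C ⟨n, hC⟩
    exact hC.measurableSet

/-- Sets depending on finitely many letters form a ring that generates the σ-algebra. The
approximation reduces statements about measurable sets to finite sums over words. -/
theorem exists_determined_approx (μ : Measure (ℕ → Fin p)) [IsFiniteMeasure μ]
    {s : Set (ℕ → Fin p)} (hs : MeasurableSet s) {ε : ℝ} (hε : 0 < ε) :
    ∃ n C, IsDetermined n C ∧ μ.real (symmDiff C s) < ε := by
  obtain ⟨C, ⟨n, hC⟩, h⟩ := exists_measure_symmDiff_lt_of_generateFrom_isSetRing (μ := μ)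
    isSetRing_determined ⟨{univ}, countable_singleton _, by
      rintro _ rfl
      exact ⟨0, fun _ _ _ h => h⟩, by simp⟩ generateFrom_determined hs
    (ENNReal.ofReal_pos.2 hε)
  refine ⟨n, C, hC, ?_⟩
  rw [measureReal_def]
  exact (ENNReal.lt_ofReal_iff_toReal_lt (measure_ne_top _ _)).1 h

theorem measureReal_le_add_symmDiff (μ : Measure (ℕ → Fin p)) [IsFiniteMeasure μ]
    (s t : Set (ℕ → Fin p)) : μ.real s ≤ μ.real t + μ.real (symmDiff s t) :=
  (measureReal_mono (fun x hx => by
    by_cases h : x ∈ t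
    · exact Or.inl h
    · exact Or.inr (Or.inl ⟨hx, h⟩))).trans (measureReal_union_le _ _)

theorem ext_of_cylinder {μ ν : Measure (ℕ → Fin p)} [IsProbabilityMeasure μ]
    [IsProbabilityMeasure ν] (h : ∀ (n : ℕ) (C : Set (ℕ → Fin p)), IsDetermined n C →
      μ.real C = ν.real C) : μ = ν := by
  refine ext_of_generate_finite _ generateFrom_determined
    isSetRing_determined.isSetSemiring.isPiSystem ?_ (by simp)
  rintro C ⟨n, hC⟩
  exact (measureReal_eq_measureReal_iff).1 (h n C hC)

/-- The words whose cylinder is contained in `C`. -/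
def wordsWithin (C : Set (ℕ → Fin p)) : Set (List (Fin p)) := {w | cylinder univ w ⊆ C}

theorem pairwiseDisjoint_cylinder (n : ℕ) (s : Finset (List (Fin p)))
    (hs : ∀ w ∈ s, w.length = n) :
    (s : Set (List (Fin p))).PairwiseDisjoint (cylinder univ) := by
  intro u hu v hv huv
  refine Set.disjoint_left.2 fun ξ h1 h2 => huv ?_
  rw [← pre_eq_of_mem_cylinder h1 (hs u hu), ← pre_eq_of_mem_cylinder h2 (hs v hv)]

theorem measureReal_biUnion_cylinder (μ : Measure (ℕ → Fin p)) [IsFiniteMeasure μ] (n : ℕ)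
    (s : Finset (List (Fin p))) (hs : ∀ w ∈ s, w.length = n) :
    μ.real (⋃ w ∈ s, cylinder univ w) = ∑ w ∈ s, μ.real (cylinder univ w) :=
  measureReal_biUnion_finset (pairwiseDisjoint_cylinder n s hs) fun w _ => measurableSet_cylinder w

theorem IsDetermined.eq_biUnion {n : ℕ} {C : Set (ℕ → Fin p)} (h : IsDetermined n C) :
    C = ⋃ w ∈ wordsIn (wordsWithin C) n, cylinder univ w := by
  ext ξ
  simp only [mem_iUnion, mem_wordsIn, exists_prop]
  constructor
  · intro hξ
    refine ⟨pre ξ n, ⟨length_pre _ _, fun η hη => ?_⟩, mem_cylinder_pre (mem_univ _) n⟩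
    exact h ξ η (pre_eq_of_mem_cylinder hη (length_pre _ _)).symm hξ
  · rintro ⟨w, ⟨-, hw⟩, hξ⟩
    exact hw hξ

theorem IsDetermined.measureReal_eq_sum {n : ℕ} {C : Set (ℕ → Fin p)} (h : IsDetermined n C)
    (μ : Measure (ℕ → Fin p)) [IsFiniteMeasure μ] :
    μ.real C = ∑ w ∈ wordsIn (wordsWithin C) n, μ.real (cylinder univ w) := by
  conv_lhs => rw [h.eq_biUnion]
  exact measureReal_biUnion_cylinder μ n _ fun w hw => (mem_wordsIn.1 hw).1

theorem sum_measureReal_cylinder (μ : Measure (ℕ → Fin p)) [IsProbabilityMeasure μ] (n : ℕ) :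
    ∑ w ∈ words (Fin p) n, μ.real (cylinder univ w) = 1 := by
  rw [← measureReal_biUnion_cylinder μ n _ fun w hw => mem_words.1 hw]
  have : (⋃ w ∈ words (Fin p) n, cylinder univ w) = univ := by
    refine eq_univ_of_forall fun ξ => ?_
    simp only [mem_iUnion, exists_prop]
    exact ⟨pre ξ n, by simp, mem_cylinder_pre (mem_univ _) n⟩
  rw [this]; simp

/-- The names of length `n` for the partition by the zeroth letter are the words of length `n`. -/
theorem wordEntropy_eq_sum (μ : Measure (ℕ → Fin p)) (n : ℕ) :
    refinementEntropy shift μ (fun ξ => ξ 0) n =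
      ∑ w ∈ words (Fin p) n, Real.negMulLog (μ.real (cylinder univ w)) := by
  unfold refinementEntropy
  refine Finset.sum_bij (fun u _ => List.ofFn u) (fun u _ => by simp)
    (fun u _ v _ h => List.ofFn_injective h) (fun w hw => ?_) fun u _ => ?_
  · rw [mem_words] at hw
    subst hw
    exact ⟨fun i => w[i], Finset.mem_univ _, by simp⟩
  · congr 2
    ext ξ
    simp only [cylinder, mem_univ, true_and, mem_ofPred_eq, List.length_ofFn, List.getElem_ofFn,
      shift_iterate_apply, zero_add]
    exact ⟨fun h k hk => h ⟨k, hk⟩, fun h k => h k k.2⟩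

end Determined

/-! ### The partition by the zeroth letter generates the entropy. -/

section Generator

variable {p : ℕ}

theorem limsup_coe_le {u : ℕ → ℝ} {h : ℝ} (hu : ∀ ε > 0, ∀ᶠ n in atTop, u n ≤ h + ε) :
    limsup (fun n => (u n : EReal)) atTop ≤ h := by
  refine (EReal.le_of_forall_lt_iff_le).1 fun z hz => ?_
  have hz' : h < z := EReal.coe_lt_coe_iff.1 hz
  refine limsup_le_of_le (by isBoundedDefault) ?_
  filter_upwards [hu (z - h) (by linarith)] with n hn
  exact EReal.coe_le_coe_iff.2 (by linarith)

/-- The function −x log x is continuous and vanishes at 0 and at 1. When the class of 0 has almost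
full mass, all `r + 1` terms are small, uniformly in the measure. -/
theorem exists_shannon_lt (r : ℕ) {ε : ℝ} (hε : 0 < ε) :
    ∃ δ > 0, ∀ (μ : Measure (ℕ → Fin p)) [IsProbabilityMeasure μ] (d : (ℕ → Fin p) → Fin (r + 1)),
      Measurable d → μ.real {ξ | d ξ ≠ 0} < δ → shannon μ d < ε := by
  have hc := Real.continuous_negMulLog
  have h0 : ∀ᶠ x in 𝓝 (0 : ℝ), Real.negMulLog x < ε / (r + 1) :=
    (hc.tendsto 0).eventually (gt_mem_nhds (by simp; positivity))
  have h1 : ∀ᶠ x in 𝓝 (1 : ℝ), Real.negMulLog x < ε / (r + 1) :=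
    (hc.tendsto 1).eventually (gt_mem_nhds (by simp; positivity))
  obtain ⟨δ₀, hδ₀, H0⟩ := Metric.eventually_nhds_iff.1 h0
  obtain ⟨δ₁, hδ₁, H1⟩ := Metric.eventually_nhds_iff.1 h1
  refine ⟨min δ₀ δ₁, lt_min hδ₀ hδ₁, fun μ _ d hd hμ => ?_⟩
  have key : ∀ s : Fin (r + 1), Real.negMulLog (μ.real (d ⁻¹' {s})) < ε / (r + 1) := by
    intro s
    by_cases hs : s = 0
    · subst hs
      apply H1
      have hcompl : d ⁻¹' {0} = {ξ | d ξ ≠ 0}ᶜ := by ext; simp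
      have hm : MeasurableSet {ξ | d ξ ≠ 0} := (hd (measurableSet_singleton 0)).compl
      rw [hcompl, probReal_compl_eq_one_sub hm, Real.dist_eq]
      have := measureReal_nonneg (μ := μ) (s := {ξ | d ξ ≠ 0})
      rw [abs_lt]
      have := hμ.trans_le (min_le_right δ₀ δ₁)
      constructor <;> linarith
    · apply H0
      rw [Real.dist_eq, sub_zero, abs_of_nonneg measureReal_nonneg]
      refine lt_of_le_of_lt (measureReal_mono fun ξ hξ => ?_) (hμ.trans_le (min_le_left _ _))
      simp only [mem_preimage, mem_singleton_iff] at hξ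
      simp [hξ, hs]
  calc shannon μ d < ∑ _s : Fin (r + 1), ε / (r + 1) :=
        Finset.sum_lt_sum_of_nonempty Finset.univ_nonempty fun s _ => key s
    _ = ε := by simp; field_simp

/-- Each atom of `q` is approximated within δ/r by a set depending on finitely many letters. Off the
union of the symmetric differences a point lies in exactly one of these sets, that of its own atom.
-/
theorem exists_determined_partition (μ : Measure (ℕ → Fin p)) [IsProbabilityMeasure μ] {r : ℕ}
    {q : (ℕ → Fin p) → Fin r} (hq : Measurable q) {δ : ℝ} (hδ : 0 < δ) :
    ∃ (N : ℕ) (F : (Fin N → Fin p) → Fin r),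
      μ.real {ξ | q ξ ≠ F (initial N ξ)} < δ := by
  classical
  obtain ⟨ξ₀⟩ : Nonempty (ℕ → Fin p) := nonempty_of_isProbabilityMeasure μ
  have hr : 0 < (r : ℝ) := by exact_mod_cast (q ξ₀).pos
  choose n C hC hμ using fun j : Fin r => exists_determined_approx μ
    (hq (measurableSet_singleton j)) (div_pos hδ hr)
  set N := Finset.univ.sup n with hN
  have hCN : ∀ j, IsDetermined N (C j) := fun j =>
    (hC j).mono (Finset.le_sup (f := n) (Finset.mem_univ j))
  -- `g` picks an index among the approximating sets that contain the point, with an arbitrary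
  -- default. `ext` completes a finite word arbitrarily, which is harmless because membership
  -- depends on the first `N` letters only.
  let g : Set (Fin r) → Fin r := fun s => if h : s.Nonempty then h.some else q ξ₀
  let ext : (Fin N → Fin p) → ℕ → Fin p := fun u k => if h : k < N then u ⟨k, h⟩ else ξ₀ k
  have hext : ∀ ξ, pre (ext (initial N ξ)) N = pre ξ N := fun ξ =>
    pre_eq_pre_iff.2 fun k hk => by simp [ext, hk, initial]
  refine ⟨N, fun u => g {j | ext u ∈ C j}, ?_⟩
  have hF : ∀ ξ, g {j | ext (initial N ξ) ∈ C j} = g {j | ξ ∈ C j} := by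
    intro ξ
    congr 1
    ext j
    exact ⟨hCN j _ _ (hext ξ), hCN j _ _ (hext ξ).symm⟩
  simp only [hF]
  have hsub : {ξ | q ξ ≠ g {j | ξ ∈ C j}} ⊆
      ⋃ j ∈ (Finset.univ : Finset (Fin r)), symmDiff (C j) (q ⁻¹' {j}) := by
    intro ξ hξ
    by_contra hcon
    simp only [mem_iUnion, not_exists, Finset.mem_univ, exists_prop, true_and] at hcon
    have h1 : ∀ j, ξ ∈ C j ↔ q ξ = j := by
      intro j
      have := hcon j
      rw [mem_symmDiff] at this
      simp only [mem_preimage, mem_singleton_iff] at this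
      tauto
    have h2 : {j | ξ ∈ C j} = {q ξ} := by
      ext j; simp [h1, eq_comm]
    apply hξ
    rw [h2]
    have h3 : ({q ξ} : Set (Fin r)).Nonempty := singleton_nonempty _
    simp only [g, h3, dif_pos]
    exact (mem_singleton_iff.1 h3.some_mem).symm
  calc μ.real {ξ | q ξ ≠ g {j | ξ ∈ C j}}
      ≤ μ.real (⋃ j ∈ (Finset.univ : Finset (Fin r)), symmDiff (C j) (q ⁻¹' {j})) :=
        measureReal_mono hsub (measure_ne_top _ _)
    _ ≤ ∑ j, μ.real (symmDiff (C j) (q ⁻¹' {j})) := measureReal_biUnion_finset_le _ _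
    _ < ∑ _j : Fin r, δ / r :=
        Finset.sum_lt_sum_of_nonempty ⟨q ξ₀, Finset.mem_univ _⟩ fun j _ => hμ j
    _ = δ := by simp; field_simp

/-- The Kolmogorov–Sinai theorem for the partition into cylinders of length one. -/
theorem entropy_shift_le {μ : Measure (ℕ → Fin p)} [IsProbabilityMeasure μ]
    (hμ : MeasurePreserving shift μ μ) {n : ℕ} (hn : n ≠ 0) :
    entropy shift μ ≤ ((refinementEntropy shift μ (fun ξ => ξ 0) n / n : ℝ) : EReal) := by
  have h0 : Measurable fun ξ : ℕ → Fin p => ξ 0 := measurable_pi_apply 0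
  refine le_trans ?_ (EReal.coe_le_coe_iff.2 (refinementEntropy_lim_le hμ h0 hn))
  have hlim := refinementEntropy_div_tendsto hμ h0
  set H := (refinementEntropy_subadditive hμ h0).lim
  refine iSup_le fun r => iSup_le fun q => iSup_le fun hq => limsup_coe_le fun ε hε => ?_
  obtain ⟨δ, hδ, hδ'⟩ := exists_shannon_lt (p := p) r (show 0 < ε / 3 by positivity)
  obtain ⟨N, F, hF⟩ := exists_determined_partition μ hq hδ
  set q' : (ℕ → Fin p) → Fin r := fun ξ => F (initial N ξ) with hq'
  have hq'm : Measurable q' := (measurable_of_finite F).comp (measurable_initial N)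
  have hd : shannon μ (fun x => if q x = q' x then (0 : Fin (r + 1)) else (q x).succ) < ε / 3 := by
    refine hδ' μ _ (Measurable.ite (measurableSet_eq_fun hq hq'm) measurable_const
      ((measurable_of_finite Fin.succ).comp hq)) (lt_of_le_of_lt (measureReal_mono ?_) hF)
    intro ξ hξ
    simp only [mem_ofPred_eq] at hξ ⊢
    intro h
    exact hξ (by simp [hq', h])
  -- The values of `q'` along `n` iterates can be read off from the first `n + N` letters. The
  -- overhead `N` disappears after division by `n`.
  have hnames : ∀ n, refinementEntropy shift μ q' n ≤
      refinementEntropy shift μ (fun ξ => ξ 0) (n + N) := by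
    intro n
    let F' : (Fin (n + N) → Fin p) → Fin n → Fin r := fun u k =>
      F fun i => u ⟨k + i, by omega⟩
    have e : (fun x => fun k : Fin n => q' (shift^[k] x)) =
        F' ∘ fun x => fun k : Fin (n + N) => (fun ξ : ℕ → Fin p => ξ 0) (shift^[k] x) := by
      funext x k
      simp only [hq', F', Function.comp, shift_iterate_apply, zero_add]
      congr 1
      funext i
      simp [initial, shift_iterate_apply, add_comm]
    rw [refinementEntropy_eq_shannon, refinementEntropy_eq_shannon, e]
    exact shannon_comp_le (measurable_names measurable_shift h0 _) F'
  have hN : Tendsto (fun n : ℕ => refinementEntropy shift μ (fun ξ => ξ 0) N / n) atTop (𝓝 0) :=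
    tendsto_const_div_atTop_nhds_zero_nat _
  filter_upwards [hlim.eventually (gt_mem_nhds (show H < H + ε / 3 by linarith)),
    hN.eventually (gt_mem_nhds (show 0 < ε / 3 by positivity)), eventually_gt_atTop 0]
    with n h1 h2 hn0
  have hn0' : (0 : ℝ) < n := by exact_mod_cast hn0
  have a1 := refinementEntropy_le_add hμ hq hq'm n
  have a2 := hnames n
  have a3 := refinementEntropy_subadditive hμ h0 n N
  have a4 : refinementEntropy shift μ q n ≤ refinementEntropy shift μ (fun ξ => ξ 0) n +
      refinementEntropy shift μ (fun ξ => ξ 0) N + n * (ε / 3) := by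
    have := mul_le_mul_of_nonneg_left hd.le hn0'.le
    linarith
  calc refinementEntropy shift μ q n / n
      ≤ (refinementEntropy shift μ (fun ξ => ξ 0) n +
          refinementEntropy shift μ (fun ξ => ξ 0) N + n * (ε / 3)) / n := by gcongr
    _ = refinementEntropy shift μ (fun ξ => ξ 0) n / n +
          refinementEntropy shift μ (fun ξ => ξ 0) N / n + ε / 3 := by field_simp
    _ ≤ H + ε := by linarith

end Generator

end PMM

namespace PMM

/-! ### Weighted sums of point masses and their limits. -/

section WeightedDirac

variable {Ω ι : Type*} [MeasurableSpace Ω]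

/-- The normalised sum of point masses of weight `w i` at `x i`, for `i ∈ s`. -/
noncomputable def weightedDirac (s : Finset ι) (w : ι → ℝ) (x : ι → Ω) : Measure Ω :=
  ∑ i ∈ s, ENNReal.ofReal (w i / ∑ j ∈ s, w j) • Measure.dirac (x i)

variable {s : Finset ι} {w : ι → ℝ} {x : ι → Ω}

open Classical in
theorem weightedDirac_real_apply (hw : ∀ i ∈ s, 0 ≤ w i) {E : Set Ω} (hE : MeasurableSet E) :
    (weightedDirac s w x).real E = (∑ i ∈ s with x i ∈ E, w i) / ∑ i ∈ s, w i := by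
  have h0 : ∀ i ∈ s, 0 ≤ w i / ∑ j ∈ s, w j := fun i hi =>
    div_nonneg (hw i hi) (Finset.sum_nonneg hw)
  rw [measureReal_def, weightedDirac, Measure.finsetSum_apply]
  rw [ENNReal.toReal_sum, Finset.sum_filter, Finset.sum_div]
  · refine Finset.sum_congr rfl fun i hi => ?_
    rw [Measure.smul_apply, Measure.dirac_apply' _ hE, smul_eq_mul, ENNReal.toReal_mul,
      ENNReal.toReal_ofReal (h0 i hi)]
    by_cases h : x i ∈ E <;> simp [h]
  · intro i _
    rw [Measure.smul_apply, Measure.dirac_apply' _ hE, smul_eq_mul]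
    refine ENNReal.mul_ne_top ENNReal.ofReal_ne_top ?_
    by_cases h : x i ∈ E <;> simp [h]

theorem isProbabilityMeasure_weightedDirac (hw : ∀ i ∈ s, 0 ≤ w i) (hpos : 0 < ∑ i ∈ s, w i) :
    IsProbabilityMeasure (weightedDirac s w x) := by
  have h := weightedDirac_real_apply (x := x) hw MeasurableSet.univ
  simp only [mem_univ, Finset.filter_true, div_self hpos.ne'] at h
  refine ⟨?_⟩
  rw [measureReal_def] at h
  rwa [ENNReal.toReal_eq_one_iff] at h

theorem integral_weightedDirac [MeasurableSingletonClass Ω] (hw : ∀ i ∈ s, 0 ≤ w i) (g : Ω → ℝ) :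
    ∫ y, g y ∂(weightedDirac s w x) = (∑ i ∈ s, w i * g (x i)) / ∑ i ∈ s, w i := by
  have h0 : ∀ i ∈ s, 0 ≤ w i / ∑ j ∈ s, w j := fun i hi =>
    div_nonneg (hw i hi) (Finset.sum_nonneg hw)
  rw [weightedDirac, integral_finsetSum_measure]
  · rw [Finset.sum_div]
    refine Finset.sum_congr rfl fun i hi => ?_
    rw [integral_smul_measure, integral_dirac, ENNReal.toReal_ofReal (h0 i hi), smul_eq_mul]
    ring
  · intro i _
    exact (integrable_dirac (by simp)).smul_measure ENNReal.ofReal_ne_top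

end WeightedDirac

section Limits

variable {p : ℕ}

/-- The probability measures on the compact space of sequences form a compact space. Limits along an
ultrafilter replace the extraction of subsequences. -/
theorem exists_ultralimit (U : Ultrafilter ℕ) (μs : ℕ → ProbabilityMeasure (ℕ → Fin p)) :
    ∃ μ : ProbabilityMeasure (ℕ → Fin p), Tendsto μs U (𝓝 μ) := by
  obtain ⟨μ, -, h⟩ := isCompact_iff_ultrafilter_le_nhds.1
    (isCompact_univ (X := ProbabilityMeasure (ℕ → Fin p))) (U.map μs) (by simp)
  exact ⟨μ, h⟩

/-- Such a set is clopen, hence has empty frontier and passes to weak limits. -/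
theorem IsDetermined.tendsto_real {F : Filter ℕ} {μs : ℕ → ProbabilityMeasure (ℕ → Fin p)}
    {μ : ProbabilityMeasure (ℕ → Fin p)} (h : Tendsto μs F (𝓝 μ)) {n : ℕ}
    {C : Set (ℕ → Fin p)} (hC : IsDetermined n C) :
    Tendsto (fun i => (μs i : Measure (ℕ → Fin p)).real C) F
      (𝓝 ((μ : Measure (ℕ → Fin p)).real C)) := by
  have h1 := ProbabilityMeasure.tendsto_measure_of_null_frontier_of_tendsto' h (E := C)
    (by rw [hC.isClopen.frontier_eq]; simp)
  exact (ENNReal.tendsto_toReal (measure_ne_top _ _)).comp h1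

theorem measure_closed_of_tendsto {F : Filter ℕ} [F.NeBot]
    {μs : ℕ → ProbabilityMeasure (ℕ → Fin p)}
    {μ : ProbabilityMeasure (ℕ → Fin p)} (h : Tendsto μs F (𝓝 μ)) {C : Set (ℕ → Fin p)}
    (hC : IsClosed C) {a : ENNReal} (ha : ∀ i, a ≤ (μs i : Measure (ℕ → Fin p)) C) :
    a ≤ (μ : Measure (ℕ → Fin p)) C := by
  refine le_trans ?_ (ProbabilityMeasure.limsup_measure_closed_le_of_tendsto h hC)
  exact le_limsup_of_frequently_le (Eventually.of_forall ha).frequently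

theorem measurePreserving_shift_of_determined {μ : Measure (ℕ → Fin p)} [IsProbabilityMeasure μ]
    (h : ∀ (n : ℕ) (C : Set (ℕ → Fin p)), IsDetermined n C →
      μ.real (shift ⁻¹' C) = μ.real C) : MeasurePreserving shift μ μ := by
  refine ⟨measurable_shift, ?_⟩
  have := Measure.isProbabilityMeasure_map (μ := μ) measurable_shift.aemeasurable
  refine ext_of_cylinder fun n C hC => ?_
  rw [← h n C hC, measureReal_def, Measure.map_apply measurable_shift hC.measurableSet,
    measureReal_def]

/-- A limit of measures that are asymptotically shift invariant is shift invariant. -/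
theorem measurePreserving_shift_of_tendsto {F : Filter ℕ} [F.NeBot]
    {μs : ℕ → ProbabilityMeasure (ℕ → Fin p)}
    {μ : ProbabilityMeasure (ℕ → Fin p)} (h : Tendsto μs F (𝓝 μ))
    (hinv : ∀ (n : ℕ) (C : Set (ℕ → Fin p)), IsDetermined n C → Tendsto (fun i =>
      (μs i : Measure (ℕ → Fin p)).real (shift ⁻¹' C) - (μs i : Measure (ℕ → Fin p)).real C) F
      (𝓝 0)) : MeasurePreserving shift (μ : Measure (ℕ → Fin p)) μ := by
  refine measurePreserving_shift_of_determined fun n C hC => ?_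
  have h1 := (IsDetermined.tendsto_real h (hC.shift_preimage 1)).sub (hC.tendsto_real h)
  exact sub_eq_zero.1 (tendsto_nhds_unique h1 (hinv n C hC))

end Limits

/-! ### Construction of the Gibbs measure. -/

section GibbsMeasure

variable {p : ℕ}

/-- A subshift with a potential and an increasing family of collections of words that have
specification and bounded distortion and exhaust the language up to an arbitrarily small
proportion. -/
structure GibbsDecomposition (X : Set (ℕ → Fin p)) (ψ : (ℕ → Fin p) → ℝ)
    (GM : ℕ → Set (List (Fin p))) (P B : ℝ) : Prop where
  isClosed : IsClosed X
  mapsTo : MapsTo shift X X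
  continuous : Continuous ψ
  bound : ∀ ξ, |ψ ξ| ≤ B
  mono : Monotone GM
  spec : ∀ M, SpecS X (GM M)
  bowen : ∀ M, ∃ V, ∀ w ∈ GM M, ∀ ξ ∈ cylinder X w,
    symSup X ψ w ≤ birkhoffSum shift ψ w.length ξ + V
  lower : ∀ n : ℕ, Real.exp (n * P) ≤ wordSum (symSup X ψ) (language X) n
  upper : ∃ K, ∀ n : ℕ, wordSum (symSup X ψ) (language X) n ≤ K * Real.exp (n * P)
  tail : ∀ ε > 0, ∃ M, ∀ n : ℕ,
    wordSum (symSup X ψ) (language X \ GM M) n ≤ ε * Real.exp (n * P)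

variable {X : Set (ℕ → Fin p)} {ψ : (ℕ → Fin p) → ℝ} {GM : ℕ → Set (List (Fin p))} {P B : ℝ}

/-- Words containing `w` at a fixed place are cut into prefix, `w` and suffix, and the weight is
subadditive. This is the source of the upper Gibbs bound. -/
theorem wordSum_middle_le (hX : MapsTo shift X X) (hB : ∀ y, |ψ y| ≤ B) (j n : ℕ)
    (w : List (Fin p)) :
    wordSum (symSup X ψ) {x | x ∈ language X ∧ ∃ a b, a.length = j ∧ x = a ++ w ++ b}
      (j + w.length + n) ≤
      wordSum (symSup X ψ) (language X) j * Real.exp (symSup X ψ w) *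
        wordSum (symSup X ψ) (language X) n := by
  classical
  have hG : wordSum (symSup X ψ) {w} w.length ≤ Real.exp (symSup X ψ w) := by
    have : wordsIn {w} w.length = {w} := by ext v; simp; rintro rfl; rfl
    rw [wordSum, this, Finset.sum_singleton]
  -- words are decomposed with a prefix of length `j` and the middle word `w`
  have h := wordSum_le_of_decomposition (c := symSup X ψ)
    (E := {x | x ∈ wordsIn (language X) (j + w.length + n) ∧ ∃ a b, a.length = j ∧ x = a ++ w ++ b})
    (C := language X) (G := {w}) (Q := fun i k => i = j ∧ k = n)
    (fun u v w' hx => symSup_append_append_le hX hB (mem_wordsIn.1 hx.1).2)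
    (by
      rintro x ⟨hx, a, b, ha, rfl⟩
      rw [mem_wordsIn] at hx
      refine ⟨a, language_append_left (language_append_left hx.2), w, rfl, b,
        language_append_right hX hx.2, ⟨ha, ?_⟩, rfl⟩
      have := hx.1
      simp at this
      omega) (j + w.length + n)
  have hf : (Finset.range (j + w.length + n + 1) ×ˢ Finset.range (j + w.length + n + 1)).filter
      (fun i : ℕ × ℕ => i.1 + i.2 ≤ j + w.length + n ∧ i.1 = j ∧ i.2 = n) = {(j, n)} := by
    ext ⟨a, b⟩
    simp only [Finset.mem_filter, Finset.mem_product, Finset.mem_range, Finset.mem_singleton,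
      Prod.mk.injEq]
    omega
  rw [hf, Finset.sum_singleton] at h
  have hlen : j + w.length + n - j - n = w.length := by omega
  simp only [hlen] at h
  refine le_trans (le_of_eq ?_) (h.trans ?_)
  · refine Finset.sum_congr ?_ fun _ _ => rfl
    ext x
    simp only [mem_wordsIn, mem_ofPred_eq]
    tauto
  · gcongr
    · exact wordSum_nonneg _ _ _
    · exact wordSum_nonneg _ _ _

theorem exists_eq_append_of_mem_cylinder {x w : List (Fin p)} {ξ : ℕ → Fin p}
    (hξ : ξ ∈ cylinder X x) {j n : ℕ} (hx : x.length = j + w.length + n)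
    (hw : shift^[j] ξ ∈ cylinder univ w) : ∃ a b, a.length = j ∧ x = a ++ w ++ b := by
  refine ⟨pre ξ j, pre (shift^[j + w.length] ξ) n, length_pre _ _, ?_⟩
  rw [← pre_eq_of_mem_cylinder hξ hx, pre_add, pre_add, pre_eq_of_mem_cylinder hw rfl]

namespace GibbsDecomposition

variable (h : GibbsDecomposition X ψ GM P B)
include h

theorem exists_le_wordSum : ∃ M₀, ∀ M ≥ M₀, ∀ n : ℕ,
    1 / 2 * Real.exp (n * P) ≤ wordSum (symSup X ψ) (GM M) n := by
  obtain ⟨M₀, hM⟩ := h.tail (1 / 2) (by norm_num)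
  refine ⟨M₀, fun M hMM n => ?_⟩
  have h1 := wordSum_le_add (symSup X ψ) (language X) (GM M₀) n
  have h2 : wordSum (symSup X ψ) (language X ∩ GM M₀) n ≤ wordSum (symSup X ψ) (GM M) n :=
    wordSum_mono _ (inter_subset_right.trans (h.mono hMM)) n
  linarith [h.lower n, hM n]

/-- The lower bound on the weight of the words of length `i + l + ...` in which `u` and `v` occur
at prescribed places. -/
theorem exists_two_word_bound (M : ℕ) : ∃ κ > 0, ∃ t : ℕ, ∀ u ∈ GM M, ∀ v ∈ GM M,
    ∀ i l n : ℕ, t ≤ i → u.length + 2 * t ≤ l → i + l + v.length + t ≤ n →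
    κ * (Real.exp (symSup X ψ u - u.length * P) * Real.exp (symSup X ψ v - v.length * P)) *
      Real.exp (n * P) ≤ wordSum (symSup X ψ) {x | x ∈ language X ∧ ∀ ξ ∈ cylinder X x,
        shift^[i] ξ ∈ cylinder univ u ∩ shift^[l] ⁻¹' cylinder univ v} n := by
  obtain ⟨M₀, hM₀⟩ := h.exists_le_wordSum
  -- At this level the collection contains `u` and `v`, and it carries at least half of e^{nP} at
  -- every length, as the free blocks require.
  set M' := max M M₀
  obtain ⟨t, ht⟩ := h.spec M'
  obtain ⟨V, hV⟩ := h.bowen M'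
  -- Five blocks and four gaps cost e^{5V + 4tB}, three free blocks give (1/2)^3, and the four gaps
  -- lose length 4t, hence e^{-4tP}.
  refine ⟨Real.exp (-((4 + 1) * V + 4 * (t * B))) * (1 / 8) * Real.exp (-(4 * t * P)),
    by positivity, t, fun u hu v hv i l n hi hl hn => ?_⟩
  have hu' := h.mono (le_max_left M M₀) hu
  have hv' := h.mono (le_max_left M M₀) hv
  -- The pattern is free, `u`, free, `v`, free. The free lengths are chosen so that, counting the
  -- gaps of length `t`, `u` starts at `i`, `v` starts at `i + l` and the total length is `n`.
  let E : Fin (4 + 1) → Set (List (Fin p)) := ![GM M', {u}, GM M', {v}, GM M']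
  let N : Fin (4 + 1) → ℕ := ![i - t, u.length, l - u.length - 2 * t, v.length,
    n - i - l - v.length - t]
  have hE : ∀ k, E k ⊆ GM M' := by
    intro k
    fin_cases k
    · exact Subset.rfl
    · exact singleton_subset_iff.2 hu'
    · exact Subset.rfl
    · exact singleton_subset_iff.2 hv'
    · exact Subset.rfl
  have hN : ∑ k, N k + 4 * t = n := by
    simp [Fin.sum_univ_succ, N]
    omega
  have key := prod_wordSum_le h.mapsTo h.bound N (E := E) (V := V) (t := t)
    (fun k w hw => hV w (hE k hw)) (fun w hw => ht 4 w fun k => hE k (hw k))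
  rw [hN] at key
  have hsing : ∀ w : List (Fin p),
      wordSum (symSup X ψ) {w} w.length = Real.exp (symSup X ψ w) := by
    intro w
    have : wordsIn {w} w.length = {w} := by ext v; simp; rintro rfl; rfl
    rw [wordSum, this, Finset.sum_singleton]
  have hprod : ∏ k, wordSum (symSup X ψ) (E k) (N k) =
      wordSum (symSup X ψ) (GM M') (i - t) * Real.exp (symSup X ψ u) *
      wordSum (symSup X ψ) (GM M') (l - u.length - 2 * t) * Real.exp (symSup X ψ v) *
      wordSum (symSup X ψ) (GM M') (n - i - l - v.length - t) := by
    simp [Fin.prod_univ_succ, E, N, hsing]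
    ring
  rw [hprod] at key
  have hlow := hM₀ M' (le_max_right _ _)
  have step : (1 / 2 * Real.exp ((i - t : ℕ) * P)) * Real.exp (symSup X ψ u) *
      (1 / 2 * Real.exp ((l - u.length - 2 * t : ℕ) * P)) * Real.exp (symSup X ψ v) *
      (1 / 2 * Real.exp ((n - i - l - v.length - t : ℕ) * P)) ≤
      Real.exp ((4 + 1) * V + 4 * (t * B)) *
        wordSum (symSup X ψ) (gluedWords X E N t) n := by
    refine le_trans ?_ (key.trans (by norm_num))
    have mul5 : ∀ x x' y y' z z' c d : ℝ, 0 ≤ x → x ≤ x' → 0 ≤ y → y ≤ y' → 0 ≤ z → z ≤ z' →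
        0 ≤ c → 0 ≤ d → x * c * y * d * z ≤ x' * c * y' * d * z' := by
      intro x x' y y' z z' c d hx hx' hy hy' hz hz' hc hd
      have := hx.trans hx'
      have := hy.trans hy'
      gcongr
    apply mul5 <;> first | exact hlow _ | positivity
  have hsub : gluedWords X E N t ⊆ {x | x ∈ language X ∧ ∀ ξ ∈ cylinder X x,
      shift^[i] ξ ∈ cylinder univ u ∩ shift^[l] ⁻¹' cylinder univ v} := by
    rintro x ⟨hx, w, b, hw, hb, rfl⟩
    refine ⟨hx, fun ξ hξ => ?_⟩
    have hw0 : (w 0).length = i - t := (hw 0).2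
    have hw1 : w 1 = u := (hw 1).1
    have hw2 : (w 2).length = l - u.length - 2 * t := (hw 2).2
    have hw3 : w 3 = v := (hw 3).1
    rw [glue_succ, glue_succ, glue_succ, glue_succ] at hξ
    have g1 := mem_cylinder_append_right h.mapsTo (mem_cylinder_append_right h.mapsTo hξ)
    have g2 := mem_cylinder_append_right h.mapsTo (mem_cylinder_append_right h.mapsTo g1)
    have g3 := mem_cylinder_append_right h.mapsTo (mem_cylinder_append_right h.mapsTo g2)
    have g1' := (mem_cylinder_append.1 g1).1
    have g3' := (mem_cylinder_append.1 g3).1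
    rw [cylinder_eq_inter] at g1' g3'
    have f1 := g1'.2
    have f3 := g3'.2
    simp only [← Function.iterate_add_apply, hb] at f1 f3
    change shift^[t + (w 0).length] ξ ∈ cylinder univ (w 1) at f1
    change shift^[t + ((w 2).length + (t + ((w 1).length + (t + (w 0).length))))] ξ ∈
      cylinder univ (w 3) at f3
    rw [hw0, hw1, show t + (i - t) = i by omega] at f1
    rw [hw0, hw1, hw2, hw3,
      show t + (l - u.length - 2 * t + (t + (u.length + (t + (i - t))))) = l + i by omega] at f3
    exact ⟨f1, by simpa only [mem_preimage, ← Function.iterate_add_apply] using f3⟩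
  have step2 := step.trans (mul_le_mul_of_nonneg_left (wordSum_mono _ hsub n)
    (Real.exp_pos ((4 + 1) * V + 4 * (t * B))).le)
  set W := wordSum (symSup X ψ) {x | x ∈ language X ∧ ∀ ξ ∈ cylinder X x,
      shift^[i] ξ ∈ cylinder univ u ∩ shift^[l] ⁻¹' cylinder univ v} n
  have hcast : ((n - i - l - v.length - t : ℕ) : ℝ) = n - i - l - v.length - t := by
    rw [Nat.cast_sub (by omega), Nat.cast_sub (by omega), Nat.cast_sub (by omega),
      Nat.cast_sub (by omega)]
  have hcast2 : ((l - u.length - 2 * t : ℕ) : ℝ) = l - u.length - 2 * t := by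
    rw [Nat.cast_sub (by omega), Nat.cast_sub (by omega)]; push_cast; ring
  have hcast3 : ((i - t : ℕ) : ℝ) = i - t := by rw [Nat.cast_sub hi]
  rw [hcast, hcast2, hcast3] at step2
  have e : Real.exp (-((4 + 1) * V + 4 * (t * B))) * (1 / 8) * Real.exp (-(4 * t * P)) *
      (Real.exp (symSup X ψ u - u.length * P) * Real.exp (symSup X ψ v - v.length * P)) *
      Real.exp (n * P) = Real.exp (-((4 + 1) * V + 4 * (t * B))) *
      ((1 / 2 * Real.exp ((i - t : ℝ) * P)) * Real.exp (symSup X ψ u) *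
      (1 / 2 * Real.exp ((l - u.length - 2 * t : ℝ) * P)) * Real.exp (symSup X ψ v) *
      (1 / 2 * Real.exp ((n - i - l - v.length - t : ℝ) * P))) := by
    have : ∀ a b c d e f g : ℝ, a + b + c + d = e + f + g → ∀ x y z : ℝ,
        x * (1 / 8) * Real.exp a * (Real.exp (y + b) * Real.exp (z + c)) * Real.exp d =
        x * (1 / 2 * Real.exp e * Real.exp y * (1 / 2 * Real.exp f) * Real.exp z *
          (1 / 2 * Real.exp g)) := by
      intro a b c d e f g habc x y z
      have : Real.exp a * Real.exp b * Real.exp c * Real.exp d =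
          Real.exp e * Real.exp f * Real.exp g := by
        rw [← Real.exp_add, ← Real.exp_add, ← Real.exp_add, habc, Real.exp_add, Real.exp_add]
      rw [Real.exp_add, Real.exp_add]
      linear_combination x * (1 / 8) * Real.exp y * Real.exp z * this
    simp only [sub_eq_add_neg (symSup X ψ _)]
    apply this
    ring
  rw [e]
  calc _ ≤ Real.exp (-((4 + 1) * V + 4 * (t * B))) *
        (Real.exp ((4 + 1) * V + 4 * (t * B)) * W) := by gcongr
    _ = W := by rw [← mul_assoc, ← Real.exp_add]; simp

end GibbsDecomposition

end GibbsMeasure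

end PMM

namespace PMM

variable {p : ℕ} {X : Set (ℕ → Fin p)} {ψ : (ℕ → Fin p) → ℝ} {GM : ℕ → Set (List (Fin p))}
  {P B : ℝ}

/-- An invariant measure on a subshift with the weak Gibbs property and a weak form of mixing. -/
structure IsSymbolicGibbs (X : Set (ℕ → Fin p)) (ψ : (ℕ → Fin p) → ℝ)
    (GM : ℕ → Set (List (Fin p))) (P : ℝ) (μ : Measure (ℕ → Fin p)) : Prop where
  prob : IsProbabilityMeasure μ
  measurePreserving : MeasurePreserving shift μ μ
  compl : μ Xᶜ = 0
  upper : ∃ K > 0, ∀ w ∈ language X,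
    μ.real (cylinder univ w) ≤ K * Real.exp (symSup X ψ w - w.length * P)
  lower : ∀ M, ∃ κ > 0, ∀ u ∈ GM M, ∀ v ∈ GM M, ∃ l₀, ∀ l ≥ l₀,
    κ * (Real.exp (symSup X ψ u - u.length * P) * Real.exp (symSup X ψ v - v.length * P)) ≤
      μ.real (cylinder univ u ∩ shift^[l] ⁻¹' cylinder univ v)

namespace GibbsDecomposition

variable (h : GibbsDecomposition X ψ GM P B)
include h

theorem exists_upper : ∃ K > 0, ∀ n : ℕ,
    wordSum (symSup X ψ) (language X) n ≤ K * Real.exp (n * P) := by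
  obtain ⟨K, hK⟩ := h.upper
  refine ⟨K, ?_, hK⟩
  have := (h.lower 0).trans (hK 0)
  simp at this
  linarith

/-- For every word of length 3(N+1) a point of its cylinder is chosen and weighted like the word.
These masses are averaged along the middle third of the orbit and a limit is taken. Words of bounded
length then occur far from both ends, so that the counting bounds apply uniformly in the position.
-/
theorem exists_gibbsMeasure : ∃ μ, IsSymbolicGibbs X ψ GM P μ := by
  classical
  obtain ⟨K, hK0, hK⟩ := h.exists_upper
  have hex : ∀ w, ∃ ξ, w ∈ language X → ξ ∈ cylinder X w := by
    intro w
    by_cases hw : w ∈ language X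
    · obtain ⟨ξ, hξ⟩ := id hw
      exact ⟨ξ, fun _ => hξ⟩
    · obtain ⟨ξ, -⟩ : ([] : List (Fin p)) ∈ language X := by
        have h0 := (Real.exp_pos _).trans_le (h.lower 0)
        obtain ⟨w, hw, -⟩ := Finset.exists_ne_zero_of_sum_ne_zero h0.ne'
        rw [mem_wordsIn, List.length_eq_zero_iff] at hw
        exact hw.1 ▸ hw.2
      exact ⟨ξ, fun h => absurd h hw⟩
  choose ξ hξ using hex
  set c := symSup X ψ with hc
  let W : ℕ → Finset (List (Fin p)) := fun N => wordsIn (language X) (3 * N)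
  let Z : ℕ → ℝ := fun N => wordSum c (language X) (3 * N)
  have hZlow : ∀ N, Real.exp ((3 * N : ℕ) * P) ≤ Z N := fun N => h.lower _
  have hZup : ∀ N, Z N ≤ K * Real.exp ((3 * N : ℕ) * P) := fun N => hK _
  have hZpos : ∀ N, 0 < Z N := fun N => (Real.exp_pos _).trans_le (hZlow N)
  -- The index is `N + 1` instead of `N` to keep the average nonempty. The shifts run from N+1 to
  -- 2N+1.
  let m : ℕ → Measure (ℕ → Fin p) := fun N => weightedDirac (Finset.range (N + 1) ×ˢ W (N + 1))
    (fun q => Real.exp (c q.2)) (fun q => shift^[N + 1 + q.1] (ξ q.2))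
  let a : ℕ → Set (ℕ → Fin p) → ℕ → ℝ := fun N C k =>
    ∑ x ∈ W N with shift^[N + k] (ξ x) ∈ C, Real.exp (c x)
  have htot : ∀ N, ∑ q ∈ Finset.range (N + 1) ×ˢ W (N + 1), Real.exp (c q.2) =
      (N + 1 : ℕ) * Z (N + 1) := by
    intro N
    rw [Finset.sum_product]
    simp [Z, W, wordSum]
  have htotpos : ∀ N : ℕ, 0 < (N + 1 : ℕ) * Z (N + 1) := fun N =>
    mul_pos (by positivity) (hZpos _)
  have hprob : ∀ N, IsProbabilityMeasure (m N) := fun N =>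
    isProbabilityMeasure_weightedDirac (fun _ _ => (Real.exp_pos _).le)
      (by rw [htot]; exact htotpos N)
  have hreal : ∀ N C, MeasurableSet C → (m N).real C =
      (∑ k ∈ Finset.range (N + 1), a (N + 1) C k) / ((N + 1 : ℕ) * Z (N + 1)) := by
    intro N C hC
    rw [weightedDirac_real_apply (fun _ _ => (Real.exp_pos _).le) hC, htot, Finset.sum_filter,
      Finset.sum_product]
    simp only [a, Finset.sum_filter]
  have ha0 : ∀ N C k, 0 ≤ a N C k := fun N C k =>
    Finset.sum_nonneg fun _ _ => (Real.exp_pos _).le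
  have haZ : ∀ N C k, a N C k ≤ Z N := fun N C k =>
    Finset.sum_le_sum_of_subset_of_nonneg (Finset.filter_subset _ _)
      fun _ _ _ => (Real.exp_pos _).le
  let μs : ℕ → ProbabilityMeasure (ℕ → Fin p) := fun N => ⟨m N, hprob N⟩
  obtain ⟨μ, hμ⟩ := exists_ultralimit (hyperfilter ℕ) μs
  have hle : ((hyperfilter ℕ : Ultrafilter ℕ) : Filter ℕ) ≤ atTop := Nat.hyperfilter_le_atTop
  refine ⟨μ, inferInstance, ?_, ?_, ?_, ?_⟩
  · refine measurePreserving_shift_of_tendsto hμ fun n C hC => Tendsto.mono_left ?_ hle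
    have hbound : ∀ N, |(m N).real (shift ⁻¹' C) - (m N).real C| ≤ 1 / ((N : ℝ) + 1) := by
      intro N
      rw [hreal N _ (measurable_shift hC.measurableSet), hreal N _ hC.measurableSet, ← sub_div,
        ← Finset.sum_sub_distrib]
      have hshift : ∀ k, a (N + 1) (shift ⁻¹' C) k = a (N + 1) C (k + 1) := by
        intro k
        simp only [a, mem_preimage, ← Function.iterate_succ_apply' shift]
        rfl
      simp only [hshift]
      -- The difference telescopes to two boundary terms between 0 and the total weight, against N+1
      -- terms in the normalisation.
      rw [Finset.sum_range_sub, abs_div, abs_of_pos (htotpos N), div_le_div_iff₀ (htotpos N)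
        (by positivity)]
      have h1 := ha0 (N + 1) C (N + 1)
      have h2 := haZ (N + 1) C (N + 1)
      have h3 := ha0 (N + 1) C 0
      have h4 := haZ (N + 1) C 0
      have h5 : |a (N + 1) C (N + 1) - a (N + 1) C 0| ≤ Z (N + 1) := by
        rw [abs_le]; constructor <;> linarith
      push_cast
      nlinarith [hZpos (N + 1)]
    exact squeeze_zero_norm hbound tendsto_one_div_add_atTop_nhds_zero_nat
  · have hX1 : ∀ N, (μs N : Measure (ℕ → Fin p)) X = 1 := by
      intro N
      have hr : (m N).real X = 1 := by
        rw [hreal N X h.isClosed.measurableSet, div_eq_one_iff_eq (htotpos N).ne']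
        have : ∀ k, a (N + 1) X k = Z (N + 1) := by
          intro k
          simp only [a, Z, wordSum]
          rw [Finset.filter_true_of_mem]
          intro x hx
          exact shift_iterate_mem h.mapsTo _ (hξ x (mem_wordsIn.1 hx).2).1
        simp [this]
      rw [measureReal_def, ENNReal.toReal_eq_one_iff] at hr
      exact hr
    have := measure_closed_of_tendsto hμ h.isClosed fun N => (hX1 N).ge
    rw [prob_compl_eq_zero_iff h.isClosed.measurableSet]
    exact le_antisymm prob_le_one this
  -- One factor `K` comes from the prefixes and one from the suffixes. The total weight in the
  -- denominator is at least e^{3(N+1)P} with constant 1.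
  · refine ⟨K * K, by positivity, fun w hw => ?_⟩
    refine le_of_tendsto ((isDetermined_cylinder w).tendsto_real hμ)
      ((eventually_ge_atTop w.length).filter_mono hle |>.mono fun N hN => ?_)
    change (m N).real _ ≤ _
    rw [hreal N _ (measurableSet_cylinder w), div_le_iff₀ (htotpos N)]
    have hk : ∀ k ∈ Finset.range (N + 1), a (N + 1) (cylinder univ w) k ≤
        K * K * Real.exp (c w - w.length * P) * Real.exp ((3 * (N + 1) : ℕ) * P) := by
      intro k hk
      rw [Finset.mem_range] at hk
      set n := 3 * (N + 1) - (N + 1 + k) - w.length with hn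
      have hlen : 3 * (N + 1) = N + 1 + k + w.length + n := by omega
      have h1 : a (N + 1) (cylinder univ w) k ≤ wordSum c
          {x | x ∈ language X ∧ ∃ a b, a.length = N + 1 + k ∧ x = a ++ w ++ b}
          (N + 1 + k + w.length + n) := by
        refine Finset.sum_le_sum_of_subset_of_nonneg (fun x hx => ?_)
          fun _ _ _ => (Real.exp_pos _).le
        rw [Finset.mem_filter] at hx
        have hx1 := mem_wordsIn.1 hx.1
        rw [mem_wordsIn, ← hlen]
        exact ⟨hx1.1, hx1.2, exists_eq_append_of_mem_cylinder (hξ x hx1.2)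
          (hx1.1.trans hlen) hx.2⟩
      refine h1.trans ((wordSum_middle_le h.mapsTo h.bound _ _ w).trans ?_)
      calc wordSum c (language X) (N + 1 + k) * Real.exp (c w) * wordSum c (language X) n
          ≤ (K * Real.exp ((N + 1 + k : ℕ) * P)) * Real.exp (c w) *
              (K * Real.exp (n * P)) := by
            gcongr
            · exact wordSum_nonneg _ _ _
            · exact hK _
            · exact hK _
        _ = K * K * (Real.exp ((N + 1 + k : ℕ) * P) * Real.exp (c w) * Real.exp (n * P)) := by
            ring
        _ = _ := by
            rw [mul_assoc (K * K), ← Real.exp_add, ← Real.exp_add, ← Real.exp_add, hlen]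
            congr 2
            push_cast
            ring
    calc ∑ k ∈ Finset.range (N + 1), a (N + 1) (cylinder univ w) k
        ≤ ∑ k ∈ Finset.range (N + 1), K * K * Real.exp (c w - w.length * P) *
            Real.exp ((3 * (N + 1) : ℕ) * P) := Finset.sum_le_sum hk
      _ = K * K * Real.exp (c w - w.length * P) *
            ((N + 1 : ℕ) * Real.exp ((3 * (N + 1) : ℕ) * P)) := by
          rw [Finset.sum_const, Finset.card_range, nsmul_eq_mul]; ring
      _ ≤ _ := by
          gcongr
          exact hZlow _
  · intro M
    obtain ⟨κ, hκ, t, hκt⟩ := h.exists_two_word_bound M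
    -- The factor 1/K bounds the normalisation. The distance has to leave room for two gaps and a
    -- possibly empty free block between `u` and `v`.
    refine ⟨κ / K, by positivity, fun u hu v hv => ⟨u.length + 2 * t, fun l hl => ?_⟩⟩
    have hdet : IsDetermined (max u.length (v.length + l))
        (cylinder univ u ∩ shift^[l] ⁻¹' cylinder univ v) :=
      ((isDetermined_cylinder u).mono (le_max_left _ _)).inter
        (((isDetermined_cylinder v).shift_preimage l).mono (le_max_right _ _))
    refine ge_of_tendsto (hdet.tendsto_real hμ)
      ((eventually_ge_atTop (l + v.length + 2 * t)).filter_mono hle |>.mono fun N hN => ?_)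
    change _ ≤ (m N).real _
    set g := Real.exp (symSup X ψ u - u.length * P) * Real.exp (symSup X ψ v - v.length * P)
      with hg
    have hg0 : 0 < g := by positivity
    rw [hreal N _ hdet.measurableSet, le_div_iff₀ (htotpos N)]
    have hk : ∀ k ∈ Finset.range (N + 1), κ * g * Real.exp ((3 * (N + 1) : ℕ) * P) ≤
        a (N + 1) (cylinder univ u ∩ shift^[l] ⁻¹' cylinder univ v) k := by
      intro k hk
      rw [Finset.mem_range] at hk
      refine (hκt u hu v hv (N + 1 + k) l (3 * (N + 1)) (by omega) hl (by omega)).trans ?_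
      generalize hEE : cylinder univ u ∩ shift^[l] ⁻¹' cylinder univ v = E
      refine Finset.sum_le_sum_of_subset_of_nonneg (fun x hx => ?_)
          fun _ _ _ => (Real.exp_pos _).le
      rw [mem_wordsIn] at hx
      exact Finset.mem_filter.2 ⟨mem_wordsIn.2 ⟨hx.1, hx.2.1⟩, hx.2.2 _ (hξ x hx.2.1)⟩
    refine le_trans ?_ (Finset.sum_le_sum hk)
    rw [Finset.sum_const, Finset.card_range, nsmul_eq_mul]
    calc κ / K * g * ((N + 1 : ℕ) * Z (N + 1))
        ≤ κ / K * g * ((N + 1 : ℕ) * (K * Real.exp ((3 * (N + 1) : ℕ) * P))) := by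
          gcongr
          exact hZup _
      _ = _ := by field_simp

end GibbsDecomposition

end PMM

namespace PMM

variable {p : ℕ} {X : Set (ℕ → Fin p)} {ψ : (ℕ → Fin p) → ℝ} {GM : ℕ → Set (List (Fin p))}
  {P B : ℝ}

/-! ### Integrals, distortion, and a lower bound for the free energy. -/

section Variation

theorem exists_cylinder_subset {U : Set (ℕ → Fin p)} (hU : IsOpen U) {ξ : ℕ → Fin p}
    (hξ : ξ ∈ U) : ∃ n, cylinder univ (pre ξ n) ⊆ U := by
  obtain ⟨I, u, hu, hsub⟩ := isOpen_pi_iff.1 hU ξ hξ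
  refine ⟨I.sup id + 1, fun η hη => hsub fun i hi => ?_⟩
  have h1 := pre_eq_pre_iff.1 (pre_eq_of_mem_cylinder hη (length_pre _ _)) i
    (Nat.lt_succ_of_le (Finset.le_sup (f := id) hi))
  rw [h1]
  exact (hu i hi).2

theorem exists_uniform_variation (hψ : Continuous ψ) {ε : ℝ} (hε : 0 < ε) :
    ∃ m, ∀ ξ η, pre ξ m = pre η m → |ψ ξ - ψ η| ≤ ε := by
  have hopen : ∀ ζ, IsOpen {ξ | |ψ ξ - ψ ζ| < ε / 2} := fun ζ =>
    isOpen_lt (by fun_prop) continuous_const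
  have hmem : ∀ ζ, ζ ∈ {ξ | |ψ ξ - ψ ζ| < ε / 2} := fun ζ => by simp [hε]
  choose n hn using fun ζ => exists_cylinder_subset (hopen ζ) (hmem ζ)
  obtain ⟨t, -, ht⟩ := isCompact_univ.elim_nhds_subcover (fun ζ => cylinder univ (pre ζ (n ζ)))
    fun ζ _ => (isClopen_cylinder _).isOpen.mem_nhds (mem_cylinder_pre (mem_univ _) _)
  refine ⟨t.sup n, fun ξ η h => ?_⟩
  obtain ⟨ζ, hζ, hξ⟩ := mem_iUnion₂.1 (ht (mem_univ ξ))
  have hη : η ∈ cylinder univ (pre ζ (n ζ)) := by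
    refine isDetermined_cylinder _ ξ η ?_ hξ
    rw [length_pre]
    exact pre_eq_pre_iff.2 fun k hk =>
      pre_eq_pre_iff.1 h k (hk.trans_le (Finset.le_sup (f := n) hζ))
  have h1 : |ψ ξ - ψ ζ| < ε / 2 := hn ζ hξ
  have h2 : |ψ η - ψ ζ| < ε / 2 := hn ζ hη
  rw [abs_lt] at h1 h2
  rw [abs_le]
  constructor <;> linarith

/-- Sequences in one cylinder agree on the next `m` letters except during the last `m` steps.
Uniform continuity handles the earlier times at cost ε each, and the late ones cost 2B each. This
sublinear distortion holds on the whole language. -/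
theorem exists_symSup_le_birkhoffSum (hψ : Continuous ψ) (hB : ∀ y, |ψ y| ≤ B) {ε : ℝ}
    (hε : 0 < ε) : ∃ R : ℝ, ∀ w ∈ language X, ∀ ξ ∈ cylinder X w,
      symSup X ψ w ≤ birkhoffSum shift ψ w.length ξ + (w.length * ε + R) := by
  obtain ⟨m, hm⟩ := exists_uniform_variation hψ hε
  refine ⟨m * (2 * B), fun w hw ξ hξ => symSup_le hw fun η hη => ?_⟩
  set n := w.length with hn
  have hB0 : 0 ≤ B := (abs_nonneg _).trans (hB ξ)
  have hpre : pre η n = pre ξ n := by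
    rw [pre_eq_of_mem_cylinder hη rfl, pre_eq_of_mem_cylinder hξ rfl]
  have hterm : ∀ k ∈ Finset.range n, ψ (shift^[k] η) ≤
      ψ (shift^[k] ξ) + (ε + if k ∈ Finset.Ico (n - m) n then 2 * B else 0) := by
    intro k hk
    rw [Finset.mem_range] at hk
    split_ifs with hkm
    · have := (abs_le.1 (hB (shift^[k] η))).2
      have := (abs_le.1 (hB (shift^[k] ξ))).1
      linarith
    · rw [Finset.mem_Ico] at hkm
      have := (abs_le.1 (hm (shift^[k] η) (shift^[k] ξ) (pre_eq_pre_iff.2 fun i hi => by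
        rw [shift_iterate_apply, shift_iterate_apply]
        exact pre_eq_pre_iff.1 hpre _ (by omega)))).2
      linarith
  unfold birkhoffSum
  refine (Finset.sum_le_sum hterm).trans ?_
  rw [Finset.sum_add_distrib, Finset.sum_add_distrib]
  have hind : ∑ k ∈ Finset.range n, (if k ∈ Finset.Ico (n - m) n then 2 * B else 0) ≤
      m * (2 * B) := by
    rw [← Finset.sum_filter, Finset.sum_const, nsmul_eq_mul]
    gcongr
    refine (Finset.card_le_card (t := Finset.Ico (n - m) n) fun k hk =>
      (Finset.mem_filter.1 hk).2).trans ?_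
    rw [Nat.card_Ico]
    omega
  rw [Finset.sum_const, Finset.card_range, nsmul_eq_mul]
  linarith

theorem measureReal_cylinder_eq_zero {μ : Measure (ℕ → Fin p)} (hμ : μ Xᶜ = 0)
    {w : List (Fin p)} (hw : w ∉ language X) : μ.real (cylinder univ w) = 0 := by
  have : cylinder univ w ⊆ Xᶜ := fun ξ hξ hX =>
    hw ⟨ξ, by rw [cylinder_eq_inter]; exact ⟨hX, hξ⟩⟩
  rw [measureReal_def, measure_mono_null this hμ, ENNReal.toReal_zero]

theorem sum_wordsIn_eq_sum_words {μ : Measure (ℕ → Fin p)} (hμ : μ Xᶜ = 0) (n : ℕ)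
    {F : List (Fin p) → ℝ} (hF : ∀ w, μ.real (cylinder univ w) = 0 → F w = 0) :
    ∑ w ∈ wordsIn (language X) n, F w = ∑ w ∈ words (Fin p) n, F w := by
  refine Finset.sum_subset (fun w hw => mem_words.2 (mem_wordsIn.1 hw).1) fun w hw hwn => ?_
  refine hF w (measureReal_cylinder_eq_zero hμ fun hL => hwn ?_)
  exact mem_wordsIn.2 ⟨mem_words.1 hw, hL⟩

theorem integral_pre (μ : Measure (ℕ → Fin p)) [IsProbabilityMeasure μ] (n : ℕ)
    (F : List (Fin p) → ℝ) : Integrable (fun ξ => F (pre ξ n)) μ ∧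
    ∫ ξ, F (pre ξ n) ∂μ = ∑ w ∈ words (Fin p) n, μ.real (cylinder univ w) * F w := by
  classical
  have he : (fun ξ => F (pre ξ n)) = fun ξ => ∑ w ∈ words (Fin p) n,
      (cylinder univ w).indicator (fun _ => F w) ξ := by
    funext ξ
    rw [Finset.sum_eq_single (pre ξ n)]
    · rw [indicator_of_mem (mem_cylinder_pre (mem_univ _) n)]
    · intro w hw hne
      refine indicator_of_notMem (fun hξ => hne ?_) _
      exact (pre_eq_of_mem_cylinder hξ (mem_words.1 hw)).symm
    · intro hn; simp at hn
  have hint : ∀ w ∈ words (Fin p) n,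
      Integrable ((cylinder univ w).indicator (fun _ => F w)) μ := fun w _ =>
    (integrable_const _).indicator (measurableSet_cylinder w)
  rw [he]
  refine ⟨integrable_finsetSum _ hint, ?_⟩
  rw [integral_finsetSum _ hint]
  refine Finset.sum_congr rfl fun w _ => ?_
  rw [integral_indicator (measurableSet_cylinder w), setIntegral_const, smul_eq_mul]

theorem integrable_of_bound {Ω : Type*} [MeasurableSpace Ω] [TopologicalSpace Ω]
    [OpensMeasurableSpace Ω] (μ : Measure Ω) [IsFiniteMeasure μ] {g : Ω → ℝ}
    (hg : Continuous g) (hB : ∀ y, |g y| ≤ B) : Integrable g μ :=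
  Integrable.of_bound hg.measurable.aestronglyMeasurable B (ae_of_all _ hB)

theorem integral_birkhoffSum {μ : Measure (ℕ → Fin p)} [IsProbabilityMeasure μ]
    (hμ : MeasurePreserving shift μ μ) (hψ : Continuous ψ) (hB : ∀ y, |ψ y| ≤ B) (n : ℕ) :
    Integrable (birkhoffSum shift ψ n) μ ∧
      ∫ ξ, birkhoffSum shift ψ n ξ ∂μ = n * ∫ ξ, ψ ξ ∂μ := by
  have hint : ∀ k ∈ Finset.range n, Integrable (fun ξ => ψ (shift^[k] ξ)) μ := fun k _ =>
    integrable_of_bound μ (hψ.comp (continuous_shift.iterate k)) fun y => hB _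
  unfold birkhoffSum
  refine ⟨integrable_finsetSum _ hint, ?_⟩
  rw [integral_finsetSum _ hint, Finset.sum_congr rfl fun k _ => ?_]
  · rw [Finset.sum_const, Finset.card_range, nsmul_eq_mul]
  · have h1 := (hμ.iterate k).map_eq
    conv_rhs => rw [← h1]
    rw [integral_map (hμ.iterate k).measurable.aemeasurable hψ.measurable.aestronglyMeasurable]

theorem mul_integral_le_sum {μ : Measure (ℕ → Fin p)} [IsProbabilityMeasure μ]
    (hμ : MeasurePreserving shift μ μ) (hμX : μ Xᶜ = 0) (hψ : Continuous ψ)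
    (hB : ∀ y, |ψ y| ≤ B) (n : ℕ) :
    n * ∫ ξ, ψ ξ ∂μ ≤
      ∑ w ∈ words (Fin p) n, μ.real (cylinder univ w) * symSup X ψ w := by
  rw [← (integral_pre μ n _).2, ← (integral_birkhoffSum hμ hψ hB n).2]
  refine integral_mono_ae (integral_birkhoffSum hμ hψ hB n).1 (integral_pre μ n _).1 ?_
  have hX : ∀ᵐ ξ ∂μ, ξ ∈ X := by rw [ae_iff]; exact hμX
  filter_upwards [hX] with ξ hξ
  have := le_symSup (X := X) hB (mem_cylinder_pre hξ n)
  rwa [length_pre] at this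

theorem sum_le_mul_integral {μ : Measure (ℕ → Fin p)} [IsProbabilityMeasure μ]
    (hμ : MeasurePreserving shift μ μ) (hμX : μ Xᶜ = 0) (hψ : Continuous ψ)
    (hB : ∀ y, |ψ y| ≤ B) {n : ℕ} {r : ℝ} (hr : ∀ ξ ∈ X,
      symSup X ψ (pre ξ n) ≤ birkhoffSum shift ψ n ξ + r) :
    ∑ w ∈ words (Fin p) n, μ.real (cylinder univ w) * symSup X ψ w ≤
      n * ∫ ξ, ψ ξ ∂μ + r := by
  have h1 := integral_birkhoffSum hμ hψ hB n
  have h2 : ∫ ξ, (birkhoffSum shift ψ n ξ + r) ∂μ = n * ∫ ξ, ψ ξ ∂μ + r := by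
    rw [integral_add h1.1 (integrable_const _), h1.2]; simp
  rw [← (integral_pre μ n _).2, ← h2]
  refine integral_mono_ae (integral_pre μ n _).1 (h1.1.add (integrable_const _)) ?_
  have hX : ∀ᵐ ξ ∂μ, ξ ∈ X := by rw [ae_iff]; exact hμX
  filter_upwards [hX] with ξ hξ
  exact hr ξ hξ

/-- An invariant measure with the upper Gibbs bound has free energy at least `P`. -/
theorem le_wordEntropy_add_of_upper {μ : Measure (ℕ → Fin p)} [IsProbabilityMeasure μ]
    (hμ : MeasurePreserving shift μ μ) (hμX : μ Xᶜ = 0) (hψ : Continuous ψ)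
    (hB : ∀ y, |ψ y| ≤ B) {K : ℝ} (hK : 0 < K) (hup : ∀ w ∈ language X,
      μ.real (cylinder univ w) ≤ K * Real.exp (symSup X ψ w - w.length * P)) (n : ℕ) :
    n * P ≤ refinementEntropy shift μ (fun ξ => ξ 0) n + n * ∫ ξ, ψ ξ ∂μ := by
  have h0 : Measurable fun ξ : ℕ → Fin p => ξ 0 := measurable_pi_apply 0
  set H := (refinementEntropy_subadditive hμ h0).lim
  -- The Fekete limit is an infimum, so a lower bound for the limit holds at every `n`. In the limit
  -- the errors R and log K disappear, and ε is arbitrary.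
  have hlim : P - ∫ ξ, ψ ξ ∂μ ≤ H := by
    refine le_of_forall_pos_le_add fun ε hε => ?_
    obtain ⟨R, hR⟩ := exists_symSup_le_birkhoffSum (X := X) hψ hB hε
    have hn : ∀ n : ℕ, n ≠ 0 →
        P - ∫ ξ, ψ ξ ∂μ - ε - (R + Real.log K) / n ≤
          refinementEntropy shift μ (fun ξ => ξ 0) n / n := by
      intro n hn
      have hn' : (0 : ℝ) < n := by positivity
      have h1 : ∑ w ∈ words (Fin p) n, μ.real (cylinder univ w) *
          (n * P - symSup X ψ w - Real.log K) ≤ refinementEntropy shift μ (fun ξ => ξ 0) n := by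
        rw [wordEntropy_eq_sum]
        refine Finset.sum_le_sum fun w hw => ?_
        rcases (measureReal_nonneg (μ := μ) (s := cylinder univ w)).eq_or_lt with hz | hpos
        · rw [← hz]; simp
        · have hwL : w ∈ language X := by
            by_contra hwL
            exact hpos.ne' (measureReal_cylinder_eq_zero hμX hwL)
          have := Real.log_le_log hpos (hup w hwL)
          rw [Real.log_mul hK.ne' (Real.exp_pos _).ne', Real.log_exp, mem_words.1 hw] at this
          rw [Real.negMulLog, neg_mul, ← mul_neg]
          exact mul_le_mul_of_nonneg_left (by linarith) hpos.le
      have h2 := sum_le_mul_integral hμ hμX hψ hB (n := n) (r := n * ε + R) (fun ξ hξ => by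
        have := hR _ (pre_mem_language hξ n) ξ (mem_cylinder_pre hξ n)
        rwa [length_pre] at this)
      have h3 : ∑ w ∈ words (Fin p) n, μ.real (cylinder univ w) *
          (n * P - symSup X ψ w - Real.log K) = (n * P - Real.log K) -
          ∑ w ∈ words (Fin p) n, μ.real (cylinder univ w) * symSup X ψ w := by
        have : ∀ w ∈ words (Fin p) n, μ.real (cylinder univ w) *
          (n * P - symSup X ψ w - Real.log K) = μ.real (cylinder univ w) * (n * P - Real.log K) -
          μ.real (cylinder univ w) * symSup X ψ w := fun _ _ => by ring
        rw [Finset.sum_congr rfl this, Finset.sum_sub_distrib, ← Finset.sum_mul,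
          sum_measureReal_cylinder, one_mul]
      rw [le_div_iff₀ hn']
      have : (P - ∫ ξ, ψ ξ ∂μ - ε - (R + Real.log K) / n) * n =
          n * P - Real.log K - (n * ∫ ξ, ψ ξ ∂μ + (n * ε + R)) := by field_simp; ring
      linarith
    have ht : Tendsto (fun n : ℕ => P - ∫ ξ, ψ ξ ∂μ - ε - (R + Real.log K) / n) atTop
        (𝓝 (P - ∫ ξ, ψ ξ ∂μ - ε - 0)) :=
      tendsto_const_nhds.sub (tendsto_const_div_atTop_nhds_zero_nat _)
    have := le_of_tendsto_of_tendsto ht (refinementEntropy_div_tendsto hμ h0)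
      ((eventually_ne_atTop 0).mono hn)
    linarith
  rcases Nat.eq_zero_or_pos n with rfl | hn
  · simp [refinementEntropy]
  · have hn' : (0 : ℝ) < n := by exact_mod_cast hn
    have h1 := hlim.trans (refinementEntropy_lim_le hμ h0 hn.ne')
    rw [le_div_iff₀ hn'] at h1
    linarith

end Variation

end PMM

namespace PMM

variable {p : ℕ} {X : Set (ℕ → Fin p)} {ψ : (ℕ → Fin p) → ℝ} {GM : ℕ → Set (List (Fin p))}
  {P B : ℝ} {μ : Measure (ℕ → Fin p)}

/-! ### Ergodicity and uniqueness on the subshift. -/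

namespace IsSymbolicGibbs

/-- Two-word bound with the second word fixed; its weight goes into the constant. -/
theorem lower_single (hμ : IsSymbolicGibbs X ψ GM P μ) (M : ℕ) : ∃ κ > 0, ∀ w ∈ GM M,
    κ * Real.exp (symSup X ψ w - w.length * P) ≤ μ.real (cylinder univ w) := by
  have := hμ.prob
  obtain ⟨κ, hκ, hlow⟩ := hμ.lower M
  rcases (GM M).eq_empty_or_nonempty with he | ⟨v, hv⟩
  · exact ⟨1, one_pos, by simp [he]⟩
  · refine ⟨κ * Real.exp (symSup X ψ v - v.length * P), by positivity, fun w hw => ?_⟩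
    obtain ⟨l, hl⟩ := hlow w hw v hv
    refine le_trans (le_of_eq ?_) ((hl l le_rfl).trans (measureReal_mono inter_subset_left))
    ring

theorem le_wordEntropy_add (hμ : IsSymbolicGibbs X ψ GM P μ)
    (h : GibbsDecomposition X ψ GM P B) (n : ℕ) :
    n * P ≤ refinementEntropy shift μ (fun ξ => ξ 0) n + n * ∫ ξ, ψ ξ ∂μ := by
  have := hμ.prob
  obtain ⟨K, hK, hup⟩ := hμ.upper
  exact le_wordEntropy_add_of_upper hμ.measurePreserving hμ.compl h.continuous h.bound hK hup n

end IsSymbolicGibbs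

namespace GibbsDecomposition

variable (h : GibbsDecomposition X ψ GM P B)
include h

/-- A word missing from all `GM M` would keep its own weight in every remainder, yet some remainder
has less than this weight at the length of the word. -/
theorem exists_mem_of_mem_language {w : List (Fin p)} (hw : w ∈ language X) :
    ∃ M, w ∈ GM M := by
  by_contra hcon
  push Not at hcon
  have hpos : 0 < Real.exp (symSup X ψ w) / (2 * Real.exp (w.length * P)) := by positivity
  obtain ⟨M, hM⟩ := h.tail _ hpos
  have h1 := (exp_le_wordSum (symSup X ψ) (D := language X \ GM M) ⟨hw, hcon M⟩).trans
    (hM w.length)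
  have h2 : Real.exp (symSup X ψ w) / (2 * Real.exp (w.length * P)) * Real.exp (w.length * P) =
      Real.exp (symSup X ψ w) / 2 := by field_simp
  rw [h2] at h1
  linarith [Real.exp_pos (symSup X ψ w)]

theorem measure_cylinder_pos (hμ : IsSymbolicGibbs X ψ GM P μ) {w : List (Fin p)}
    (hw : w ∈ language X) : 0 < μ.real (cylinder univ w) := by
  obtain ⟨M, hM⟩ := h.exists_mem_of_mem_language hw
  obtain ⟨κ, hκ, hlow⟩ := hμ.lower_single M
  exact lt_of_lt_of_le (by positivity) (hlow w hM)

/-- A collection of words of positive proportion still has positive proportion in `GM M`. -/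
theorem exists_heavy {γ : ℝ} (hγ : 0 < γ) : ∃ M, ∀ (n : ℕ) (D : Set (List (Fin p))),
    D ⊆ language X → γ * Real.exp (n * P) ≤ wordSum (symSup X ψ) D n →
      γ / 2 * Real.exp (n * P) ≤ wordSum (symSup X ψ) (D ∩ GM M) n := by
  obtain ⟨M, hM⟩ := h.tail (γ / 2) (by positivity)
  refine ⟨M, fun n D hD hle => ?_⟩
  have h1 := wordSum_le_add (symSup X ψ) D (GM M) n
  have h2 := (wordSum_mono (symSup X ψ) (sdiff_subset_sdiff_left (t := GM M) hD) n).trans (hM n)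
  linarith

omit h in
theorem measureReal_eq_sum_language [IsProbabilityMeasure μ] (hμX : μ Xᶜ = 0) {n : ℕ}
    {C : Set (ℕ → Fin p)} (hC : IsDetermined n C) :
    μ.real C = ∑ w ∈ wordsIn (wordsWithin C ∩ language X) n, μ.real (cylinder univ w) := by
  rw [hC.measureReal_eq_sum μ]
  symm
  refine Finset.sum_subset (fun w hw => ?_) fun w hw hwn => ?_
  · rw [mem_wordsIn] at hw ⊢
    exact ⟨hw.1, hw.2.1⟩
  · refine measureReal_cylinder_eq_zero hμX fun hL => hwn ?_
    rw [mem_wordsIn] at hw ⊢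
    exact ⟨hw.1, hw.2, hL⟩

omit h in
theorem exp_sub_eq {D : Set (List (Fin p))} {n : ℕ} :
    ∑ w ∈ wordsIn D n, Real.exp (symSup X ψ w - w.length * P) =
      wordSum (symSup X ψ) D n * Real.exp (-(n * P)) := by
  rw [wordSum, Finset.sum_mul]
  refine Finset.sum_congr rfl fun w hw => ?_
  rw [← Real.exp_add, (mem_wordsIn.1 hw).1, sub_eq_add_neg]

/-- A determined set of positive measure carries a positive proportion of words of `GM M`. -/
theorem exists_heavy_of_measure (hμ : IsSymbolicGibbs X ψ GM P μ) {δ : ℝ} (hδ : 0 < δ) :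
    ∃ γ > 0, ∃ M, ∀ (n : ℕ) (C : Set (ℕ → Fin p)), IsDetermined n C → δ ≤ μ.real C →
      γ ≤ ∑ w ∈ wordsIn (wordsWithin C ∩ GM M) n,
        Real.exp (symSup X ψ w - w.length * P) := by
  have := hμ.prob
  obtain ⟨K, hK, hup⟩ := hμ.upper
  obtain ⟨M, hM⟩ := h.exists_heavy (show 0 < δ / K by positivity)
  refine ⟨δ / K / 2, by positivity, M, fun n C hC hδC => ?_⟩
  have h1 : δ ≤ K * (wordSum (symSup X ψ) (wordsWithin C ∩ language X) n *
      Real.exp (-(n * P))) := by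
    rw [measureReal_eq_sum_language hμ.compl hC] at hδC
    refine hδC.trans ?_
    rw [← exp_sub_eq, Finset.mul_sum]
    exact Finset.sum_le_sum fun w hw => hup w (mem_wordsIn.1 hw).2.2
  have h2 := hM n (wordsWithin C ∩ language X) inter_subset_right (by
    rw [div_mul_eq_mul_div, div_le_iff₀ hK]
    calc δ * Real.exp (n * P) ≤ K * (wordSum (symSup X ψ) (wordsWithin C ∩ language X) n *
          Real.exp (-(n * P))) * Real.exp (n * P) := by gcongr
      _ = wordSum (symSup X ψ) (wordsWithin C ∩ language X) n * K *
          (Real.exp (-(n * P)) * Real.exp (n * P)) := by ring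
      _ = _ := by rw [← Real.exp_add]; simp)
  have h3 : wordSum (symSup X ψ) (wordsWithin C ∩ language X ∩ GM M) n ≤
      wordSum (symSup X ψ) (wordsWithin C ∩ GM M) n :=
    wordSum_mono _ (inter_subset_inter_left _ inter_subset_left) n
  rw [exp_sub_eq]
  calc δ / K / 2 = δ / K / 2 * Real.exp (n * P) * Real.exp (-(n * P)) := by
        rw [mul_assoc, ← Real.exp_add]; simp
    _ ≤ _ := by
        gcongr
        exact h2.trans h3

/-- For an invariant set A of intermediate measure, A and its complement are approximated by sets C
and D on finitely many letters. Both contain a fixed share of the words of some `GM M`. The two-word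
bound keeps the measure of C ∩ σ^{-l}D away from 0, although it approximates the empty intersection
of A with its complement. -/
theorem ergodic (hμ : IsSymbolicGibbs X ψ GM P μ) : Ergodic shift μ := by
  classical
  have := hμ.prob
  refine ⟨hμ.measurePreserving, ⟨fun A hA hinv => ?_⟩⟩
  rw [eventuallyConst_set]
  by_contra hcon
  push Not at hcon
  have hA0 : 0 < μ.real A := by
    rw [measureReal_def, ENNReal.toReal_pos_iff]
    refine ⟨pos_iff_ne_zero.2 fun h0 => hcon.2 ?_, measure_lt_top _ _⟩
    exact measure_eq_zero_iff_ae_notMem.1 h0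
  have hA1 : 0 < μ.real Aᶜ := by
    rw [measureReal_def, ENNReal.toReal_pos_iff]
    refine ⟨pos_iff_ne_zero.2 fun h0 => hcon.1 ?_, measure_lt_top _ _⟩
    filter_upwards [measure_eq_zero_iff_ae_notMem.1 h0] with x hx
    simpa using hx
  set δ := min (μ.real A) (μ.real Aᶜ) / 2 with hδ
  have hδ0 : 0 < δ := by positivity
  have hδA : 2 * δ ≤ μ.real A := by linarith [min_le_left (μ.real A) (μ.real Aᶜ)]
  have hδA' : 2 * δ ≤ μ.real Aᶜ := by linarith [min_le_right (μ.real A) (μ.real Aᶜ)]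
  -- The constants γ, `M` and κ depend on δ only. They are fixed before C and D so that the
  -- precision ε can be chosen in terms of them.
  obtain ⟨γ, hγ, M, hM⟩ := h.exists_heavy_of_measure hμ hδ0
  obtain ⟨κ, hκ, hlow⟩ := hμ.lower M
  set ε := min δ (κ * (γ * γ) / 3) with hε
  have hε0 : 0 < ε := by positivity
  obtain ⟨n₁, C, hC, hCA⟩ := exists_determined_approx μ hA hε0
  obtain ⟨n₂, D, hD, hDA⟩ := exists_determined_approx μ hA.compl hε0
  set n := max n₁ n₂
  replace hC := hC.mono (le_max_left n₁ n₂)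
  replace hD := hD.mono (le_max_right n₁ n₂)
  have hεδ : ε ≤ δ := min_le_left _ _
  have hC1 := hM n C hC (by
    have := measureReal_le_add_symmDiff μ A C
    rw [symmDiff_comm] at this
    linarith)
  have hD1 := hM n D hD (by
    have := measureReal_le_add_symmDiff μ Aᶜ D
    rw [symmDiff_comm] at this
    linarith)
  choose! l₀ hl₀ using hlow
  set S := wordsIn (wordsWithin C ∩ GM M) n
  set T := wordsIn (wordsWithin D ∩ GM M) n
  -- Only finitely many pairs of words occur, so a single distance is beyond all their thresholds.
  set l := (S ×ˢ T).sup fun q => l₀ q.1 q.2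
  have hsum : κ * (γ * γ) ≤ ∑ q ∈ S ×ˢ T,
      μ.real (cylinder univ q.1 ∩ shift^[l] ⁻¹' cylinder univ q.2) := by
    calc κ * (γ * γ) ≤ κ * ((∑ w ∈ S, Real.exp (symSup X ψ w - w.length * P)) *
          ∑ w ∈ T, Real.exp (symSup X ψ w - w.length * P)) := by gcongr
      _ = ∑ q ∈ S ×ˢ T, κ * (Real.exp (symSup X ψ q.1 - q.1.length * P) *
          Real.exp (symSup X ψ q.2 - q.2.length * P)) := by
          rw [Finset.sum_mul_sum, ← Finset.sum_product', Finset.mul_sum]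
      _ ≤ _ := by
          refine Finset.sum_le_sum fun q hq => ?_
          obtain ⟨hq1, hq2⟩ := Finset.mem_product.1 hq
          exact hl₀ _ (mem_wordsIn.1 hq1).2.2 _ (mem_wordsIn.1 hq2).2.2 l
            (Finset.le_sup (f := fun q => l₀ q.1 q.2) hq)
  have hunion : ∑ q ∈ S ×ˢ T,
      μ.real (cylinder univ q.1 ∩ shift^[l] ⁻¹' cylinder univ q.2) ≤
        μ.real (C ∩ shift^[l] ⁻¹' D) := by
    rw [← measureReal_biUnion_finset]
    · refine measureReal_mono (iUnion₂_subset fun q hq => ?_)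
      obtain ⟨hq1, hq2⟩ := Finset.mem_product.1 hq
      exact inter_subset_inter (mem_wordsIn.1 hq1).2.1
        (preimage_mono (mem_wordsIn.1 hq2).2.1)
    · rintro ⟨u, v⟩ hq ⟨u', v'⟩ hq' hne
      obtain ⟨hq1, hq2⟩ := Finset.mem_product.1 (Finset.mem_coe.1 hq)
      obtain ⟨hq1', hq2'⟩ := Finset.mem_product.1 (Finset.mem_coe.1 hq')
      refine Set.disjoint_left.2 fun ξ hx hx' => hne ?_
      have e1 : u = u' :=
        (pre_eq_of_mem_cylinder hx.1 (mem_wordsIn.1 hq1).1).symm.trans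
          (pre_eq_of_mem_cylinder hx'.1 (mem_wordsIn.1 hq1').1)
      have e2 : v = v' :=
        (pre_eq_of_mem_cylinder hx.2 (mem_wordsIn.1 hq2).1).symm.trans
          (pre_eq_of_mem_cylinder hx'.2 (mem_wordsIn.1 hq2').1)
      rw [e1, e2]
    · exact fun q _ => (measurableSet_cylinder _).inter
        ((measurable_shift.iterate l) (measurableSet_cylinder _))
  have hinvl : shift^[l] ⁻¹' A = A :=
    (congrFun preimage_iterate_eq A).trans (Function.iterate_fixed hinv l)
  have hsmall : μ.real (C ∩ shift^[l] ⁻¹' D) ≤ ε + ε := by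
    have hsub : C ∩ shift^[l] ⁻¹' D ⊆ symmDiff C A ∪ shift^[l] ⁻¹' (symmDiff D Aᶜ) := by
      rintro ξ ⟨hξC, hξD⟩
      by_cases hξA : ξ ∈ A
      · right
        refine Or.inl ⟨hξD, not_not.2 ?_⟩
        rw [← hinvl] at hξA
        exact hξA
      · exact Or.inl (Or.inl ⟨hξC, hξA⟩)
    refine (measureReal_mono hsub).trans ((measureReal_union_le _ _).trans ?_)
    refine add_le_add hCA.le (le_trans (le_of_eq ?_) hDA.le)
    rw [measureReal_def, (hμ.measurePreserving.iterate l).measure_preimage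
      (hD.measurableSet.symmDiff hA.compl).nullMeasurableSet, measureReal_def]
  -- The two approximation errors together are at most two thirds of the lower bound, a
  -- contradiction.
  have hε' : ε ≤ κ * (γ * γ) / 3 := min_le_right _ _
  have : 0 < κ * (γ * γ) := by positivity
  linarith

/-- A set of positive measure for a measure of maximal free energy carries a positive proportion of
the words. -/
theorem mul_log_le {ν : Measure (ℕ → Fin p)} [IsProbabilityMeasure ν]
    (hν : MeasurePreserving shift ν ν) (hνX : ν Xᶜ = 0) {n : ℕ}
    (hent : n * P ≤ refinementEntropy shift ν (fun ξ => ξ 0) n + n * ∫ ξ, ψ ξ ∂ν)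
    {C : Set (ℕ → Fin p)} (hC : IsDetermined n C) (s : ℝ) :
    n * P + s * ν.real C ≤ Real.log (wordSum (symSup X ψ) (language X) n +
      Real.exp s * wordSum (symSup X ψ) (wordsWithin C ∩ language X) n) := by
  classical
  set W := wordsIn (language X) n
  -- Tilting the weights by e^s on the words inside C adds s ν(C) to the energy side of the Gibbs
  -- inequality, while the partition sum grows only through those words.
  set c : List (Fin p) → ℝ := fun w => symSup X ψ w + if w ∈ wordsWithin C then s else 0 with hc
  have h1 : ∑ w ∈ W, ν.real (cylinder univ w) = 1 := by
    rw [sum_wordsIn_eq_sum_words hνX n fun w hw => hw, sum_measureReal_cylinder]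
  have hW : wordsIn (wordsWithin C ∩ language X) n = W.filter (· ∈ wordsWithin C) := by
    ext w
    simp only [W, Finset.mem_filter, mem_wordsIn, mem_inter_iff]
    tauto
  have h2 := sum_negMulLog_add_mul_le W c (fun w _ => measureReal_nonneg) h1
  have h3 : ∑ w ∈ W, Real.exp (c w) ≤ wordSum (symSup X ψ) (language X) n +
      Real.exp s * wordSum (symSup X ψ) (wordsWithin C ∩ language X) n := by
    rw [wordSum, wordSum, Finset.mul_sum, hW, Finset.sum_filter, ← Finset.sum_add_distrib]
    refine Finset.sum_le_sum fun w _ => ?_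
    simp only [hc]
    split_ifs
    · rw [Real.exp_add, mul_comm]
      linarith [Real.exp_pos (symSup X ψ w)]
    · simp
  have h4 : ∑ w ∈ W, (Real.negMulLog (ν.real (cylinder univ w)) + ν.real (cylinder univ w) * c w) =
      refinementEntropy shift ν (fun ξ => ξ 0) n +
      ∑ w ∈ words (Fin p) n, ν.real (cylinder univ w) * symSup X ψ w + s * ν.real C := by
    rw [measureReal_eq_sum_language hνX hC, hW, Finset.sum_filter, wordEntropy_eq_sum,
      ← sum_wordsIn_eq_sum_words hνX n (F := fun w => Real.negMulLog (ν.real (cylinder univ w)))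
        (fun w hw => by rw [hw]; simp),
      ← sum_wordsIn_eq_sum_words hνX n (F := fun w => ν.real (cylinder univ w) * symSup X ψ w)
        (fun w hw => by rw [hw]; simp),
      Finset.mul_sum, ← Finset.sum_add_distrib, ← Finset.sum_add_distrib]
    refine Finset.sum_congr rfl fun w _ => ?_
    simp only [hc]
    split_ifs <;> ring
  have h5 := mul_integral_le_sum hν hνX h.continuous h.bound n
  have h6 : 0 < ∑ w ∈ W, Real.exp (c w) := by
    refine Finset.sum_pos (fun w _ => Real.exp_pos _) ?_
    by_contra hne
    rw [Finset.not_nonempty_iff_eq_empty] at hne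
    rw [hne] at h1
    simp at h1
  have h7 := Real.log_le_log h6 h3
  rw [h4] at h2
  linarith

/-- Uniqueness of the measure of maximal free energy. -/
theorem eq_of_le_wordEntropy_add (hμ : IsSymbolicGibbs X ψ GM P μ)
    {ν : Measure (ℕ → Fin p)} [IsProbabilityMeasure ν]
    (hν : MeasurePreserving shift ν ν) (hνX : ν Xᶜ = 0)
    (hent : ∀ n : ℕ, n * P ≤ refinementEntropy shift ν (fun ξ => ξ 0) n + n * ∫ ξ, ψ ξ ∂ν) :
    ν = μ := by
  have := hμ.prob
  -- An invariant probability measure absolutely continuous with respect to an ergodic one equals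
  -- it, so μ-null sets must be shown to be ν-null.
  refine (h.ergodic hμ).eq_of_absolutelyContinuous hν ?_
  refine Measure.AbsolutelyContinuous.mk fun A hA hA0 => ?_
  by_contra hcon
  have hA1 : 0 < ν.real A := by
    rw [measureReal_def, ENNReal.toReal_pos_iff]
    exact ⟨pos_iff_ne_zero.2 hcon, measure_lt_top _ _⟩
  set δ := ν.real A / 2 with hδ
  have hδ0 : 0 < δ := by positivity
  obtain ⟨K, hK, hKup⟩ := h.exists_upper
  -- The choice makes sδ exceed log(K+1), the most that the tilted partition sum allows if the words
  -- inside C have a share below e^{-s}.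
  set s := (Real.log (K + 1) + 1) / δ with hs
  have hlogK : 0 < Real.log (K + 1) := Real.log_pos (by linarith)
  have hs0 : 0 < s := by positivity
  obtain ⟨M, hM⟩ := h.exists_heavy (Real.exp_pos (-s))
  obtain ⟨κ, hκ, hlow⟩ := hμ.lower_single M
  set ε := min δ (κ * (Real.exp (-s) / 2) / 2) with hε
  have hε0 : 0 < ε := by positivity
  -- Approximating with respect to μ + ν gives one set that is good for both measures. The precision
  -- was chosen last, after `M` and κ.
  obtain ⟨n, C, hC, hCA⟩ := exists_determined_approx (μ + ν) hA hε0
  have hsd : μ.real (symmDiff C A) + ν.real (symmDiff C A) < ε := by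
    rwa [measureReal_add_apply] at hCA
  have hνC : δ ≤ ν.real C := by
    have h1 := measureReal_le_add_symmDiff ν A C
    rw [symmDiff_comm] at h1
    have h2 : ε ≤ δ := min_le_left _ _
    have h3 := measureReal_nonneg (μ := μ) (s := symmDiff C A)
    linarith
  have hμC : μ.real C < ε := by
    have h1 := measureReal_le_add_symmDiff μ C A
    have h2 : μ.real A = 0 := by rw [measureReal_def, hA0, ENNReal.toReal_zero]
    have h3 := measureReal_nonneg (μ := ν) (s := symmDiff C A)
    linarith
  have hheavy : Real.exp (-s) * Real.exp (n * P) ≤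
      wordSum (symSup X ψ) (wordsWithin C ∩ language X) n := by
    by_contra hlt
    push Not at hlt
    have h1 := h.mul_log_le hν hνX (hent n) hC s
    have h2 : wordSum (symSup X ψ) (language X) n +
        Real.exp s * wordSum (symSup X ψ) (wordsWithin C ∩ language X) n ≤
        (K + 1) * Real.exp (n * P) := by
      have h3 := mul_le_mul_of_nonneg_left hlt.le (Real.exp_pos s).le
      rw [← mul_assoc, ← Real.exp_add, add_neg_cancel, Real.exp_zero, one_mul] at h3
      linarith [hKup n]
    have h3 : 0 < wordSum (symSup X ψ) (language X) n +
        Real.exp s * wordSum (symSup X ψ) (wordsWithin C ∩ language X) n :=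
      add_pos_of_pos_of_nonneg ((Real.exp_pos _).trans_le (h.lower n))
        (mul_nonneg (Real.exp_pos _).le (wordSum_nonneg _ _ _))
    have h4 := h1.trans (Real.log_le_log h3 h2)
    rw [Real.log_mul (by positivity) (Real.exp_pos _).ne', Real.log_exp] at h4
    have h5 : s * δ = Real.log (K + 1) + 1 := by rw [hs]; field_simp
    have h6 := mul_le_mul_of_nonneg_left hνC hs0.le
    linarith
  have h1 := hM n _ inter_subset_right hheavy
  have h2 : κ * (wordSum (symSup X ψ) (wordsWithin C ∩ language X ∩ GM M) n *
      Real.exp (-(n * P))) ≤ μ.real C := by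
    rw [measureReal_eq_sum_language hμ.compl hC, ← exp_sub_eq, Finset.mul_sum]
    calc ∑ w ∈ wordsIn (wordsWithin C ∩ language X ∩ GM M) n,
          κ * Real.exp (symSup X ψ w - w.length * P)
        ≤ ∑ w ∈ wordsIn (wordsWithin C ∩ language X ∩ GM M) n, μ.real (cylinder univ w) :=
          Finset.sum_le_sum fun w hw => hlow w (mem_wordsIn.1 hw).2.2
      _ ≤ _ := Finset.sum_le_sum_of_subset_of_nonneg (fun w hw => by
          rw [mem_wordsIn] at hw ⊢
          exact ⟨hw.1, hw.2.1⟩) fun _ _ _ => measureReal_nonneg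
  have h3 : κ * (Real.exp (-s) / 2) ≤ μ.real C := by
    refine le_trans ?_ h2
    gcongr
    calc Real.exp (-s) / 2 = Real.exp (-s) / 2 * Real.exp (n * P) * Real.exp (-(n * P)) := by
          rw [mul_assoc, ← Real.exp_add]; simp
      _ ≤ _ := by gcongr
  have h4 : ε ≤ κ * (Real.exp (-s) / 2) / 2 := min_le_right _ _
  have h5 : 0 < κ * (Real.exp (-s) / 2) := by positivity
  linarith

/-- The Gibbs inequality over words of length `n` bounds the free energy by P + (log K)/n. -/
theorem wordEntropy_add_le {ν : Measure (ℕ → Fin p)} [IsProbabilityMeasure ν]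
    (hν : MeasurePreserving shift ν ν) (hνX : ν Xᶜ = 0) :
    entropy shift ν + ((∫ ξ, ψ ξ ∂ν : ℝ) : EReal) ≤ (P : EReal) := by
  obtain ⟨K, hK, hKup⟩ := h.exists_upper
  have hn : ∀ n : ℕ, n ≠ 0 → refinementEntropy shift ν (fun ξ => ξ 0) n / n ≤
      P - ∫ ξ, ψ ξ ∂ν + Real.log K / n := by
    intro n hn
    have hn' : (0 : ℝ) < n := by positivity
    have h1 : ∑ w ∈ wordsIn (language X) n, ν.real (cylinder univ w) = 1 := by
      rw [sum_wordsIn_eq_sum_words hνX n fun w hw => hw, sum_measureReal_cylinder]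
    have h2 := sum_negMulLog_add_mul_le (wordsIn (language X) n) (symSup X ψ)
      (fun w _ => measureReal_nonneg) h1
    rw [sum_wordsIn_eq_sum_words hνX n (F := fun w => Real.negMulLog (ν.real (cylinder univ w)) +
      ν.real (cylinder univ w) * symSup X ψ w) (fun w hw => by rw [hw]; simp),
      Finset.sum_add_distrib, ← wordEntropy_eq_sum] at h2
    have h3 := mul_integral_le_sum hν hνX h.continuous h.bound n
    have h4 := Real.log_le_log ((Real.exp_pos _).trans_le (h.lower n)) (hKup n)
    rw [Real.log_mul hK.ne' (Real.exp_pos _).ne', Real.log_exp] at h4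
    change _ ≤ Real.log (wordSum (symSup X ψ) (language X) n) at h2
    rw [div_le_iff₀ hn']
    have : (P - ∫ ξ, ψ ξ ∂ν + Real.log K / n) * n = n * P - n * ∫ ξ, ψ ξ ∂ν + Real.log K := by
      field_simp
    linarith
  have hle : entropy shift ν ≤ ((P - ∫ ξ, ψ ξ ∂ν : ℝ) : EReal) := by
    refine EReal.le_of_forall_lt_iff_le.1 fun z hz => ?_
    have hz' : P - ∫ ξ, ψ ξ ∂ν < z := EReal.coe_lt_coe_iff.1 hz
    have ht : Tendsto (fun n : ℕ => P - ∫ ξ, ψ ξ ∂ν + Real.log K / n) atTop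
        (𝓝 (P - ∫ ξ, ψ ξ ∂ν + 0)) :=
      tendsto_const_nhds.add (tendsto_const_div_atTop_nhds_zero_nat _)
    rw [add_zero] at ht
    obtain ⟨n, hn1, hn0⟩ := ((ht.eventually (gt_mem_nhds hz')).and (eventually_ne_atTop 0)).exists
    exact (entropy_shift_le hν hn0).trans (EReal.coe_le_coe_iff.2 ((hn n hn0).trans hn1.le))
  calc entropy shift ν + ((∫ ξ, ψ ξ ∂ν : ℝ) : EReal)
      ≤ ((P - ∫ ξ, ψ ξ ∂ν : ℝ) : EReal) + ((∫ ξ, ψ ξ ∂ν : ℝ) : EReal) := by gcongr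
    _ = (P : EReal) := by rw [← EReal.coe_add]; simp

theorem eq_of_le_entropy_add (hμ : IsSymbolicGibbs X ψ GM P μ)
    {ν : Measure (ℕ → Fin p)} [IsProbabilityMeasure ν]
    (hν : MeasurePreserving shift ν ν) (hνX : ν Xᶜ = 0)
    (hent : (P : EReal) ≤ entropy shift ν + ((∫ ξ, ψ ξ ∂ν : ℝ) : EReal)) : ν = μ := by
  refine h.eq_of_le_wordEntropy_add hμ hν hνX fun n => ?_
  rcases Nat.eq_zero_or_pos n with rfl | hn
  · simp [refinementEntropy]
  · have h1 := hent.trans (add_le_add_left (entropy_shift_le hν hn.ne') _)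
    rw [← EReal.coe_add, EReal.coe_le_coe_iff] at h1
    have hn' : (0 : ℝ) < n := by exact_mod_cast hn
    have h2 := mul_le_mul_of_nonneg_left h1 hn'.le
    have h3 : (n : ℝ) * (refinementEntropy shift ν (fun ξ => ξ 0) n / n + ∫ ξ, ψ ξ ∂ν) =
        refinementEntropy shift ν (fun ξ => ξ 0) n + n * ∫ ξ, ψ ξ ∂ν := by field_simp
    linarith

/-- On an infinite subshift the Gibbs measure has no atoms. -/
theorem measure_singleton (hμ : IsSymbolicGibbs X ψ GM P μ) (hinf : X.Infinite)
    (ξ : ℕ → Fin p) : μ {ξ} = 0 := by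
  have := hμ.prob
  by_contra hne
  have hcons := hμ.measurePreserving.conservative
  -- By Poincaré recurrence an atom is a periodic point. Its orbit is invariant and, by ergodicity,
  -- has full measure.
  obtain ⟨x, hx, n, hn, hret⟩ := hcons.exists_mem_iterate_mem
    (measurableSet_singleton ξ).nullMeasurableSet hne
  rw [mem_singleton_iff] at hx hret
  subst hx
  set O : Set (ℕ → Fin p) := (fun k => shift^[k] x) '' Set.Iio n
  have hOfin : O.Finite := (Set.finite_Iio n).image _
  have hper : Function.IsPeriodicPt shift n x := hret
  have hxO : x ∈ O := ⟨0, Nat.pos_of_ne_zero hn, rfl⟩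
  have hOsub : O ⊆ shift ⁻¹' O := by
    rintro _ ⟨k, -, rfl⟩
    refine ⟨(k + 1) % n, Nat.mod_lt _ (Nat.pos_of_ne_zero hn), ?_⟩
    simp only
    rw [hper.iterate_mod_apply, Function.iterate_succ_apply']
  have hOm : MeasurableSet O := hOfin.measurableSet
  have hae : shift ⁻¹' O =ᵐ[μ] O :=
    (ae_eq_of_subset_of_measure_ge hOsub
      (hμ.measurePreserving.measure_preimage hOm.nullMeasurableSet).le hOm.nullMeasurableSet
      (measure_ne_top _ _)).symm
  have hO1 : μ Oᶜ = 0 := by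
    rcases (h.ergodic hμ).quasiErgodic.ae_empty_or_univ₀ hOm.nullMeasurableSet hae with h0 | h1
    · exfalso
      exact hne (measure_mono_null (singleton_subset_iff.2 hxO) (ae_eq_empty.1 h0))
    · exact ae_eq_univ.1 h1
  -- A point of `X` off the finite orbit has a cylinder disjoint from it, and that cylinder has
  -- positive measure.
  obtain ⟨η, hηX, hηO⟩ := hinf.exists_notMem_finite hOfin
  obtain ⟨k, hk⟩ := exists_cylinder_subset hOfin.isClosed.isOpen_compl hηO
  have hpos := h.measure_cylinder_pos hμ (pre_mem_language hηX k)
  have hzero : μ.real (cylinder univ (pre η k)) = 0 := by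
    rw [measureReal_def, measure_mono_null hk hO1, ENNReal.toReal_zero]
  exact hpos.ne' hzero

end GibbsDecomposition

end PMM

/-! ### Regular points and itineraries of the interval map. -/

namespace PMM

variable {p : ℕ} {f : unitInterval → unitInterval} {a : Fin (p + 1) → unitInterval}

theorem isOpen_piece (j : Fin p) : IsOpen (piece a j) := isOpen_Ioo

theorem closure_piece_subset (j : Fin p) : closure (piece a j) ⊆ Icc (a j.castSucc) (a j.succ) :=
  closure_minimal Ioo_subset_Icc_self isClosed_Icc

theorem mem_piece_of_mem_closure {x : unitInterval} {j : Fin p} (h : x ∈ closure (piece a j))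
    (hx : x ∉ range a) : x ∈ piece a j := by
  obtain ⟨h1, h2⟩ := closure_piece_subset j h
  exact ⟨lt_of_le_of_ne h1 fun he => hx ⟨_, he⟩, lt_of_le_of_ne h2 fun he => hx ⟨_, he.symm⟩⟩

namespace PiecewiseMonotonic

variable (hf : PiecewiseMonotonic f a)
include hf

theorem notMem_range {x : unitInterval} {j : Fin p} (h : x ∈ piece a j) : x ∉ range a := by
  rintro ⟨i, rfl⟩
  have h1 := hf.strictMono.lt_iff_lt.1 h.1
  have h2 := hf.strictMono.lt_iff_lt.1 h.2
  rw [Fin.lt_def] at h1 h2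
  simp at h1 h2
  omega

theorem piece_injective {x : unitInterval} {i j : Fin p} (hi : x ∈ piece a i)
    (hj : x ∈ piece a j) : i = j := by
  have h1 := hf.strictMono.lt_iff_lt.1 (hi.1.trans hj.2)
  have h2 := hf.strictMono.lt_iff_lt.1 (hj.1.trans hi.2)
  rw [Fin.lt_def] at h1 h2
  simp at h1 h2
  omega

theorem exists_piece {x : unitInterval} (hx : x ∉ range a) : ∃ j, x ∈ piece a j := by
  classical
  set s := Finset.univ.filter fun i => a i ≤ x with hs
  have h0 : s.Nonempty := ⟨0, by simp [hs, hf.first]⟩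
  set i := s.max' h0
  have hi : a i ≤ x := (Finset.mem_filter.1 (s.max'_mem h0)).2
  have hne : i ≠ Fin.last p := by
    intro he
    rw [he, hf.last] at hi
    exact hx ⟨Fin.last p, by rw [hf.last]; exact le_antisymm hi x.2.2⟩
  obtain ⟨j, hj⟩ := Fin.exists_castSucc_eq.2 hne
  refine ⟨j, lt_of_le_of_ne (hj ▸ hi) fun he => hx ⟨_, he⟩, ?_⟩
  by_contra hcon
  have : j.succ ∈ s := Finset.mem_filter.2 ⟨Finset.mem_univ _, not_lt.1 hcon⟩
  have h1 := s.le_max' _ this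
  change j.succ ≤ i at h1
  rw [← hj, Fin.le_def] at h1
  simp at h1

theorem injOn_piece (j : Fin p) : InjOn f (piece a j) :=
  (hf.monotonic j).elim StrictMonoOn.injOn StrictAntiOn.injOn

/-- The index of the interval that contains a point. -/
noncomputable def index (x : unitInterval) : Fin p :=
  open Classical in
  if h : ∃ j, x ∈ piece a j then h.choose else ⟨0, Nat.lt_of_lt_of_le Nat.zero_lt_two hf.two_le⟩

theorem index_eq {x : unitInterval} {j : Fin p} (h : x ∈ piece a j) : hf.index x = j := by
  have hex : ∃ j, x ∈ piece a j := ⟨j, h⟩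
  rw [index, dif_pos hex]
  exact hf.piece_injective hex.choose_spec h

theorem mem_piece_index {x : unitInterval} (hx : x ∉ range a) : x ∈ piece a (hf.index x) := by
  obtain ⟨j, hj⟩ := hf.exists_piece hx
  rwa [hf.index_eq hj]

theorem measurable_index : Measurable hf.index := by
  refine measurable_to_countable' fun j => ?_
  have hfin : (range a).Finite := finite_range a
  have : hf.index ⁻¹' {j} = piece a j ∪ (hf.index ⁻¹' {j} ∩ range a) := by
    ext x
    simp only [mem_preimage, mem_singleton_iff, mem_union, mem_inter_iff]
    constructor
    · intro h
      by_cases hx : x ∈ range a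
      · exact Or.inr ⟨h, hx⟩
      · exact Or.inl (h ▸ hf.mem_piece_index hx)
    · rintro (h | h)
      · exact hf.index_eq h
      · exact h.1
  rw [this]
  exact (isOpen_piece j).measurableSet.union (hfin.subset inter_subset_right).measurableSet

/-- The itinerary of a point. -/
noncomputable def itinerary (x : unitInterval) : ℕ → Fin p := fun k => hf.index (f^[k] x)

theorem isItinerary {x : unitInterval} (hx : x ∈ regularPoints f a) :
    IsItinerary f a x (hf.itinerary x) := fun k => hf.mem_piece_index (hx k)

theorem itinerary_eq {x : unitInterval} {ξ : ℕ → Fin p} (h : IsItinerary f a x ξ) :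
    hf.itinerary x = ξ := funext fun k => hf.index_eq (h k)

theorem regular_of_isItinerary {x : unitInterval} {ξ : ℕ → Fin p} (h : IsItinerary f a x ξ) :
    x ∈ regularPoints f a := fun k => hf.notMem_range (h k)

omit hf in
theorem regular_iterate {x : unitInterval} (hx : x ∈ regularPoints f a) (k : ℕ) :
    f^[k] x ∈ regularPoints f a := fun j => by
  rw [← Function.iterate_add_apply]; exact hx _

theorem itinerary_iterate (x : unitInterval) (k : ℕ) :
    hf.itinerary (f^[k] x) = shift^[k] (hf.itinerary x) := by
  funext j
  rw [shift_iterate_apply, itinerary, itinerary, ← Function.iterate_add_apply]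

theorem itinerary_mem {x : unitInterval} (hx : x ∈ regularPoints f a) :
    hf.itinerary x ∈ codeSpace f a := subset_closure ⟨x, hx, hf.isItinerary hx⟩

theorem measurable : Measurable f := by
  refine measurable_of_isOpen fun U hU => ?_
  have hfin : (range a).Finite := finite_range a
  have : f ⁻¹' U = (⋃ j, piece a j ∩ f ⁻¹' U) ∪ (f ⁻¹' U ∩ range a) := by
    ext x
    simp only [mem_union, mem_iUnion, mem_inter_iff]
    constructor
    · intro h
      by_cases hx : x ∈ range a
      · exact Or.inr ⟨h, hx⟩
      · obtain ⟨j, hj⟩ := hf.exists_piece hx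
        exact Or.inl ⟨j, hj, h⟩
    · rintro (⟨j, -, h⟩ | h)
      · exact h
      · exact h.1
  rw [this]
  refine (MeasurableSet.iUnion fun j => ?_).union (hfin.subset inter_subset_right).measurableSet
  exact ((hf.continuousOn j).isOpen_inter_preimage (isOpen_piece j) hU).measurableSet

theorem measurable_itinerary : Measurable hf.itinerary :=
  measurable_pi_lambda _ fun k => hf.measurable_index.comp (hf.measurable.iterate k)

theorem countable_preimage {s : Set unitInterval} (hs : s.Countable) : (f ⁻¹' s).Countable := by
  have : f ⁻¹' s ⊆ (⋃ j, piece a j ∩ f ⁻¹' s) ∪ range a := by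
    intro x hx
    by_cases hxa : x ∈ range a
    · exact Or.inr hxa
    · obtain ⟨j, hj⟩ := hf.exists_piece hxa
      exact Or.inl (mem_iUnion.2 ⟨j, hj, hx⟩)
  refine Set.Countable.mono this ((countable_iUnion fun j => ?_).union (finite_range a).countable)
  exact MapsTo.countable_of_injOn (t := s) (fun x hx => hx.2)
    ((hf.injOn_piece j).mono inter_subset_left) hs

/-- `f` is injective on each piece, so preimages of countable sets are countable. The exceptional
set is therefore null for measures without atoms and has dense complement. -/
theorem countable_irregular : (regularPoints f a)ᶜ.Countable := by
  have : (regularPoints f a)ᶜ ⊆ ⋃ k, (f^[k]) ⁻¹' range a := by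
    intro x hx
    simp only [regularPoints, mem_compl_iff, mem_ofPred_eq, not_forall, not_not] at hx
    obtain ⟨k, hk⟩ := hx
    exact mem_iUnion.2 ⟨k, hk⟩
  refine Set.Countable.mono this (countable_iUnion fun k => ?_)
  induction k with
  | zero => exact (finite_range a).countable
  | succ k ih =>
    rw [Function.iterate_succ, preimage_comp]
    exact hf.countable_preimage ih

omit hf in
theorem not_countable_of_isOpen {U : Set unitInterval} (hU : IsOpen U) (hne : U.Nonempty) :
    ¬ U.Countable := by
  intro hc
  obtain ⟨x, y, hxy, hsub⟩ := hU.exists_Ioo_subset hne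
  have h1 : (Subtype.val '' Ioo x y).Countable := (hc.mono hsub).image _
  have h2 : Subtype.val '' Ioo x y = Ioo (x : ℝ) y := by
    ext t
    constructor
    · rintro ⟨s, hs, rfl⟩
      exact hs
    · intro ht
      exact ⟨⟨t, x.2.1.trans ht.1.le, ht.2.le.trans y.2.2⟩, ht, rfl⟩
  rw [h2, Cardinal.Real.Ioo_countable_iff] at h1
  exact absurd h1 (not_le.2 hxy)

theorem dense_regular : Dense (regularPoints f a) := by
  rw [dense_iff_inter_open]
  intro U hU hne
  by_contra hcon
  rw [not_nonempty_iff_eq_empty] at hcon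
  refine not_countable_of_isOpen hU hne (Set.Countable.mono ?_ hf.countable_irregular)
  intro x hx hxr
  have : x ∈ U ∩ regularPoints f a := ⟨hx, hxr⟩
  rw [hcon] at this
  exact this

theorem exists_regular_mem {U : Set unitInterval} (hU : IsOpen U) (hne : U.Nonempty) :
    ∃ x ∈ U, x ∈ regularPoints f a :=
  hf.dense_regular.inter_open_nonempty U hU hne

end PiecewiseMonotonic

/-! ### Intervals of points with a common itinerary, and the projection. -/

section OpenCylinder

theorem openCylinder_succ (ξ : ℕ → Fin p) (n : ℕ) :
    openCylinder f a ξ (n + 1) = piece a (ξ 0) ∩ f ⁻¹' openCylinder f a (shift ξ) n := by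
  ext x
  simp only [openCylinder, mem_ofPred_eq, mem_inter_iff, mem_preimage]
  constructor
  · exact fun h => ⟨h 0 (Nat.succ_pos _), fun k hk => h (k + 1) (by omega)⟩
  · rintro ⟨h0, h1⟩ (_ | k) hk
    · exact h0
    · exact h1 k (by omega)

theorem openCylinder_congr {ξ η : ℕ → Fin p} {n : ℕ} (h : pre ξ n = pre η n) :
    openCylinder f a ξ n = openCylinder f a η n := by
  ext x
  have := pre_eq_pre_iff.1 h
  exact ⟨fun hx k hk => this k hk ▸ hx k hk, fun hx k hk => this k hk ▸ hx k hk⟩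

theorem openCylinder_anti (ξ : ℕ → Fin p) : Antitone (openCylinder f a ξ) :=
  fun _ _ hmn _ hx k hk => hx k (hk.trans_le hmn)

theorem isItinerary_iff {x : unitInterval} {ξ : ℕ → Fin p} :
    IsItinerary f a x ξ ↔ ∀ n, x ∈ openCylinder f a ξ n :=
  ⟨fun h _ k _ => h k, fun h k => h (k + 1) k (Nat.lt_succ_self k)⟩

namespace PiecewiseMonotonic

variable (hf : PiecewiseMonotonic f a)
include hf

theorem isOpen_openCylinder (ξ : ℕ → Fin p) (n : ℕ) : IsOpen (openCylinder f a ξ n) := by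
  induction n generalizing ξ with
  | zero => simp [openCylinder]
  | succ n ih =>
    rw [openCylinder_succ]
    exact (hf.continuousOn _).isOpen_inter_preimage (isOpen_piece _) (ih _)

/-- On a piece `f` is monotone, and monotone preimages of order-convex sets are order-convex. -/
theorem ordConnected_openCylinder (ξ : ℕ → Fin p) (n : ℕ) :
    (openCylinder f a ξ n).OrdConnected := by
  induction n generalizing ξ with
  | zero =>
    have : openCylinder f a ξ 0 = univ := by simp [openCylinder]
    rw [this]; exact ordConnected_univ
  | succ n ih =>
    rw [openCylinder_succ]
    refine ⟨fun x hx y hy z hz => ?_⟩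
    have hzp : z ∈ piece a (ξ 0) := ordConnected_Ioo.out hx.1 hy.1 hz
    refine ⟨hzp, ?_⟩
    rcases hf.monotonic (ξ 0) with hm | hm
    · exact (ih _).out hx.2 hy.2 ⟨hm.monotoneOn hx.1 hzp hz.1, hm.monotoneOn hzp hy.1 hz.2⟩
    · exact (ih _).out hy.2 hx.2 ⟨hm.antitoneOn hzp hy.1 hz.2, hm.antitoneOn hx.1 hzp hz.1⟩

omit hf in
theorem isClosed_codeSpace : IsClosed (codeSpace f a) := isClosed_closure

omit hf in
theorem mapsTo_codeSpace : MapsTo shift (codeSpace f a) (codeSpace f a) := by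
  refine MapsTo.closure ?_ continuous_shift
  rintro ξ ⟨x, hx, hξ⟩
  exact ⟨f x, regular_iterate hx 1, fun k => hξ (k + 1)⟩

theorem exists_regular_of_mem {ξ : ℕ → Fin p} (hξ : ξ ∈ codeSpace f a) (n : ℕ) :
    ∃ x ∈ regularPoints f a, pre (hf.itinerary x) n = pre ξ n := by
  obtain ⟨η, hη, x, hx, hxη⟩ := mem_closure_iff.1 hξ _ (isClopen_cylinder (pre ξ n)).isOpen
    (mem_cylinder_pre (mem_univ _) n)
  refine ⟨x, hx, ?_⟩
  rw [hf.itinerary_eq hxη]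
  exact pre_eq_of_mem_cylinder hη (length_pre _ _)

theorem exists_regular_of_mem_language {w : List (Fin p)} (hw : w ∈ language (codeSpace f a)) :
    ∃ x ∈ regularPoints f a, hf.itinerary x ∈ cylinder (codeSpace f a) w := by
  obtain ⟨ξ, hξ⟩ := hw
  obtain ⟨x, hx, he⟩ := hf.exists_regular_of_mem hξ.1 w.length
  refine ⟨x, hx, ?_⟩
  rw [mem_cylinder_iff_pre]
  exact ⟨hf.itinerary_mem hx, he.trans (pre_eq_of_mem_cylinder hξ rfl)⟩

theorem nonempty_openCylinder {ξ : ℕ → Fin p} (hξ : ξ ∈ codeSpace f a) (n : ℕ) :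
    (openCylinder f a ξ n).Nonempty := by
  obtain ⟨x, hx, he⟩ := hf.exists_regular_of_mem hξ n
  refine ⟨x, ?_⟩
  rw [← openCylinder_congr he]
  exact isItinerary_iff.1 (hf.isItinerary hx) n

theorem exists_mem_closures {ξ : ℕ → Fin p} (hξ : ξ ∈ codeSpace f a) :
    ∃ x, ∀ n, x ∈ closure (openCylinder f a ξ n) := by
  obtain ⟨x, hx⟩ := IsCompact.nonempty_iInter_of_sequence_nonempty_isCompact_isClosed
    (fun n => closure (openCylinder f a ξ n))
    (fun n => closure_mono (openCylinder_anti ξ (Nat.le_succ n)))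
    (fun n => (hf.nonempty_openCylinder hξ n).closure) isClosed_closure.isCompact
    fun n => isClosed_closure
  exact ⟨x, mem_iInter.1 hx⟩

omit hf in
theorem proj_mem {ξ : ℕ → Fin p} (h : ∃ x, ∀ n, x ∈ closure (openCylinder f a ξ n)) (n : ℕ) :
    proj f a ξ ∈ closure (openCylinder f a ξ n) :=
  Classical.epsilon_spec h n

omit hf in
theorem mem_of_lt_of_lt {J : Set unitInterval} (hJ : J.OrdConnected) {x y z : unitInterval}
    (hx : x ∈ closure J) (hy : y ∈ closure J) (hxz : x < z) (hzy : z < y) : z ∈ J := by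
  obtain ⟨u, hu, huJ⟩ := mem_closure_iff.1 hx (Iio z) isOpen_Iio hxz
  obtain ⟨v, hv, hvJ⟩ := mem_closure_iff.1 hy (Ioi z) isOpen_Ioi hzy
  exact hJ.out huJ hvJ ⟨(mem_Iio.1 hu).le, (mem_Ioi.1 hv).le⟩

/-- All points strictly between x and y lie in every open cylinder, hence share the itinerary ξ. Two
of them contradict the injectivity of the coding; x and y themselves may be endpoints. -/
theorem not_lt_of_mem_closures (hinj : AdmitsSymbolicDynamics f a) {ξ : ℕ → Fin p}
    {x y : unitInterval} (hx : ∀ n, x ∈ closure (openCylinder f a ξ n))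
    (hy : ∀ n, y ∈ closure (openCylinder f a ξ n)) : ¬ x < y := by
  intro hxy
  have hmem : ∀ z, x < z → z < y → IsItinerary f a z ξ := fun z h1 h2 =>
    isItinerary_iff.2 fun n => mem_of_lt_of_lt (hf.ordConnected_openCylinder ξ n) (hx n) (hy n) h1 h2
  obtain ⟨z, hz1, hz2⟩ := exists_between hxy
  obtain ⟨t, ht1, ht2⟩ := exists_between hz1
  have h1 := hmem z hz1 hz2
  have h2 := hmem t ht1 (ht2.trans hz2)
  exact ht2.ne (hinj t (hf.regular_of_isItinerary h2) z (hf.regular_of_isItinerary h1) ξ h2 h1)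

theorem proj_eq (hinj : AdmitsSymbolicDynamics f a) {ξ : ℕ → Fin p} {x : unitInterval}
    (hx : ∀ n, x ∈ closure (openCylinder f a ξ n)) : proj f a ξ = x := by
  have h := proj_mem ⟨x, hx⟩
  rcases lt_trichotomy (proj f a ξ) x with hlt | heq | hgt
  · exact absurd hlt (hf.not_lt_of_mem_closures hinj h hx)
  · exact heq
  · exact absurd hgt (hf.not_lt_of_mem_closures hinj hx h)

theorem proj_itinerary (hinj : AdmitsSymbolicDynamics f a) {x : unitInterval}
    (hx : x ∈ regularPoints f a) : proj f a (hf.itinerary x) = x :=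
  hf.proj_eq hinj fun n => subset_closure (isItinerary_iff.1 (hf.isItinerary hx) n)

/-- A regular point is interior to the cylinders of its own itinerary, and it lies in the closures
of those of ξ. The cylinders meet, and a common point determines the letters. So π has one-point
fibres over regular points. -/
theorem eq_itinerary_of_proj_regular {ξ : ℕ → Fin p} (hξ : ξ ∈ codeSpace f a)
    (hx : proj f a ξ ∈ regularPoints f a) : ξ = hf.itinerary (proj f a ξ) := by
  funext k
  have h1 := proj_mem (hf.exists_mem_closures hξ) (k + 1)
  obtain ⟨y, hy1, hy2⟩ := mem_closure_iff.1 h1 _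
    (hf.isOpen_openCylinder (hf.itinerary (proj f a ξ)) (k + 1))
    (isItinerary_iff.1 (hf.isItinerary hx) (k + 1))
  exact hf.piece_injective (hy2 k (Nat.lt_succ_self k)) (hy1 k (Nat.lt_succ_self k))

theorem proj_shift_iterate (hinj : AdmitsSymbolicDynamics f a) {ξ : ℕ → Fin p}
    (hξ : ξ ∈ codeSpace f a) (hx : proj f a ξ ∈ regularPoints f a) (k : ℕ) :
    proj f a (shift^[k] ξ) = f^[k] (proj f a ξ) := by
  conv_lhs => rw [hf.eq_itinerary_of_proj_regular hξ hx]
  rw [← hf.itinerary_iterate, hf.proj_itinerary hinj (regular_iterate hx k)]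

/-- The nested compact closures shrink to one point, so one of them lies in any given neighbourhood
of it. -/
theorem continuousOn_proj (hinj : AdmitsSymbolicDynamics f a) :
    ContinuousOn (proj f a) (codeSpace f a) := by
  intro ξ hξ
  rw [ContinuousWithinAt, tendsto_def]
  intro U hU
  have hproj := proj_mem (hf.exists_mem_closures hξ)
  obtain ⟨n, hn⟩ := exists_subset_nhds_of_isCompact' (V := fun n => closure (openCylinder f a ξ n))
    (U := U) (antitone_nat_of_succ_le fun n =>
      closure_mono (openCylinder_anti ξ (Nat.le_succ n))).directed_ge
    (fun n => isClosed_closure.isCompact) (fun n => isClosed_closure) (by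
      intro x hx
      rwa [← hf.proj_eq hinj (mem_iInter.1 hx)])
  rw [mem_nhdsWithin]
  refine ⟨cylinder univ (pre ξ n), (isClopen_cylinder _).isOpen,
    mem_cylinder_pre (mem_univ _) n, ?_⟩
  rintro η ⟨hη, hηX⟩
  refine hn ?_
  rw [← openCylinder_congr (pre_eq_of_mem_cylinder hη (length_pre _ _))]
  exact proj_mem (hf.exists_mem_closures hηX) n

theorem exists_proj_eq (hinj : AdmitsSymbolicDynamics f a) (x : unitInterval) :
    ∃ ξ ∈ codeSpace f a, proj f a ξ = x := by
  have hcl : IsClosed (proj f a '' codeSpace f a) :=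
    (isClosed_codeSpace.isCompact.image_of_continuousOn (hf.continuousOn_proj hinj)).isClosed
  have : proj f a '' codeSpace f a = univ := by
    rw [← hcl.closure_eq]
    refine Dense.closure_eq (hf.dense_regular.mono fun x hx => ?_)
    exact ⟨_, hf.itinerary_mem hx, hf.proj_itinerary hinj hx⟩
  have hx : x ∈ proj f a '' codeSpace f a := this ▸ mem_univ x
  exact hx

/-- π maps the compact code space onto the interval and closed sets to closed sets. Continuity
upstairs therefore descends. -/
theorem continuous_of_liftContinuous (hinj : AdmitsSymbolicDynamics f a)
    {φ : unitInterval → ℝ} (hφ : LiftContinuous f a φ) : Continuous φ := by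
  refine continuous_iff_isClosed.2 fun C hC => ?_
  have hcl : IsClosed (codeSpace f a ∩ (fun ξ => φ (proj f a ξ)) ⁻¹' C) :=
    hφ.preimage_isClosed_of_isClosed isClosed_codeSpace hC
  have h2 := (hcl.isCompact.image_of_continuousOn
    ((hf.continuousOn_proj hinj).mono inter_subset_left)).isClosed
  have : φ ⁻¹' C = proj f a '' (codeSpace f a ∩ (fun ξ => φ (proj f a ξ)) ⁻¹' C) := by
    ext x
    constructor
    · intro hx
      obtain ⟨ξ, hξ, rfl⟩ := hf.exists_proj_eq hinj x
      exact ⟨ξ, ⟨hξ, hx⟩, rfl⟩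
    · rintro ⟨ξ, hξ, rfl⟩
      exact hξ.2
  rw [this]
  exact h2

/-- Each open cylinder of a code over x contains a one-sided neighbourhood of x, and the side can be
chosen the same for all lengths. Two codes on the same side have intersecting cylinders and
coincide, so a fibre has at most two points. -/
theorem finite_fiber (x : unitInterval) :
    {ξ | ξ ∈ codeSpace f a ∧ proj f a ξ = x}.Finite := by
  have side : ∀ ξ ∈ codeSpace f a, proj f a ξ = x →
      (∀ n, ∃ y ∈ openCylinder f a ξ n, x < y ∧ ∀ z, x < z → z ≤ y → z ∈ openCylinder f a ξ n) ∨
      (∀ n, ∃ y ∈ openCylinder f a ξ n, y < x ∧ ∀ z, y ≤ z → z < x → z ∈ openCylinder f a ξ n) := by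
    rintro ξ hξ rfl
    set x := proj f a ξ
    have hcl := proj_mem (hf.exists_mem_closures hξ)
    have hgt : ∀ n, (∃ y ∈ openCylinder f a ξ n, x < y) → ∃ y ∈ openCylinder f a ξ n, x < y ∧
        ∀ z, x < z → z ≤ y → z ∈ openCylinder f a ξ n := by
      rintro n ⟨y, hy, hxy⟩
      refine ⟨y, hy, hxy, fun z hxz hzy => ?_⟩
      rcases hzy.eq_or_lt with rfl | hzy
      · exact hy
      · exact mem_of_lt_of_lt (hf.ordConnected_openCylinder ξ n) (hcl n) (subset_closure hy) hxz hzy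
    have hlt : ∀ n, (∃ y ∈ openCylinder f a ξ n, y < x) → ∃ y ∈ openCylinder f a ξ n, y < x ∧
        ∀ z, y ≤ z → z < x → z ∈ openCylinder f a ξ n := by
      rintro n ⟨y, hy, hxy⟩
      refine ⟨y, hy, hxy, fun z hyz hzx => ?_⟩
      rcases hyz.eq_or_lt with rfl | hyz
      · exact hy
      · exact mem_of_lt_of_lt (hf.ordConnected_openCylinder ξ n) (subset_closure hy) (hcl n) hyz hzx
    have hor : ∀ n, (∃ y ∈ openCylinder f a ξ n, x < y) ∨ ∃ y ∈ openCylinder f a ξ n, y < x := by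
      intro n
      by_contra hcon
      push Not at hcon
      have hsub : openCylinder f a ξ n ⊆ {x} := fun y hy =>
        le_antisymm (hcon.1 y hy) (hcon.2 y hy)
      exact not_countable_of_isOpen (hf.isOpen_openCylinder ξ n) (hf.nonempty_openCylinder hξ n)
        ((countable_singleton x).mono hsub)
    -- The cylinders decrease. Once one of them misses the right side of x, so do all longer ones,
    -- which must then reach to the left.
    by_cases hall : ∀ n, ∃ y ∈ openCylinder f a ξ n, x < y
    · exact Or.inl fun n => hgt n (hall n)
    · right
      push Not at hall
      obtain ⟨m, hm⟩ := hall
      intro n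
      refine hlt n ?_
      rcases hor (max m n) with ⟨y, hy, hxy⟩ | ⟨y, hy, hxy⟩
      · exact absurd hxy (not_lt.2 (hm y (openCylinder_anti ξ (le_max_left m n) hy)))
      · exact ⟨y, openCylinder_anti ξ (le_max_right m n) hy, hxy⟩
  have eq_of_inter : ∀ ξ η : ℕ → Fin p,
      (∀ n, (openCylinder f a ξ n ∩ openCylinder f a η n).Nonempty) → ξ = η := by
    intro ξ η h
    funext k
    obtain ⟨y, h1, h2⟩ := h (k + 1)
    exact hf.piece_injective (h1 k (Nat.lt_succ_self k)) (h2 k (Nat.lt_succ_self k))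
  have hR : {ξ | ξ ∈ codeSpace f a ∧ ∀ n, ∃ y ∈ openCylinder f a ξ n, x < y ∧
      ∀ z, x < z → z ≤ y → z ∈ openCylinder f a ξ n}.Subsingleton := by
    rintro ξ ⟨-, h1⟩ η ⟨-, h2⟩
    refine eq_of_inter ξ η fun n => ?_
    obtain ⟨y, hy, hxy, H⟩ := h1 n
    obtain ⟨y', hy', hxy', H'⟩ := h2 n
    exact ⟨min y y', H _ (lt_min hxy hxy') (min_le_left _ _),
      H' _ (lt_min hxy hxy') (min_le_right _ _)⟩
  have hL : {ξ | ξ ∈ codeSpace f a ∧ ∀ n, ∃ y ∈ openCylinder f a ξ n, y < x ∧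
      ∀ z, y ≤ z → z < x → z ∈ openCylinder f a ξ n}.Subsingleton := by
    rintro ξ ⟨-, h1⟩ η ⟨-, h2⟩
    refine eq_of_inter ξ η fun n => ?_
    obtain ⟨y, hy, hxy, H⟩ := h1 n
    obtain ⟨y', hy', hxy', H'⟩ := h2 n
    exact ⟨max y y', H _ (le_max_left _ _) (max_lt hxy hxy'),
      H' _ (le_max_right _ _) (max_lt hxy hxy')⟩
  refine (hR.finite.union hL.finite).subset ?_
  rintro ξ ⟨hξ, hx⟩
  exact (side ξ hξ hx).imp (fun h => ⟨hξ, h⟩) fun h => ⟨hξ, h⟩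

theorem infinite_codeSpace (hinj : AdmitsSymbolicDynamics f a) : (codeSpace f a).Infinite := by
  intro hfin
  have h1 : (univ : Set unitInterval).Countable := by
    refine ((hfin.image (proj f a)).countable).mono fun x _ => ?_
    obtain ⟨ξ, hξ, rfl⟩ := hf.exists_proj_eq hinj x
    exact ⟨ξ, hξ, rfl⟩
  exact not_countable_of_isOpen isOpen_univ univ_nonempty h1

/-- The projection to the interval, extended continuously to all sequences. -/
theorem exists_continuous_proj (hinj : AdmitsSymbolicDynamics f a) :
    ∃ π : (ℕ → Fin p) → unitInterval, Continuous π ∧ ∀ ξ ∈ codeSpace f a, π ξ = proj f a ξ := by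
  have hc : Continuous fun ξ : codeSpace f a => (proj f a ξ : ℝ) :=
    continuous_subtype_val.comp (continuousOn_iff_continuous_domRestrict.1 (hf.continuousOn_proj hinj))
  -- Tietze extension to a real function, then retraction to [0,1]. A map on all sequences makes φ ∘
  -- π continuous everywhere, as `GibbsDecomposition` asks.
  obtain ⟨g, hg⟩ := ContinuousMap.exists_restrict_eq isClosed_codeSpace
    (⟨fun ξ : codeSpace f a => (proj f a ξ : ℝ), hc⟩ : C(codeSpace f a, ℝ))
  refine ⟨fun ξ => projIcc 0 1 zero_le_one (g ξ), continuous_projIcc.comp g.continuous,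
    fun ξ hξ => ?_⟩
  have : g ξ = (proj f a ξ : ℝ) := congrArg (fun F => F ⟨ξ, hξ⟩) hg
  simp only [this]
  exact projIcc_val zero_le_one _

end PiecewiseMonotonic

end OpenCylinder

end PMM

/-! ### Comparing the weights on the interval with the symbolic weights. -/

namespace PMM

/-- The exponential growth rate of a subadditive weighted count of the words of a language. -/
theorem exists_wordSum_exponent {A : Type*} [Finite A] {c : List A → ℝ} {E : Set (List A)} {B : ℝ}
    (hsub : ∀ u v, u ++ v ∈ E → c (u ++ v) ≤ c u + c v)
    (hl : ∀ u v, u ++ v ∈ E → u ∈ E) (hr : ∀ u v, u ++ v ∈ E → v ∈ E)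
    (hB : ∀ w ∈ E, |c w| ≤ w.length * B) (hne : ∀ n : ℕ, ∃ w ∈ E, w.length = n) :
    ∃ P : ℝ, Tendsto (fun n : ℕ => Real.log (wordSum c E n) / n) atTop (𝓝 P) ∧
      (∀ n : ℕ, Real.exp (n * P) ≤ wordSum c E n) ∧
      ∀ ε > 0, ∀ᶠ n : ℕ in atTop, wordSum c E n ≤ Real.exp (n * (P + ε)) := by
  have hlow : ∀ n : ℕ, Real.exp (-(n * B)) ≤ wordSum c E n := by
    intro n
    obtain ⟨w, hw, rfl⟩ := hne n
    exact (Real.exp_le_exp.2 (abs_le.1 (hB w hw)).1).trans (exp_le_wordSum c hw)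
  have hpos : ∀ n : ℕ, 0 < wordSum c E n := fun n => (Real.exp_pos _).trans_le (hlow n)
  have hsa : Subadditive fun n : ℕ => Real.log (wordSum c E n) := by
    intro m n
    rw [← Real.log_mul (hpos m).ne' (hpos n).ne']
    exact Real.log_le_log (hpos _) (wordSum_add_le hsub hl hr m n)
  have hbdd : BddBelow (range fun n : ℕ => Real.log (wordSum c E n) / n) := by
    refine ⟨-|B|, ?_⟩
    rintro _ ⟨n, rfl⟩
    rcases Nat.eq_zero_or_pos n with rfl | hn
    · simp
    · have hn' : (0 : ℝ) < n := by exact_mod_cast hn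
      rw [le_div_iff₀ hn', Real.le_log_iff_exp_le (hpos n)]
      refine le_trans (Real.exp_le_exp.2 ?_) (hlow n)
      nlinarith [le_abs_self B]
  have hlim := hsa.tendsto_lim hbdd
  refine ⟨hsa.lim, hlim, fun n => ?_, fun ε hε => ?_⟩
  -- The Fekete limit is an infimum, so the lower bound e^{nP} needs no constant.
  · rcases Nat.eq_zero_or_pos n with rfl | hn
    · simpa using hlow 0
    · have hn' : (0 : ℝ) < n := by exact_mod_cast hn
      rw [← Real.le_log_iff_exp_le (hpos n), mul_comm, ← le_div_iff₀ hn']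
      exact hsa.lim_le_div hbdd hn.ne'
  · filter_upwards [hlim.eventually (gt_mem_nhds (lt_add_of_pos_right hsa.lim hε)),
      eventually_gt_atTop 0] with n h1 hn
    have hn' : (0 : ℝ) < n := by exact_mod_cast hn
    rw [← Real.log_le_iff_le_exp (hpos n), mul_comm, ← div_le_iff₀ hn']
    exact h1.le

theorem language_append_left_right {A : Type*} {X : Set (ℕ → A)} (hX : MapsTo shift X X)
    {u v w : List A} (h : u ++ v ++ w ∈ language X) :
    u ∈ language X ∧ v ∈ language X ∧ w ∈ language X :=
  ⟨language_append_left (language_append_left h),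
    language_append_right hX (language_append_left h), language_append_right hX h⟩

namespace PiecewiseMonotonic

variable {p : ℕ} {f : unitInterval → unitInterval} {a : Fin (p + 1) → unitInterval}
  {φ : unitInterval → ℝ} {B : ℝ} {π : (ℕ → Fin p) → unitInterval}

theorem wordSet_append_left {u v : List (Fin p)} {x : unitInterval}
    (h : x ∈ wordSet f a (u ++ v)) : x ∈ wordSet f a u := fun k hk => by
  have := h k (by simp; omega)
  rwa [List.getElem_append_left hk] at this

theorem wordSet_append_right {u v : List (Fin p)} {x : unitInterval}
    (h : x ∈ wordSet f a (u ++ v)) : f^[u.length] x ∈ wordSet f a v := fun k hk => by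
  have := h (k + u.length) (by simp; omega)
  rw [Function.iterate_add_apply] at this
  simpa [List.getElem_append_right] using this

theorem le_supSum (hB : ∀ x, |φ x| ≤ B) {w : List (Fin p)} {x : unitInterval}
    (h : x ∈ wordSet f a w) : birkhoffSum f φ w.length x ≤ supSum f a φ w := by
  refine le_csSup ⟨w.length * B, ?_⟩ (mem_image_of_mem _ h)
  rintro _ ⟨η, -, rfl⟩
  exact (abs_le.1 (abs_birkhoffSum_le hB _ _)).2

theorem supSum_le {w : List (Fin p)} (hw : (wordSet f a w).Nonempty) {r : ℝ}
    (h : ∀ x ∈ wordSet f a w, birkhoffSum f φ w.length x ≤ r) : supSum f a φ w ≤ r := by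
  refine csSup_le (hw.image _) ?_
  rintro _ ⟨ξ, hξ, rfl⟩
  exact h ξ hξ

theorem partitionSum_eq (D : Set (List (Fin p))) (n : ℕ) :
    partitionSum f a φ D n = wordSum (supSum f a φ) D n := by
  rw [partitionSum, wordSum]
  exact finsum_mem_eq_sum_of_inter_support_eq _ (by ext w; simp [and_comm])

variable (hf : PiecewiseMonotonic f a)
include hf

theorem itinerary_mem_cylinder_iff {x : unitInterval} (hx : x ∈ regularPoints f a)
    {w : List (Fin p)} :
    hf.itinerary x ∈ cylinder (codeSpace f a) w ↔ x ∈ wordSet f a w := by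
  constructor
  · rintro ⟨-, h⟩ k hk
    rw [← h k hk]
    exact subset_closure (hf.isItinerary hx k)
  · exact fun h => ⟨hf.itinerary_mem hx, fun k hk =>
      hf.piece_injective (hf.isItinerary hx k) (mem_piece_of_mem_closure (h k hk) (hx k))⟩

theorem wordSet_nonempty {w : List (Fin p)} (hw : w ∈ language (codeSpace f a)) :
    (wordSet f a w).Nonempty := by
  obtain ⟨x, hx, h⟩ := hf.exists_regular_of_mem_language hw
  exact ⟨x, (hf.itinerary_mem_cylinder_iff hx).1 h⟩

theorem abs_supSum_le (hB : ∀ x, |φ x| ≤ B) {w : List (Fin p)}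
    (hw : w ∈ language (codeSpace f a)) : |supSum f a φ w| ≤ w.length * B := by
  rw [abs_le]
  obtain ⟨x, hx⟩ := hf.wordSet_nonempty hw
  exact ⟨(abs_le.1 (abs_birkhoffSum_le hB _ x)).1.trans (le_supSum hB hx),
    supSum_le ⟨x, hx⟩ fun η _ => (abs_le.1 (abs_birkhoffSum_le hB _ η)).2⟩

theorem supSum_append_le (hB : ∀ x, |φ x| ≤ B) {u v : List (Fin p)}
    (h : u ++ v ∈ language (codeSpace f a)) :
    supSum f a φ (u ++ v) ≤ supSum f a φ u + supSum f a φ v := by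
  refine supSum_le (hf.wordSet_nonempty h) fun x hx => ?_
  rw [List.length_append, birkhoffSum_add]
  exact add_le_add (le_supSum hB (wordSet_append_left hx)) (le_supSum hB (wordSet_append_right hx))

theorem supSum_append_append_le (hB : ∀ x, |φ x| ≤ B) {u v w : List (Fin p)}
    (h : u ++ v ++ w ∈ language (codeSpace f a)) :
    supSum f a φ (u ++ v ++ w) ≤ supSum f a φ u + supSum f a φ v + supSum f a φ w :=
  (hf.supSum_append_le hB h).trans
    (add_le_add_left (hf.supSum_append_le hB (language_append_left h)) _)

/-- The itineraries of the points of `π(w)` are dense in the cylinder `[w]`. -/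
theorem cylinder_subset_closure (w : List (Fin p)) : cylinder (codeSpace f a) w ⊆
    closure (hf.itinerary '' (regularPoints f a ∩ wordSet f a w)) := by
  rw [cylinder_eq_inter, inter_comm]
  refine ((isClopen_cylinder w).isOpen.inter_closure).trans (closure_mono ?_)
  rintro ξ ⟨h, x, hx, hξ⟩
  rw [← hf.itinerary_eq hξ] at h ⊢
  refine ⟨x, ⟨hx, (hf.itinerary_mem_cylinder_iff hx).1 ?_⟩, rfl⟩
  rw [cylinder_eq_inter]
  exact ⟨hf.itinerary_mem hx, h⟩

variable (hinj : AdmitsSymbolicDynamics f a) (hπ : ∀ ξ ∈ codeSpace f a, π ξ = proj f a ξ)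
include hinj hπ

theorem birkhoffSum_itinerary {x : unitInterval} (hx : x ∈ regularPoints f a) (n : ℕ) :
    birkhoffSum shift (φ ∘ π) n (hf.itinerary x) = birkhoffSum f φ n x := by
  refine Finset.sum_congr rfl fun k _ => ?_
  rw [← itinerary_iterate hf, Function.comp_apply, hπ _ (hf.itinerary_mem (regular_iterate hx k)),
    hf.proj_itinerary hinj (regular_iterate hx k)]

variable (hφ : Continuous φ) (hπc : Continuous π)
include hφ hπc

omit hf hinj hπ in
theorem continuous_birkhoffSum_lift (n : ℕ) :
    Continuous (birkhoffSum shift (φ ∘ π) n) :=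
  continuous_finsetSum _ fun k _ => (hφ.comp hπc).comp (continuous_shift.iterate k)

/-- For regular points the Birkhoff sums of φ and of φ ∘ π agree. Density of their itineraries in
the cylinder and continuity give the rest. -/
theorem birkhoffSum_le_of_forall {w : List (Fin p)} {r : ℝ}
    (h : ∀ x ∈ wordSet f a w, birkhoffSum f φ w.length x ≤ r) {ξ : ℕ → Fin p}
    (hξ : ξ ∈ cylinder (codeSpace f a) w) : birkhoffSum shift (φ ∘ π) w.length ξ ≤ r := by
  refine closure_minimal (t := {ξ | birkhoffSum shift (φ ∘ π) w.length ξ ≤ r}) ?_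
    (isClosed_le (continuous_birkhoffSum_lift hφ hπc _) continuous_const)
    (hf.cylinder_subset_closure w hξ)
  rintro _ ⟨x, ⟨hx, hxw⟩, rfl⟩
  exact (hf.birkhoffSum_itinerary hinj hπ hx _).trans_le (h x hxw)

theorem le_birkhoffSum_of_forall {w : List (Fin p)} {r : ℝ}
    (h : ∀ x ∈ wordSet f a w, r ≤ birkhoffSum f φ w.length x) {ξ : ℕ → Fin p}
    (hξ : ξ ∈ cylinder (codeSpace f a) w) : r ≤ birkhoffSum shift (φ ∘ π) w.length ξ := by
  refine closure_minimal (t := {ξ | r ≤ birkhoffSum shift (φ ∘ π) w.length ξ}) ?_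
    (isClosed_le continuous_const (continuous_birkhoffSum_lift hφ hπc _))
    (hf.cylinder_subset_closure w hξ)
  rintro _ ⟨x, ⟨hx, hxw⟩, rfl⟩
  exact (h x hxw).trans_eq (hf.birkhoffSum_itinerary hinj hπ hx _).symm

variable (hB : ∀ x, |φ x| ≤ B)
include hB

/-- The converse may fail: `wordSet f a w` can contain irregular points whose f-orbit is not the
projection of a shift orbit. -/
theorem symSup_le_supSum {w : List (Fin p)} (hw : w ∈ language (codeSpace f a)) :
    symSup (codeSpace f a) (φ ∘ π) w ≤ supSum f a φ w :=
  symSup_le hw fun _ hξ =>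
    hf.birkhoffSum_le_of_forall hinj hπ hφ hπc (fun _ hx => le_supSum hB hx) hξ

/-- The Bowen property passes from `G` to the collections `G(M)`. -/
theorem exists_supSum_le_birkhoffSum {Cp G Cs : Set (List (Fin p))} (hII : BowenOn f a φ G)
    (M : ℕ) : ∃ V, ∀ w ∈ fatten (language (codeSpace f a)) Cp G Cs M,
      ∀ ξ ∈ cylinder (codeSpace f a) w,
        supSum f a φ w ≤ birkhoffSum shift (φ ∘ π) w.length ξ + V := by
  obtain ⟨-, V, hV⟩ := hII
  -- The outer factors have length at most `M`. Each of the two costs MB in the supremum and MB in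
  -- the Birkhoff sum.
  refine ⟨V + 4 * (M * B), ?_⟩
  rintro _ ⟨hL, u, -, v, hv, s, -, hu, hs, rfl⟩ ξ hξ
  have hX := mapsTo_codeSpace (f := f) (a := a)
  obtain ⟨huL, hvL, hsL⟩ := language_append_left_right hX hL
  have hB0 : 0 ≤ B := (abs_nonneg (φ 0)).trans (hB 0)
  have hψB : ∀ ξ, |(φ ∘ π) ξ| ≤ B := fun ξ => hB _
  have huB : (u.length : ℝ) * B ≤ M * B := mul_le_mul_of_nonneg_right (by exact_mod_cast hu) hB0
  have hsB : (s.length : ℝ) * B ≤ M * B := mul_le_mul_of_nonneg_right (by exact_mod_cast hs) hB0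
  have h1 := hf.supSum_append_append_le hB hL
  have h2 := (abs_le.1 (hf.abs_supSum_le hB huL)).2
  have h3 := (abs_le.1 (hf.abs_supSum_le hB hsL)).2
  have h4 := (abs_le.1 (abs_birkhoffSum_le (T := shift) hψB u.length ξ)).1
  have h5 := (abs_le.1 (abs_birkhoffSum_le (T := shift) hψB s.length
    (shift^[(u ++ v).length] ξ))).1
  have h6 : supSum f a φ v - V ≤ birkhoffSum shift (φ ∘ π) v.length (shift^[u.length] ξ) := by
    refine hf.le_birkhoffSum_of_forall hinj hπ hφ hπc (fun x hx => ?_)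
      (mem_cylinder_append_right hX (mem_cylinder_append.1 hξ).1)
    have : supSum f a φ v ≤ birkhoffSum f φ v.length x + V :=
      supSum_le ⟨x, hx⟩ fun y hy => by linarith [(abs_le.1 (hV v hv y hy x hx)).2]
    linarith
  rw [List.length_append, birkhoffSum_add, List.length_append, birkhoffSum_add]
  rw [List.length_append] at h5
  linarith

/-- On G(M) bounded distortion reverses `symSup_le_supSum` up to a constant. This is what makes the
two pressures comparable. -/
theorem exists_supSum_le_symSup {Cp G Cs : Set (List (Fin p))} (hII : BowenOn f a φ G)
    (M : ℕ) : ∃ V, ∀ w ∈ fatten (language (codeSpace f a)) Cp G Cs M,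
        supSum f a φ w ≤ symSup (codeSpace f a) (φ ∘ π) w + V := by
  obtain ⟨V, hV⟩ := hf.exists_supSum_le_birkhoffSum hinj hπ hφ hπc hB (Cp := Cp) (Cs := Cs) hII M
  refine ⟨V, fun w hw => ?_⟩
  obtain ⟨ξ, hξ⟩ := id hw.1
  exact (hV w hw ξ hξ).trans (add_le_add_left (le_symSup (fun ξ => hB _) hξ) _)

/-- The hypotheses are about `supSum`, the symbolic argument about `symSup`. Upper bounds pass down
since `symSup` is smaller. For the lower bound, G(M) carries half of the `supSum` weight for large
M, and there the two weights are comparable, so the exponents satisfy P ≤ R. -/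
theorem gibbsDecomposition {Cp G Cs : Set (List (Fin p))}
    (hCp : Cp ⊆ language (codeSpace f a)) (hG : G ⊆ language (codeSpace f a))
    (hCs : Cs ⊆ language (codeSpace f a))
    (hdec : tripleConcat (language (codeSpace f a)) Cp G Cs = language (codeSpace f a))
    (hI : ∀ M : ℕ, SpecS (codeSpace f a) (fatten (language (codeSpace f a)) Cp G Cs M))
    (hII : BowenOn f a φ G)
    (hIII : Summable fun n : ℕ => partitionSum f a φ (Cp ∪ Cs) (n + 1) *
      Real.exp (-((n + 1 : ℕ) * pressure f a φ))) :
    GibbsDecomposition (codeSpace f a) (φ ∘ π) (fatten (language (codeSpace f a)) Cp G Cs)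
      (pressure f a φ) B := by
  set X := codeSpace f a with hXdef
  set P := pressure f a φ with hPdef
  set ψ := φ ∘ π with hψ
  have hX : MapsTo shift X X := mapsTo_codeSpace
  have hψB : ∀ ξ, |ψ ξ| ≤ B := fun ξ => hB _
  have hne : ∀ n : ℕ, ∃ w ∈ language X, w.length = n := fun n => by
    obtain ⟨x, -, hx⟩ := hf.exists_regular_mem isOpen_univ univ_nonempty
    exact ⟨pre (hf.itinerary x) n, pre_mem_language (hf.itinerary_mem hx) n, length_pre _ _⟩
  have hl : ∀ u v, u ++ v ∈ language X → u ∈ language X := fun _ _ => language_append_left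
  have hr : ∀ u v, u ++ v ∈ language X → v ∈ language X := fun _ _ => language_append_right hX
  have hle : ∀ w ∈ language X, symSup X ψ w ≤ supSum f a φ w := fun w =>
    hf.symSup_le_supSum hinj hπ hφ hπc hB
  have hle' : ∀ {D}, D ⊆ language X → ∀ n,
      wordSum (symSup X ψ) D n ≤ wordSum (supSum f a φ) D n := fun hD n => by
    simpa using wordSum_le_mul (V := 0) (fun w hw => by simpa using hle w (hD hw)) n
  -- The empty word belongs to the language and decomposes only into empty words. Hence all three
  -- collections contain it, and G lies in every G(M).
  have hnil : [] ∈ Cp ∧ [] ∈ G ∧ [] ∈ Cs := by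
    obtain ⟨w, hw, hw0⟩ := hne 0
    obtain rfl := List.eq_nil_of_length_eq_zero hw0
    rw [← hdec] at hw
    obtain ⟨-, u, hu, v, hv, s, hs, h⟩ := hw
    have h' := h.symm
    simp only [List.append_eq_nil_iff] at h'
    obtain ⟨⟨rfl, rfl⟩, rfl⟩ := h'
    exact ⟨hu, hv, hs⟩
  have hGsub : ∀ M, G ⊆ fatten (language X) Cp G Cs M := fun M v hv =>
    ⟨hG hv, [], hnil.1, v, hv, [], hnil.2.2, by simp, by simp, by simp⟩
  have hfsub : ∀ M, fatten (language X) Cp G Cs M ⊆ language X := fun M w hw => hw.1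
  have hBow := fun M => hf.exists_supSum_le_birkhoffSum hinj hπ hφ hπc hB (Cp := Cp) (Cs := Cs) hII M
  have hBow' := fun M => hf.exists_supSum_le_symSup hinj hπ hφ hπc hB (Cp := Cp) (Cs := Cs) hII M
  have hsB : ∀ M, ∃ V, ∀ w ∈ fatten (language X) Cp G Cs M, ∀ ξ ∈ cylinder X w,
      symSup X ψ w ≤ birkhoffSum shift ψ w.length ξ + V := fun M => by
    obtain ⟨V, hV⟩ := hBow M
    exact ⟨V, fun w hw ξ hξ => (hle w (hfsub M hw)).trans (hV w hw ξ hξ)⟩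
  obtain ⟨Q, hQlim, hQlow, hQup⟩ := exists_wordSum_exponent
    (fun u v h => hf.supSum_append_le (φ := φ) hB h) hl hr (fun w hw => hf.abs_supSum_le hB hw) hne
  obtain rfl : P = Q := by
    rw [hPdef, pressure]
    simp only [partitionSum_eq]
    exact hQlim.limsup_eq
  obtain ⟨R, -, hRlow, hRup⟩ := exists_wordSum_exponent (c := symSup X ψ) (E := language X)
    (fun u v h => symSup_append_le hX hψB h) hl hr (fun w hw => abs_symSup_le hψB hw) hne
  -- The hypothesis starts at length 1; the single term of length 0 does not affect summability.
  have hsum : Summable fun n : ℕ => wordSum (supSum f a φ) (Cp ∪ Cs) n * Real.exp (-(n * P)) := by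
    rw [← summable_nat_add_iff 1]
    simpa only [partitionSum_eq] using hIII
  have hsum' : Summable fun n : ℕ => wordSum (symSup X ψ) (Cp ∪ Cs) n * Real.exp (-(n * P)) :=
    Summable.of_nonneg_of_le
      (fun n => mul_nonneg (wordSum_nonneg _ _ _) (Real.exp_pos _).le)
      (fun n => mul_le_mul_of_nonneg_right (hle' (union_subset hCp hCs) n) (Real.exp_pos _).le) hsum
  obtain ⟨V₀, hV₀⟩ := hsB 0
  obtain ⟨K, hK⟩ := wordSum_le_of_specS hX hψB (fun w hw => hV₀ w (hGsub 0 hw))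
    (by
      obtain ⟨t, ht⟩ := hI 0
      exact ⟨t, fun m w hw => ht m w fun i => hGsub 0 (hw i)⟩ : SpecS X G) (P := P)
    (fun ε hε => (hQup ε hε).mono fun n hn => (hle' subset_rfl n).trans hn)
  obtain ⟨V₁, hV₁⟩ := hBow' 0
  have hKsup : ∀ n : ℕ, wordSum (supSum f a φ) G n ≤ Real.exp V₁ * K * Real.exp (n * P) := by
    intro n
    refine (wordSum_le_mul (fun w hw => hV₁ w (hGsub 0 hw)) n).trans ?_
    rw [mul_assoc]
    exact mul_le_mul_of_nonneg_left (hK n) (Real.exp_pos _).le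
  obtain ⟨-, htail⟩ := wordSum_decomposition_bounds (c := supSum f a φ) hdec
    (fun u v w h => hf.supSum_append_append_le hB h) hKsup hsum
  obtain ⟨hup, htail'⟩ := wordSum_decomposition_bounds (c := symSup X ψ) hdec
    (fun u v w h => symSup_append_append_le hX hψB h) hK hsum'
  have hPR : P ≤ R := by
    obtain ⟨M, hM⟩ := htail (1 / 2) (by norm_num)
    obtain ⟨V, hV⟩ := hBow' M
    have key : ∀ n : ℕ, 1 / 2 * Real.exp (n * P) ≤
        Real.exp V * wordSum (symSup X ψ) (language X) n := by
      intro n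
      have h1 := wordSum_le_add (supSum f a φ) (language X) (fatten (language X) Cp G Cs M) n
      have h2 := wordSum_mono (supSum f a φ) (inter_subset_right :
        language X ∩ fatten (language X) Cp G Cs M ⊆ fatten (language X) Cp G Cs M) n
      have h3 := wordSum_le_mul (fun w hw => hV w hw) n
      have h4 := mul_le_mul_of_nonneg_left (wordSum_mono (symSup X ψ) (hfsub M) n)
        (Real.exp_pos V).le
      linarith [hQlow n, hM n]
    by_contra! hlt
    -- If R < P, half of the difference bounds the symbolic growth from above. For this large `n`,
    -- the factor 2e^V cannot bridge the rest.
    obtain ⟨n, h1, h2, hn⟩ := ((hRup ((P - R) / 2) (by linarith)).and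
      ((tendsto_natCast_atTop_atTop.eventually_gt_atTop ((V + Real.log 2) / ((P - R) / 2))).and
      (eventually_gt_atTop 0))).exists
    have h3 := (key n).trans (mul_le_mul_of_nonneg_left h1 (Real.exp_pos V).le)
    rw [div_lt_iff₀ (by linarith)] at h2
    have h4 : Real.exp (n * P) ≤ Real.exp (Real.log 2 + V + n * (R + (P - R) / 2)) := by
      rw [Real.exp_add, Real.exp_add, Real.exp_log two_pos]
      linarith
    rw [Real.exp_le_exp] at h4
    nlinarith
  exact
    { isClosed := isClosed_codeSpace
      mapsTo := hX
      continuous := hφ.comp hπc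
      bound := hψB
      mono := by
        rintro M N hMN w ⟨hL, u, hu, v, hv, s, hs, h1, h2, h⟩
        exact ⟨hL, u, hu, v, hv, s, hs, h1.trans hMN, h2.trans hMN, h⟩
      spec := hI
      bowen := hsB
      lower := fun n => (Real.exp_le_exp.2 (mul_le_mul_of_nonneg_left hPR n.cast_nonneg)).trans
        (hRlow n)
      upper := hup
      tail := htail' }

end PiecewiseMonotonic
end PMM

namespace PMM

/-! ### Invariant limits of averages, and factor maps. -/

section Averages

variable {p : ℕ}

/-- Two probability measures that are comparable on closed sets agree. -/
theorem eq_of_forall_isClosed_le {Y : Type*} [TopologicalSpace Y] [MeasurableSpace Y] [BorelSpace Y]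
    {μ ν : Measure Y} [IsProbabilityMeasure μ] [IsProbabilityMeasure ν] [ν.OuterRegular]
    (h : ∀ C, IsClosed C → ν C ≤ μ C) : μ = ν := by
  have hopen : ∀ U, IsOpen U → μ U ≤ ν U := by
    intro U hU
    have := h Uᶜ hU.isClosed_compl
    rw [prob_compl_eq_one_sub hU.measurableSet, prob_compl_eq_one_sub hU.measurableSet] at this
    rw [← ENNReal.sub_sub_cancel ENNReal.one_ne_top (prob_le_one (μ := μ) (s := U)),
      ← ENNReal.sub_sub_cancel ENNReal.one_ne_top (prob_le_one (μ := ν) (s := U))]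
    exact tsub_le_tsub_left this _
  refine ext_of_generate_finite _ (borel_eq_generateFrom_isClosed (α := Y) ▸ BorelSpace.measurable_eq)
    isPiSystem_isClosed (fun C hC => le_antisymm ?_ (h C hC)) (by simp)
  rw [C.measure_eq_iInf_isOpen ν]
  exact le_iInf₂ fun U hCU => le_iInf fun hU => (measure_mono hCU).trans (hopen U hU)

/-- Limits of averages along orbits of the shift. -/
theorem exists_invariant_average (m : Measure (ℕ → Fin p)) [IsProbabilityMeasure m] :
    ∃ μ : Measure (ℕ → Fin p), IsProbabilityMeasure μ ∧ MeasurePreserving shift μ μ ∧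
      ∀ C, IsClosed C → ∀ r : ENNReal, (∀ k, r ≤ m (shift^[k] ⁻¹' C)) → r ≤ μ C := by
  let A : ℕ → Measure (ℕ → Fin p) := fun N =>
    ((N + 1 : ℕ) : ENNReal)⁻¹ • ∑ k ∈ Finset.range (N + 1), m.map shift^[k]
  have hA : ∀ N C, MeasurableSet C → A N C =
      ((N + 1 : ℕ) : ENNReal)⁻¹ * ∑ k ∈ Finset.range (N + 1), m (shift^[k] ⁻¹' C) := by
    intro N C hC
    simp only [A, Measure.smul_apply, Measure.finsetSum_apply, smul_eq_mul]
    congr 1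
    exact Finset.sum_congr rfl fun k _ => Measure.map_apply (measurable_shift.iterate k) hC
  have hcancel : ∀ (N : ℕ) (r : ENNReal), ((N + 1 : ℕ) : ENNReal)⁻¹ * (((N + 1 : ℕ) : ENNReal) * r) = r :=
    fun N r => by
      rw [← mul_assoc, ENNReal.inv_mul_cancel (by simp) (by simp), one_mul]
  have hprob : ∀ N, IsProbabilityMeasure (A N) := fun N => ⟨by
    rw [hA N _ MeasurableSet.univ]
    simpa using hcancel N 1⟩
  have hreal : ∀ N C, MeasurableSet C → (A N).real C =
      ((N + 1 : ℕ) : ℝ)⁻¹ * ∑ k ∈ Finset.range (N + 1), m.real (shift^[k] ⁻¹' C) := by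
    intro N C hC
    rw [measureReal_def, hA N C hC, ENNReal.toReal_mul, ENNReal.toReal_inv,
      ENNReal.toReal_natCast, ENNReal.toReal_sum fun _ _ => measure_ne_top _ _]
    rfl
  obtain ⟨μ, hμ⟩ := exists_ultralimit (hyperfilter ℕ) fun N => ⟨A N, hprob N⟩
  have hle : ((hyperfilter ℕ : Ultrafilter ℕ) : Filter ℕ) ≤ atTop := Nat.hyperfilter_le_atTop
  refine ⟨μ, inferInstance, ?_, fun C hC r hr => ?_⟩
  · refine measurePreserving_shift_of_tendsto hμ fun n C hC => Tendsto.mono_left ?_ hle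
    refine squeeze_zero_norm (fun N => ?_) tendsto_one_div_add_atTop_nhds_zero_nat
    simp only [ProbabilityMeasure.coe_mk]
    rw [hreal N _ (measurable_shift hC.measurableSet), hreal N _ hC.measurableSet, ← mul_sub,
      ← Finset.sum_sub_distrib]
    have hs : ∀ k, shift^[k] ⁻¹' (shift ⁻¹' C) = shift^[k + 1] ⁻¹' C := fun k => by
      rw [Function.iterate_succ', preimage_comp]
    simp only [hs]
    rw [Finset.sum_range_sub fun k => m.real (shift^[k] ⁻¹' C), norm_mul, norm_inv,
      Real.norm_natCast, one_div, Nat.cast_succ]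
    refine mul_le_of_le_one_right (by positivity) ?_
    rw [Real.norm_eq_abs, abs_le]
    constructor <;>
      linarith [measureReal_nonneg (μ := m) (s := shift^[N + 1] ⁻¹' C),
        measureReal_nonneg (μ := m) (s := shift^[0] ⁻¹' C),
        measureReal_le_one (μ := m) (s := shift^[N + 1] ⁻¹' C),
        measureReal_le_one (μ := m) (s := shift^[0] ⁻¹' C)]
  · refine measure_closed_of_tendsto hμ hC fun N => ?_
    simp only [ProbabilityMeasure.coe_mk]
    rw [hA N C hC.measurableSet]
    calc r = ((N + 1 : ℕ) : ENNReal)⁻¹ * (((N + 1 : ℕ) : ENNReal) * r) := (hcancel N r).symm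
      _ ≤ _ := by
        gcongr
        calc ((N + 1 : ℕ) : ENNReal) * r = ∑ _k ∈ Finset.range (N + 1), r := by simp
          _ ≤ _ := Finset.sum_le_sum fun k _ => hr k

end Averages

section FactorMaps

variable {Y Z : Type*} [MeasurableSpace Y] [MeasurableSpace Z] {T : Y → Y} {S : Z → Z}
  {μ : Measure Y} {g : Y → Z}

omit [MeasurableSpace Z] in
theorem ae_iterate_of_ae (hT : MeasurePreserving T μ μ)
    (h : ∀ᵐ y ∂μ, g (T y) = S (g y)) : ∀ᵐ y ∂μ, ∀ k, g (T^[k] y) = S^[k] (g y) := by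
  rw [ae_all_iff]
  intro k
  induction k with
  | zero => simp
  | succ k ih =>
    filter_upwards [ih, (hT.iterate k).quasiMeasurePreserving.ae h] with y h1 h2
    rw [Function.iterate_succ_apply', h2, h1, ← Function.iterate_succ_apply' S]

theorem refinementEntropy_congr {r : ℕ} {q q' : Y → Fin r} {n : ℕ}
    (h : ∀ᵐ y ∂μ, ∀ k : ℕ, q (T^[k] y) = q' (T^[k] y)) :
    refinementEntropy T μ q n = refinementEntropy T μ q' n := by
  refine Finset.sum_congr rfl fun u _ => congrArg _ (measureReal_congr ?_)
  filter_upwards [h] with y hy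
  refine propext (forall_congr' fun k => ?_)
  rw [hy]

theorem refinementEntropy_map (hS : Measurable S) (hg : Measurable g)
    (h : ∀ᵐ y ∂μ, ∀ k, g (T^[k] y) = S^[k] (g y)) {r : ℕ} {q : Z → Fin r} (hq : Measurable q)
    (n : ℕ) : refinementEntropy S (μ.map g) q n = refinementEntropy T μ (q ∘ g) n := by
  refine Finset.sum_congr rfl fun u _ => congrArg _ ?_
  have hm : MeasurableSet {x | ∀ k : Fin n, q (S^[k] x) = u k} := by
    rw [ofPred_forall]
    exact MeasurableSet.iInter fun k => (hq.comp (hS.iterate k)) (measurableSet_singleton (u k))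
  rw [map_measureReal_apply hg hm]
  refine measureReal_congr ?_
  filter_upwards [h] with y hy
  refine propext (forall_congr' fun k => ?_)
  rw [Function.comp_apply, hy]

/-- Partitions pull back along `g` with the same names almost everywhere, so the factor sees no more
partitions than the original system. -/
theorem entropy_map_le (hS : Measurable S) (hg : Measurable g)
    (h : ∀ᵐ y ∂μ, ∀ k, g (T^[k] y) = S^[k] (g y)) : entropy S (μ.map g) ≤ entropy T μ := by
  refine iSup_le fun r => iSup_le fun q => iSup_le fun hq => ?_
  simp only [refinementEntropy_map hS hg h hq]
  exact le_iSup_of_le r (le_iSup_of_le (q ∘ g) (le_iSup_of_le (hq.comp hg) le_rfl))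

theorem measurePreserving_map (hT : MeasurePreserving T μ μ) (hS : Measurable S)
    (hg : Measurable g) (h : ∀ᵐ y ∂μ, g (T y) = S (g y)) :
    MeasurePreserving S (μ.map g) (μ.map g) := by
  refine ⟨hS, ?_⟩
  rw [Measure.map_map hS hg]
  conv_rhs => rw [← hT.map_eq, Measure.map_map hg hT.measurable]
  exact Measure.map_congr (h.mono fun y hy => hy.symm)

end FactorMaps

end PMM

/-! ### Transport of invariant measures between the subshift and the interval. -/

namespace PMM
namespace PiecewiseMonotonic

variable {p : ℕ} {f : unitInterval → unitInterval} {a : Fin (p + 1) → unitInterval}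
  {φ : unitInterval → ℝ} {B P : ℝ} {π : (ℕ → Fin p) → unitInterval}
  {GM : ℕ → Set (List (Fin p))} {μ : Measure (ℕ → Fin p)}

variable (hf : PiecewiseMonotonic f a) (hinj : AdmitsSymbolicDynamics f a)
  (hπ : ∀ ξ ∈ codeSpace f a, π ξ = proj f a ξ) (hπc : Continuous π)
include hf hinj hπ

theorem lift_shift_iterate {ξ : ℕ → Fin p} (hξ : ξ ∈ codeSpace f a)
    (hx : π ξ ∈ regularPoints f a) (k : ℕ) : π (shift^[k] ξ) = f^[k] (π ξ) := by
  rw [hπ _ (shift_iterate_mem mapsTo_codeSpace k hξ), hπ _ hξ]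
  exact hf.proj_shift_iterate hinj hξ (hπ ξ hξ ▸ hx) k

/-- Regular points get their itinerary, irregular periodic points the code supplied by
`CodesPeriodicOrbits`, and all others any code. The last kind is null for every invariant measure.
-/
theorem exists_section (hper : CodesPeriodicOrbits f a) (x : unitInterval) :
    ∃ ξ ∈ codeSpace f a, π ξ = x ∧ (x ∈ regularPoints f a → ξ = hf.itinerary x) ∧
      ((x ∈ regularPoints f a ∨ ∃ n > 0, f^[n] x = x) → ∀ k, π (shift^[k] ξ) = f^[k] x) := by
  by_cases hx : x ∈ regularPoints f a
  · have hX := hf.itinerary_mem hx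
    have h0 : π (hf.itinerary x) = x := by rw [hπ _ hX, hf.proj_itinerary hinj hx]
    exact ⟨_, hX, h0, fun _ => rfl, fun _ k => by
      rw [hf.lift_shift_iterate hinj hπ hX (by rwa [h0]), h0]⟩
  · by_cases hp : ∃ n > 0, f^[n] x = x
    · obtain ⟨n, hn, hfx⟩ := hp
      obtain ⟨ξ, hξ, h⟩ := hper x n hn hfx
      have h' : ∀ k, π (shift^[k] ξ) = f^[k] x := fun k => by
        rw [hπ _ (shift_iterate_mem mapsTo_codeSpace k hξ), h]
      exact ⟨ξ, hξ, h' 0, fun h => absurd h hx, fun _ => h'⟩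
    · obtain ⟨ξ, hξ, h⟩ := hf.exists_proj_eq hinj x
      exact ⟨ξ, hξ, by rw [hπ _ hξ, h], fun h => absurd h hx, fun h => (h.elim hx hp).elim⟩

omit hinj hπ in
/-- Almost every point of an invariant measure is regular or periodic. -/
theorem ae_regular_or_periodic {ν : Measure unitInterval} (hν : IsInvariantProb f ν) :
    ∀ᵐ x ∂ν, x ∈ regularPoints f a ∨ ∃ n > 0, f^[n] x = x := by
  have := hν.1
  rw [ae_iff]
  have hc : {x | ¬ (x ∈ regularPoints f a ∨ ∃ n > 0, f^[n] x = x)}.Countable :=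
    hf.countable_irregular.mono fun x hx h => hx (Or.inl h)
  rw [← biUnion_of_singleton {x | ¬ (x ∈ regularPoints f a ∨ ∃ n > 0, f^[n] x = x)},
    measure_biUnion_null_iff hc]
  intro x hx
  by_contra h0
  obtain ⟨y, rfl, n, hn, hy⟩ := hν.2.conservative.exists_mem_iterate_mem
    (measurableSet_singleton x).nullMeasurableSet h0
  exact hx (Or.inr ⟨n, Nat.pos_of_ne_zero hn, hy⟩)

include hπc

/-- Invariant measures of `f` lift to the symbolic space. -/
theorem exists_lift (hper : CodesPeriodicOrbits f a) {ν : Measure unitInterval}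
    (hν : IsInvariantProb f ν) :
    ∃ μ : Measure (ℕ → Fin p), IsProbabilityMeasure μ ∧ MeasurePreserving shift μ μ ∧
      μ (codeSpace f a)ᶜ = 0 ∧ μ.map π = ν ∧ ∀ᵐ ξ ∂μ, π (shift ξ) = f (π ξ) := by
  have := hν.1
  set X := codeSpace f a with hX
  choose s hsX hs0 hsreg hsper using hf.exists_section hinj hπ hper
  -- The section agrees with the measurable itinerary off a countable set.
  have hsm : Measurable s := hf.measurable_itinerary.measurable_of_countable_ne
    (hf.countable_irregular.mono fun x hx h => hx (hsreg x h).symm)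
  have hgood : ∀ᵐ x ∂ν, ∀ k, π (shift^[k] (s x)) = f^[k] x :=
    (hf.ae_regular_or_periodic hν).mono hsper
  have hprobm : IsProbabilityMeasure (ν.map s) :=
    Measure.isProbabilityMeasure_map hsm.aemeasurable
  -- The codes chosen along an irregular periodic orbit need not be shifts of each other, so the
  -- image of ν under `s` need not be invariant and is averaged.
  obtain ⟨μ, hμ, hinv, hlim⟩ := exists_invariant_average (ν.map s)
  have hmap : ∀ k C, MeasurableSet C → (ν.map s) (shift^[k] ⁻¹' C) =
      ν {x | shift^[k] (s x) ∈ C} := fun k C hC =>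
    Measure.map_apply hsm ((measurable_shift.iterate k) hC)
  have hfk : ∀ k C, MeasurableSet C → ν (f^[k] ⁻¹' C) = ν C := fun k C hC =>
    (hν.2.iterate k).measure_preimage hC.nullMeasurableSet
  have hμX : μ Xᶜ = 0 := by
    rw [prob_compl_eq_zero_iff isClosed_codeSpace.measurableSet]
    refine le_antisymm prob_le_one (hlim X isClosed_codeSpace 1 fun k => ?_)
    rw [hmap k X isClosed_codeSpace.measurableSet]
    have : {x | shift^[k] (s x) ∈ X} = univ :=
      eq_univ_of_forall fun x => shift_iterate_mem mapsTo_codeSpace k (hsX x)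
    simp [this]
  have hprobπ : IsProbabilityMeasure (μ.map π) :=
    Measure.isProbabilityMeasure_map hπc.measurable.aemeasurable
  -- For closed C every term of the average gives the preimage of C at least the mass ν(C), and so
  -- does the limit. Comparison on closed sets suffices for probability measures.
  have hνμ : μ.map π = ν := by
    refine eq_of_forall_isClosed_le fun C hC => ?_
    rw [Measure.map_apply hπc.measurable hC.measurableSet]
    refine hlim _ (hC.preimage hπc) _ fun k => ?_
    rw [hmap k _ (hC.preimage hπc).measurableSet, ← hfk k C hC.measurableSet]
    refine measure_mono_ae ?_
    filter_upwards [hgood] with x hx hxC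
    change π (shift^[k] (s x)) ∈ C
    rw [hx]; exact hxC
  refine ⟨μ, hμ, hinv, hμX, hνμ, ?_⟩
  -- In the fibre over z the sequences whose whole projected orbit is the f-orbit of z form a closed
  -- set. For almost every x with f^k(x) = z the shifted code lies in it, so it fills the fibre up
  -- to measure 0. This is needed only for the countably many irregular z.
  have hfib : ∀ z, ∀ᵐ ξ ∂μ, π ξ = z → π (shift ξ) = f z := by
    intro z
    set C : Set (ℕ → Fin p) := {ξ | ∀ k, π (shift^[k] ξ) = f^[k] z} with hCdef
    have hC : IsClosed C := by
      rw [hCdef, ofPred_forall]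
      exact isClosed_iInter fun k =>
        isClosed_eq (hπc.comp (continuous_shift.iterate k)) continuous_const
    have hsub : C ⊆ π ⁻¹' {z} := fun ξ hξ => hξ 0
    have hle : μ (π ⁻¹' {z}) ≤ μ C := by
      rw [← Measure.map_apply hπc.measurable (measurableSet_singleton z), hνμ]
      refine hlim C hC _ fun k => ?_
      rw [hmap k _ hC.measurableSet, ← hfk k _ (measurableSet_singleton z)]
      refine measure_mono_ae ?_
      filter_upwards [hgood] with x hx hxz j
      have hxz' : f^[k] x = z := hxz
      rw [← Function.iterate_add_apply, hx, Function.iterate_add_apply, hxz']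
    have h0 : μ (π ⁻¹' {z} \ C) = 0 := by
      rw [measure_sdiff hsub hC.measurableSet.nullMeasurableSet (measure_ne_top _ _)]
      exact tsub_eq_zero_of_le hle
    filter_upwards [measure_eq_zero_iff_ae_notMem.1 h0] with ξ hξ hz
    by_contra hne
    exact hξ ⟨hz, fun hξC => hne (hξC 1)⟩
  filter_upwards [(ae_ball_iff hf.countable_irregular).2 fun z _ => hfib z,
    measure_eq_zero_iff_ae_notMem.1 hμX] with ξ h1 h2
  by_cases hr : π ξ ∈ regularPoints f a
  · exact hf.lift_shift_iterate hinj hπ (not_not.1 h2) hr 1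
  · exact h1 _ hr rfl

variable (h : GibbsDecomposition (codeSpace f a) (φ ∘ π) GM P B)
  (hμ : IsSymbolicGibbs (codeSpace f a) (φ ∘ π) GM P μ)
include h hμ

omit hπc in
-- A measure without atoms ignores the countable union of the finite fibres over irregular points.
theorem ae_regular : ∀ᵐ ξ ∂μ, ξ ∈ codeSpace f a ∧ π ξ ∈ regularPoints f a := by
  have hnull : ∀ z, ∀ᵐ ξ ∂μ, ξ ∈ codeSpace f a → π ξ ≠ z := by
    intro z
    have : NullSingletonClass μ := ⟨h.measure_singleton hμ (hf.infinite_codeSpace hinj)⟩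
    have h0 := (hf.finite_fiber z).countable.measure_zero μ
    filter_upwards [measure_eq_zero_iff_ae_notMem.1 h0] with ξ hξ hX hz
    exact hξ ⟨hX, by rw [← hπ _ hX, hz]⟩
  filter_upwards [(ae_ball_iff hf.countable_irregular).2 fun z _ => hnull z,
    measure_eq_zero_iff_ae_notMem.1 hμ.compl] with ξ h1 h2
  exact ⟨not_not.1 h2, by_contra fun hr => h1 _ hr (not_not.1 h2) rfl⟩

omit hπc in
theorem ae_lift_shift : ∀ᵐ ξ ∂μ, π (shift ξ) = f (π ξ) :=
  (hf.ae_regular hinj hπ h hμ).mono fun _ hξ => hf.lift_shift_iterate hinj hπ hξ.1 hξ.2 1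

theorem isInvariantProb_map : IsInvariantProb f (μ.map π) := by
  have := hμ.prob
  exact ⟨Measure.isProbabilityMeasure_map hπc.measurable.aemeasurable,
    measurePreserving_map hμ.measurePreserving hf.measurable hπc.measurable
      (hf.ae_lift_shift hinj hπ h hμ)⟩

theorem map_real_wordSet (w : List (Fin p)) :
    (μ.map π).real (wordSet f a w) = μ.real (cylinder univ w) := by
  have hm : MeasurableSet (wordSet f a w) := by
    simp only [wordSet, ofPred_forall]
    exact MeasurableSet.iInter fun k => MeasurableSet.iInter fun hk =>
      (hf.measurable.iterate k) isClosed_closure.measurableSet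
  rw [map_measureReal_apply hπc.measurable hm]
  refine measureReal_congr ?_
  filter_upwards [hf.ae_regular hinj hπ h hμ] with ξ hξ
  have hr := hξ.2
  rw [hπ _ hξ.1] at hr
  have h1 := hf.itinerary_mem_cylinder_iff hr (w := w)
  rw [← hf.eq_itinerary_of_proj_regular hξ.1 hr, ← hπ _ hξ.1] at h1
  refine propext (h1.symm.trans ?_)
  rw [cylinder_eq_inter]
  exact and_iff_right hξ.1

/-- Almost everywhere the piece containing the projected point is the zeroth letter of its code. So
the partition into pieces has the entropy of the symbolic generator, and this single partition
bounds the supremum below. -/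
theorem pressure_le_entropy_map (hφ : Continuous φ) :
    (P : EReal) ≤ entropy f (μ.map π) + ((∫ x, φ x ∂(μ.map π) : ℝ) : EReal) := by
  have := hμ.prob
  have hint : ∫ x, φ x ∂(μ.map π) = ∫ ξ, (φ ∘ π) ξ ∂μ :=
    integral_map hπc.measurable.aemeasurable hφ.aestronglyMeasurable
  have hent : ∀ n, refinementEntropy f (μ.map π) hf.index n =
      refinementEntropy shift μ (fun ξ => ξ 0) n := by
    intro n
    rw [refinementEntropy_map hf.measurable hπc.measurable (ae_iterate_of_ae hμ.measurePreserving
      (hf.ae_lift_shift hinj hπ h hμ)) hf.measurable_index]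
    refine refinementEntropy_congr ?_
    filter_upwards [hf.ae_regular hinj hπ h hμ] with ξ hξ k
    have hr := hξ.2
    rw [hπ _ hξ.1] at hr
    rw [Function.comp_apply, hf.lift_shift_iterate hinj hπ hξ.1 hξ.2, shift_iterate_apply, zero_add,
      hπ _ hξ.1]
    exact (congrFun (hf.eq_itinerary_of_proj_regular hξ.1 hr) k).symm
  rw [hint]
  set c := ∫ ξ, (φ ∘ π) ξ ∂μ
  have h1 : ((P - c : ℝ) : EReal) ≤ entropy f (μ.map π) := by
    refine le_iSup_of_le p (le_iSup_of_le hf.index (le_iSup_of_le hf.measurable_index ?_))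
    refine le_limsup_of_frequently_le ?_
    refine ((eventually_gt_atTop 0).mono fun n hn => ?_).frequently
    rw [EReal.coe_le_coe_iff, hent, le_div_iff₀ (by exact_mod_cast hn)]
    linarith [hμ.le_wordEntropy_add h n]
  calc (P : EReal) = ((P - c : ℝ) : EReal) + (c : EReal) := by rw [← EReal.coe_add]; simp
    _ ≤ _ := by gcongr

/-- A lift of ν has the same integral and at least the same entropy. The symbolic bound applies to
it, and if ν reaches P then the lift is μ. -/
theorem entropy_add_le (hφ : Continuous φ) (hper : CodesPeriodicOrbits f a)
    {ν : Measure unitInterval} (hν : IsInvariantProb f ν) :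
    entropy f ν + ((∫ x, φ x ∂ν : ℝ) : EReal) ≤ P ∧
      ((P : EReal) ≤ entropy f ν + ((∫ x, φ x ∂ν : ℝ) : EReal) → ν = μ.map π) := by
  obtain ⟨lam, hprob, hinv, hX, rfl, hsemi⟩ := hf.exists_lift hinj hπ hπc hper hν
  have hle : entropy f (lam.map π) + ((∫ x, φ x ∂(lam.map π) : ℝ) : EReal) ≤
      entropy shift lam + ((∫ ξ, (φ ∘ π) ξ ∂lam : ℝ) : EReal) := by
    rw [integral_map hπc.measurable.aemeasurable hφ.aestronglyMeasurable]
    exact add_le_add_left (entropy_map_le hf.measurable hπc.measurable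
      (ae_iterate_of_ae hinv hsemi)) _
  exact ⟨hle.trans (h.wordEntropy_add_le hinv hX), fun hP => by
    rw [h.eq_of_le_entropy_add hμ hinv hX (hP.trans hle)]⟩

theorem isEquilibriumState_map (hφ : Continuous φ) (hper : CodesPeriodicOrbits f a) :
    IsEquilibriumState f φ (μ.map π) :=
  ⟨hf.isInvariantProb_map hinj hπ hπc h hμ, fun _ hν =>
    (hf.entropy_add_le hinj hπ hπc h hμ hφ hper hν).1.trans
      (hf.pressure_le_entropy_map hinj hπ hπc h hμ hφ)⟩

theorem eq_map_of_isEquilibriumState (hφ : Continuous φ) (hper : CodesPeriodicOrbits f a)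
    {ν : Measure unitInterval} (hν : IsEquilibriumState f φ ν) : ν = μ.map π :=
  (hf.entropy_add_le hinj hπ hπc h hμ hφ hper hν.1).2
    ((hf.pressure_le_entropy_map hinj hπ hπc h hμ hφ).trans
      (hν.2 _ (hf.isInvariantProb_map hinj hπ hπc h hμ)))

theorem support_map : (μ.map π).support = univ := by
  have := hμ.prob
  have : (μ.map π).IsOpenPosMeasure := by
    refine ⟨fun U hU hne => ?_⟩
    obtain ⟨x, hxU, hx⟩ := hf.exists_regular_mem hU hne
    have hX := hf.itinerary_mem hx
    have hxπ : π (hf.itinerary x) = x := by rw [hπ _ hX, hf.proj_itinerary hinj hx]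
    obtain ⟨n, hn⟩ := exists_cylinder_subset (hU.preimage hπc) (ξ := hf.itinerary x)
      (by rwa [mem_preimage, hxπ])
    have hpos := h.measure_cylinder_pos hμ (pre_mem_language hX n)
    rw [Measure.map_apply hπc.measurable hU.measurableSet]
    exact fun h0 => hpos.ne' (by rw [measureReal_def, measure_mono_null hn h0]; rfl)
  exact Measure.support_eq_univ

/-- The upper constant does not depend on `M`, because the symbolic upper bound holds on the whole
language and passing to `supSum` only helps. The lower one loses the distortion of G(M). -/
theorem weakGibbs_map (hφ : Continuous φ) (hB : ∀ x, |φ x| ≤ B) {Cp G Cs : Set (List (Fin p))}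
    (hII : BowenOn f a φ G) (hGM : GM = fatten (language (codeSpace f a)) Cp G Cs)
    (hP : P = pressure f a φ) : WeakGibbs f a φ GM (μ.map π) := by
  subst hP hGM
  obtain ⟨K, hK, hup⟩ := hμ.upper
  choose V hV using fun M =>
    hf.exists_supSum_le_symSup hinj hπ hφ hπc hB (Cp := Cp) (Cs := Cs) hII M
  choose κ hκ hlow using hμ.lower_single
  refine ⟨K, fun M => κ M * Real.exp (-V M), hK, fun M => mul_pos (hκ M) (Real.exp_pos _),
    fun M w hw => ?_⟩
  rw [hf.map_real_wordSet hinj hπ hπc h hμ, le_div_iff₀ (Real.exp_pos _),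
    div_le_iff₀ (Real.exp_pos _)]
  constructor
  · refine le_trans ?_ (hlow M w hw)
    rw [mul_assoc, ← Real.exp_add]
    refine mul_le_mul_of_nonneg_left (Real.exp_le_exp.2 ?_) (hκ M).le
    linarith [hV M w hw]
  · refine (hup w hw.1).trans (mul_le_mul_of_nonneg_left (Real.exp_le_exp.2 ?_) hK.le)
    linarith [hf.symSup_le_supSum hinj hπ hφ hπc hB hw.1]

end PiecewiseMonotonic
end PMM

namespace PMM

/-! ### Periodic orbits and their measures. -/

section PeriodicOrbits

variable {Y : Type*} {T : Y → Y}

/-- A periodic orbit through S is the orbit of a point of S. Points of S that are not periodic have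
minimal period 0 and contribute nothing. -/
theorem finite_periodic_of_hits {S : Set Y} (hS : S.Finite) :
    {y | (∃ k, T^[k] y ∈ S) ∧ ∃ n > 0, T^[n] y = y}.Finite := by
  refine (hS.biUnion fun s _ =>
    (finite_Iio (Function.minimalPeriod T s)).image fun j => T^[j] s).subset ?_
  rintro y ⟨⟨k, hk⟩, n, hn, hy⟩
  have hyp : Function.IsPeriodicPt T n y := hy
  have hs : Function.IsPeriodicPt T n (T^[k] y) := hyp.apply_iterate k
  -- From T^k y, another nk − k steps complete `k` full periods and return to y.
  refine mem_biUnion hk ⟨(n * k - k) % Function.minimalPeriod T (T^[k] y),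
    Nat.mod_lt _ (hs.minimalPeriod_pos hn), ?_⟩
  simp only
  rw [Function.iterate_mod_minimalPeriod_eq, ← Function.iterate_add_apply,
    Nat.sub_add_cancel (Nat.le_mul_of_pos_left k hn)]
  exact hyp.mul_const k

theorem birkhoffSum_mul_of_periodic {g : Y → ℝ} {n : ℕ} {y : Y} (hy : T^[n] y = y) (k : ℕ) :
    birkhoffSum T g (k * n) y = k * birkhoffSum T g n y := by
  induction k with
  | zero => simp
  | succ k ih =>
    have hyk : T^[k * n] y = y := Function.IsPeriodicPt.const_mul (f := T) hy k
    rw [Nat.succ_mul, birkhoffSum_add, hyk, ih]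
    push_cast
    ring

theorem birkhoffSum_eq_mul_of_periodic {g : Y → ℝ} {n q : ℕ} (hq : 0 < q) {y : Y}
    (hy : T^[n] y = y) (hy' : T^[q] y = y) :
    birkhoffSum T g n y = n * (birkhoffSum T g q y / q) := by
  have h := birkhoffSum_mul_of_periodic (g := g) hy q
  rw [mul_comm, birkhoffSum_mul_of_periodic (g := g) hy' n] at h
  have hq' : (q : ℝ) ≠ 0 := by exact_mod_cast hq.ne'
  field_simp
  linarith

variable [MeasurableSpace Y] [MeasurableSingletonClass Y]

/-- The uniform measure on a periodic orbit. -/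
theorem exists_orbit_measure (hT : Measurable T) {y : Y} {q : ℕ} (hq : 0 < q) (hy : T^[q] y = y) :
    ∃ ν : Measure Y, IsInvariantProb T ν ∧ ν {y} ≠ 0 ∧
      (∀ E, MeasurableSet E → (∀ k, T^[k] y ∉ E) → ν E = 0) ∧
      ∀ g : Y → ℝ, ∫ z, g z ∂ν = birkhoffSum T g q y / q := by
  classical
  have hw : ∀ i ∈ Finset.range q, 0 ≤ (fun _ : ℕ => (1 : ℝ)) i := fun _ _ => zero_le_one
  have hsum : ∑ _i ∈ Finset.range q, (1 : ℝ) = q := by simp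
  have hq' : (0 : ℝ) < q := by exact_mod_cast hq
  have hprob := isProbabilityMeasure_weightedDirac (x := fun k => T^[k] y) hw
    (by rw [hsum]; exact hq')
  have hreal : ∀ E, MeasurableSet E →
      (weightedDirac (Finset.range q) (fun _ => (1 : ℝ)) fun k => T^[k] y).real E =
        (∑ k ∈ Finset.range q, if T^[k] y ∈ E then (1 : ℝ) else 0) / q := by
    intro E hE
    rw [weightedDirac_real_apply hw hE, hsum, Finset.sum_filter]
  refine ⟨weightedDirac (Finset.range q) (fun _ => 1) fun k => T^[k] y, ⟨hprob, hT, ?_⟩, ?_, ?_, ?_⟩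
  · have := Measure.isProbabilityMeasure_map (μ := weightedDirac (Finset.range q)
      (fun _ => (1 : ℝ)) fun k => T^[k] y) hT.aemeasurable
    refine Measure.ext fun E hE => ?_
    rw [← ENNReal.toReal_eq_toReal_iff' (measure_ne_top _ _) (measure_ne_top _ _),
      ← measureReal_def, ← measureReal_def]
    rw [map_measureReal_apply hT hE, hreal _ (hT hE), hreal _ hE]
    congr 1
    have h := Finset.sum_range_succ' (fun k => if T^[k] y ∈ E then (1 : ℝ) else 0) q
    rw [Finset.sum_range_succ, hy, Function.iterate_zero, id, add_left_inj] at h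
    rw [h]
    refine Finset.sum_congr rfl fun k _ => ?_
    rw [Function.iterate_succ_apply']
    rfl
  · intro h0
    have h1 := hreal {y} (measurableSet_singleton y)
    rw [measureReal_def, h0, ENNReal.toReal_zero, eq_comm, div_eq_zero_iff] at h1
    have h2 := Finset.single_le_sum (f := fun k => if T^[k] y ∈ ({y} : Set Y) then (1 : ℝ) else 0)
      (fun k _ => by split_ifs <;> norm_num) (Finset.mem_range.2 hq)
    simp only [Function.iterate_zero, id, mem_singleton_iff, if_true] at h2 h1
    rcases h1 with h1 | h1 <;> linarith
  · intro E hE hEy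
    have h1 := hreal E hE
    simp only [hEy, if_false, Finset.sum_const_zero, zero_div] at h1
    exact (measureReal_eq_zero_iff).1 h1
  · intro g
    rw [integral_weightedDirac hw, hsum]
    simp [birkhoffSum]

omit [MeasurableSpace Y] [MeasurableSingletonClass Y] in
/-- Finitely many periodic orbits of small weight are negligible. -/
theorem tendsto_sum_periodic_zero {Q : Set Y} (hQ : Q.Finite) {φ g : Y → ℝ} {P C : ℝ}
    (hP : ∀ y ∈ Q, ∀ n > 0, T^[n] y = y → birkhoffSum T φ n y / n < P)
    (hg : ∀ y, |g y| ≤ C) {F : ℕ → Finset Y}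
    (hF : ∀ n, ∀ y ∈ F n, y ∈ Q ∧ 0 < n ∧ T^[n] y = y) :
    Tendsto (fun n => (∑ y ∈ F n, Real.exp (birkhoffSum T φ n y) * g y) * Real.exp (-(n * P)))
      atTop (𝓝 0) := by
  classical
  -- All periods of a point give the same average A < P, so its normalised weight e^{n(A−P)} decays
  -- geometrically. For the other points any value below P serves.
  have hA : ∀ y, ∃ A < P, y ∈ Q → ∀ n > 0, T^[n] y = y → birkhoffSum T φ n y = n * A := by
    intro y
    by_cases h : y ∈ Q ∧ ∃ q > 0, T^[q] y = y
    · obtain ⟨hyQ, q, hq, hy⟩ := h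
      exact ⟨_, hP y hyQ q hq hy, fun _ n _ hn => birkhoffSum_eq_mul_of_periodic hq hn hy⟩
    · exact ⟨P - 1, by linarith, fun hyQ n hn hy => absurd ⟨hyQ, n, hn, hy⟩ h⟩
  choose A hAP hA using hA
  have hlim : Tendsto (fun n : ℕ => ∑ y ∈ hQ.toFinset, C * Real.exp (A y - P) ^ n) atTop (𝓝 0) := by
    have : Tendsto (fun n : ℕ => ∑ y ∈ hQ.toFinset, C * Real.exp (A y - P) ^ n) atTop
        (𝓝 (∑ y ∈ hQ.toFinset, C * 0)) :=
      tendsto_finsetSum _ fun y _ => Tendsto.const_mul C (tendsto_pow_atTop_nhds_zero_of_lt_one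
        (Real.exp_pos _).le (Real.exp_lt_one_iff.2 (by linarith [hAP y])))
    simpa using this
  refine squeeze_zero_norm (fun n => ?_) hlim
  rw [Finset.sum_mul]
  refine (norm_sum_le _ _).trans ?_
  have hterm : ∀ y ∈ F n, ‖Real.exp (birkhoffSum T φ n y) * g y * Real.exp (-(n * P))‖ ≤
      C * Real.exp (A y - P) ^ n := by
    intro y hy
    obtain ⟨hyQ, hn, hyn⟩ := hF n y hy
    rw [hA y hyQ n hn hyn, Real.norm_eq_abs, abs_mul, abs_mul, Real.abs_exp, Real.abs_exp,
      ← Real.exp_nat_mul, mul_comm (Real.exp _) |g y|, mul_assoc, ← Real.exp_add]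
    rw [show (n : ℝ) * A y + -(n * P) = n * (A y - P) by ring]
    exact mul_le_mul_of_nonneg_right (hg y) (Real.exp_pos _).le
  refine (Finset.sum_le_sum hterm).trans (Finset.sum_le_sum_of_subset_of_nonneg
    (fun y hy => hQ.mem_toFinset.2 (hF n y hy).1) fun y _ _ => ?_)
  exact mul_nonneg ((abs_nonneg _).trans (hg y)) (by positivity)

end PeriodicOrbits

/-! ### Weighted periodic points of the subshift. -/

section SymbolicPeriodic

variable {p : ℕ} {X : Set (ℕ → Fin p)} {ψ : (ℕ → Fin p) → ℝ} {GM : ℕ → Set (List (Fin p))}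
  {P B : ℝ} {μ : Measure (ℕ → Fin p)}

theorem eq_of_pre_eq_of_periodic {n : ℕ} (hn : 0 < n) {ξ η : ℕ → Fin p} (hξ : shift^[n] ξ = ξ)
    (hη : shift^[n] η = η) (h : pre ξ n = pre η n) : ξ = η := by
  have key : ∀ ζ : ℕ → Fin p, shift^[n] ζ = ζ → ∀ k, ζ k = ζ (k % n) := by
    intro ζ hζ k
    have h1 : shift^[n * (k / n)] ζ = ζ := Function.IsPeriodicPt.mul_const (f := shift) hζ _
    conv_lhs => rw [← Nat.mod_add_div k n, ← shift_iterate_apply _ ζ, h1]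
  funext k
  rw [key ξ hξ, key η hη]
  exact pre_eq_pre_iff.1 h _ (Nat.mod_lt k hn)

theorem finite_periodicCodes (X : Set (ℕ → Fin p)) (n : ℕ) :
    {ξ | 0 < n ∧ ξ ∈ X ∧ shift^[n] ξ = ξ}.Finite := by
  refine Set.Finite.of_finite_image (f := fun ξ => pre ξ n)
    ((words (Fin p) n).finite_toSet.subset ?_) ?_
  · rintro _ ⟨ξ, -, rfl⟩
    simp
  · rintro ξ ⟨hn, -, hξ⟩ η ⟨-, -, hη⟩ h
    exact eq_of_pre_eq_of_periodic hn hξ hη h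

/-- The points of period `n > 0` of the shift space `X`. -/
noncomputable def periodicCodes (X : Set (ℕ → Fin p)) (n : ℕ) : Finset (ℕ → Fin p) :=
  (finite_periodicCodes X n).toFinset

@[simp] theorem mem_periodicCodes {n : ℕ} {ξ : ℕ → Fin p} :
    ξ ∈ periodicCodes X n ↔ 0 < n ∧ ξ ∈ X ∧ shift^[n] ξ = ξ := by
  simp [periodicCodes]

/-- The total weight of the points of period `n`. -/
noncomputable def periodicSum (X : Set (ℕ → Fin p)) (ψ : (ℕ → Fin p) → ℝ) (n : ℕ) : ℝ :=
  ∑ ξ ∈ periodicCodes X n, Real.exp (birkhoffSum shift ψ n ξ)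

theorem birkhoffSum_shift_of_periodic {n : ℕ} {ξ : ℕ → Fin p} (hξ : shift^[n] ξ = ξ) :
    birkhoffSum shift ψ n (shift ξ) = birkhoffSum shift ψ n ξ := by
  have h1 := birkhoffSum_succ shift ψ n ξ
  have h2 := birkhoffSum_succ' shift ψ n ξ
  rw [hξ] at h1
  linarith

namespace GibbsDecomposition

variable (h : GibbsDecomposition X ψ GM P B)
include h

/-- Periodic specification for a single word turns each word of length n − t in `GM M` into a point
of period n, injectively. -/
theorem exists_le_periodicSum (hper : ∀ M, SpecPer X (GM M)) :
    ∃ c > 0, ∃ N : ℕ, ∀ n ≥ N, c * Real.exp (n * P) ≤ periodicSum X ψ n := by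
  classical
  obtain ⟨M, hM⟩ := h.exists_le_wordSum
  obtain ⟨t, ht⟩ := hper M
  obtain ⟨V, hV⟩ := h.bowen M
  have hex : ∀ w, ∃ ξ, w ∈ GM M → ξ ∈ cylinder X w ∧ shift^[w.length + t] ξ = ξ := by
    intro w
    by_cases hw : w ∈ GM M
    · obtain ⟨v, -, -, ξ, hξ, hξ'⟩ := ht 0 (fun _ => w) fun _ => hw
      rw [glue_zero] at hξ hξ'
      exact ⟨ξ, fun _ => ⟨hξ, hξ'⟩⟩
    · obtain ⟨i⟩ : Nonempty (ℕ → Fin p) := by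
        have h0 := (Real.exp_pos _).trans_le (h.lower 0)
        obtain ⟨u, hu, -⟩ := Finset.exists_ne_zero_of_sum_ne_zero h0.ne'
        obtain ⟨ζ, -⟩ := (mem_wordsIn.1 hu).2
        exact ⟨ζ⟩
      exact ⟨i, fun hw' => absurd hw' hw⟩
  choose ξ hξ using hex
  -- V is the distortion on the word, tB the cost of the closing gap, 1/2 the share of `GM M`, and
  -- e^{-tP} the missing length. The threshold t + 1 keeps the period positive.
  refine ⟨Real.exp (-(V + t * B)) * (1 / 2 * Real.exp (-(t * P))),
    by positivity, t + 1, fun n hn => ?_⟩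
  obtain ⟨m, rfl⟩ : ∃ m, n = m + t := ⟨n - t, by omega⟩
  have hsum : Real.exp (-(V + t * B)) * wordSum (symSup X ψ) (GM M) m ≤
      periodicSum X ψ (m + t) := by
    rw [wordSum, Finset.mul_sum, periodicSum]
    calc ∑ w ∈ wordsIn (GM M) m, Real.exp (-(V + t * B)) * Real.exp (symSup X ψ w)
        ≤ ∑ w ∈ wordsIn (GM M) m, Real.exp (birkhoffSum shift ψ (m + t) (ξ w)) := by
          refine Finset.sum_le_sum fun w hw => ?_
          obtain ⟨rfl, hw'⟩ := mem_wordsIn.1 hw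
          rw [← Real.exp_add, birkhoffSum_add, Real.exp_le_exp]
          linarith [hV w hw' _ (hξ w hw').1,
            (abs_le.1 (abs_birkhoffSum_le (T := shift) h.bound t (shift^[w.length] (ξ w)))).1]
      _ = ∑ ζ ∈ (wordsIn (GM M) m).image ξ, Real.exp (birkhoffSum shift ψ (m + t) ζ) := by
          rw [Finset.sum_image]
          intro w hw v hv hwv
          obtain ⟨hwm, hw⟩ := mem_wordsIn.1 hw
          obtain ⟨hvm, hv⟩ := mem_wordsIn.1 hv
          rw [← pre_eq_of_mem_cylinder (hξ w hw).1 hwm, ← pre_eq_of_mem_cylinder (hξ v hv).1 hvm,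
            hwv]
      _ ≤ _ := by
          refine Finset.sum_le_sum_of_subset_of_nonneg ?_ fun _ _ _ => (Real.exp_pos _).le
          intro ζ hζ
          obtain ⟨w, hw, rfl⟩ := Finset.mem_image.1 hζ
          obtain ⟨rfl, hw'⟩ := mem_wordsIn.1 hw
          exact mem_periodicCodes.2 ⟨by omega, (hξ w hw').1.1, (hξ w hw').2⟩
  refine le_trans ?_ hsum
  rw [mul_assoc]
  refine mul_le_mul_of_nonneg_left ?_ (Real.exp_pos _).le
  refine le_trans (le_of_eq ?_) (hM M le_rfl m)
  rw [mul_assoc, ← Real.exp_add]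
  congr 2
  push_cast
  ring

/-- Periodic orbits have smaller free energy than the pressure. -/
theorem birkhoffSum_div_lt_of_periodic (hμ : IsSymbolicGibbs X ψ GM P μ) (hinf : X.Infinite)
    {ξ : ℕ → Fin p} (hξ : ξ ∈ X) {n : ℕ} (hn : 0 < n) (hper : shift^[n] ξ = ξ) :
    birkhoffSum shift ψ n ξ / n < P := by
  by_contra! hle
  obtain ⟨ν, ⟨hprob, hinv⟩, hν0, hνE, hint⟩ := exists_orbit_measure measurable_shift hn hper
  refine hν0 ?_
  -- Entropy is nonnegative, so an average of at least P would make the orbit measure equal to μ,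
  -- which has no atoms.
  rw [h.eq_of_le_wordEntropy_add hμ hinv (hνE _ h.isClosed.measurableSet.compl
    fun k hk => hk (shift_iterate_mem h.mapsTo k hξ)) fun m => ?_]
  · exact h.measure_singleton hμ hinf ξ
  · rw [hint]
    have h1 := refinementEntropy_nonneg (f := shift) (μ := ν) (q := fun ξ => ξ 0) m
    have h2 := mul_le_mul_of_nonneg_left hle (Nat.cast_nonneg (α := ℝ) m)
    linarith

/-- Weighted periodic points converge to the Gibbs measure. -/
theorem tendsto_periodic (hμ : IsSymbolicGibbs X ψ GM P μ) (hper : ∀ M, SpecPer X (GM M))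
    {g : (ℕ → Fin p) → ℝ} (hg : Continuous g) :
    Tendsto (fun n => (∑ ξ ∈ periodicCodes X n, Real.exp (birkhoffSum shift ψ n ξ) * g ξ) /
      periodicSum X ψ n) atTop (𝓝 (∫ ξ, g ξ ∂μ)) := by
  classical
  have := hμ.prob
  obtain ⟨c, hc, N, hcN⟩ := h.exists_le_periodicSum hper
  obtain ⟨K, hK0, hK⟩ := h.exists_upper
  -- The index is moved by `N` so that all normalising sums are positive.
  let m : ℕ → Measure (ℕ → Fin p) := fun n => weightedDirac (periodicCodes X (n + N))
    (fun ξ => Real.exp (birkhoffSum shift ψ (n + N) ξ)) id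
  have hw : ∀ n, ∀ ξ ∈ periodicCodes X n, 0 ≤ Real.exp (birkhoffSum shift ψ n ξ) :=
    fun _ _ _ => (Real.exp_pos _).le
  have hlow : ∀ n, c * Real.exp ((n + N : ℕ) * P) ≤ periodicSum X ψ (n + N) := fun n =>
    hcN _ (Nat.le_add_left _ _)
  have hpos : ∀ n, 0 < periodicSum X ψ (n + N) := fun n => lt_of_lt_of_le (by positivity) (hlow n)
  have hprob : ∀ n, IsProbabilityMeasure (m n) := fun n =>
    isProbabilityMeasure_weightedDirac (hw _) (hpos n)
  let ms : ℕ → ProbabilityMeasure (ℕ → Fin p) := fun n => ⟨m n, hprob n⟩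
  have hreal : ∀ n C, MeasurableSet C → (m n).real C =
      (∑ ξ ∈ periodicCodes X (n + N) with ξ ∈ C,
        Real.exp (birkhoffSum shift ψ (n + N) ξ)) / periodicSum X ψ (n + N) := by
    intro n C hC
    exact weightedDirac_real_apply (hw _) hC
  -- The shift permutes the points of period n and preserves their Birkhoff sums.
  have hinv : ∀ n C, MeasurableSet C → (m n).real (shift ⁻¹' C) = (m n).real C := by
    intro n C hC
    rw [hreal n _ (measurable_shift hC), hreal n _ hC]
    congr 1
    refine Finset.sum_bij (fun ξ _ => shift ξ) ?_ ?_ ?_ ?_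
    · intro ξ hξ
      rw [Finset.mem_filter, mem_periodicCodes] at hξ ⊢
      refine ⟨⟨hξ.1.1, h.mapsTo hξ.1.2.1, ?_⟩, hξ.2⟩
      rw [← Function.iterate_succ_apply, Function.iterate_succ_apply', hξ.1.2.2]
    · intro ξ hξ η hη he
      rw [Finset.mem_filter, mem_periodicCodes] at hξ hη
      obtain ⟨k, hk⟩ := Nat.exists_eq_succ_of_ne_zero hξ.1.1.ne'
      have h1 := hξ.1.2.2
      have h2 := hη.1.2.2
      rw [hk, Function.iterate_succ_apply] at h1 h2
      rw [← h1, ← h2, he]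
    · intro η hη
      rw [Finset.mem_filter, mem_periodicCodes] at hη
      obtain ⟨k, hk⟩ := Nat.exists_eq_succ_of_ne_zero hη.1.1.ne'
      have h2 : shift (shift^[k] η) = η := by
        rw [← Function.iterate_succ_apply' shift, ← hk, hη.1.2.2]
      refine ⟨shift^[k] η, ?_, h2⟩
      rw [Finset.mem_filter, mem_periodicCodes, mem_preimage, h2]
      refine ⟨⟨hη.1.1, shift_iterate_mem h.mapsTo k hη.1.2.1, ?_⟩, hη.2⟩
      rw [← Function.iterate_add_apply, add_comm, Function.iterate_add_apply, hη.1.2.2]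
    · intro ξ hξ
      rw [Finset.mem_filter, mem_periodicCodes] at hξ
      rw [birkhoffSum_shift_of_periodic hξ.1.2.2]
  have hmX : ∀ n, (m n) X = 1 := by
    intro n
    have hr : (m n).real X = 1 := by
      rw [hreal n X h.isClosed.measurableSet, Finset.filter_true_of_mem]
      · exact div_self (hpos n).ne'
      intro ξ hξ
      exact (mem_periodicCodes.1 hξ).2.1
    rwa [measureReal_def, ENNReal.toReal_eq_one_iff] at hr
  -- A periodic point is determined by the word of its first period. So the points in [w] are no
  -- heavier than the words that begin with `w`, while the normalisation is at least c e^{(n+N)P}.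
  have hupper : ∀ w : List (Fin p), ∀ n, w.length ≤ n + N → (m n).real (cylinder univ w) ≤
      K * K / c * Real.exp (symSup X ψ w - w.length * P) := by
    intro w n hn
    obtain ⟨l, hl⟩ := Nat.exists_eq_add_of_le hn
    rw [hreal n _ (measurableSet_cylinder w), div_le_iff₀ (hpos n)]
    have h1 : ∑ ξ ∈ periodicCodes X (n + N) with ξ ∈ cylinder univ w,
        Real.exp (birkhoffSum shift ψ (n + N) ξ) ≤ wordSum (symSup X ψ)
          {x | x ∈ language X ∧ ∃ a b, a.length = 0 ∧ x = a ++ w ++ b} (0 + w.length + l) := by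
      rw [zero_add, ← hl, wordSum]
      calc _ ≤ ∑ ξ ∈ periodicCodes X (n + N) with ξ ∈ cylinder univ w,
            Real.exp (symSup X ψ (pre ξ (n + N))) := by
            refine Finset.sum_le_sum fun ξ hξ => Real.exp_le_exp.2 ?_
            have hξX := (mem_periodicCodes.1 (Finset.mem_filter.1 hξ).1).2.1
            simpa using le_symSup h.bound (mem_cylinder_pre hξX (n + N))
        _ = ∑ x ∈ ((periodicCodes X (n + N)).filter (· ∈ cylinder univ w)).image
            fun ξ => pre ξ (n + N), Real.exp (symSup X ψ x) := by
            rw [Finset.sum_image]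
            intro ξ hξ η hη he
            have h1 := mem_periodicCodes.1 (Finset.mem_filter.1 hξ).1
            have h2 := mem_periodicCodes.1 (Finset.mem_filter.1 hη).1
            exact eq_of_pre_eq_of_periodic h1.1 h1.2.2 h2.2.2 he
        _ ≤ _ := by
            refine Finset.sum_le_sum_of_subset_of_nonneg ?_ fun _ _ _ => (Real.exp_pos _).le
            intro x hx
            obtain ⟨ξ, hξ, rfl⟩ := Finset.mem_image.1 hx
            obtain ⟨hξ1, hξ2⟩ := Finset.mem_filter.1 hξ
            have hξX := (mem_periodicCodes.1 hξ1).2.1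
            refine mem_wordsIn.2 ⟨length_pre _ _, pre_mem_language hξX _, ?_⟩
            exact exists_eq_append_of_mem_cylinder (mem_cylinder_pre hξX _) (n := l)
              (by simp [hl]) hξ2
    have h2 := wordSum_middle_le h.mapsTo h.bound 0 l w
    have h3 := hK 0
    have h4 := hK l
    simp only [Nat.cast_zero, zero_mul, Real.exp_zero, mul_one] at h3
    have h5 := hlow n
    calc _ ≤ _ := h1.trans h2
      _ ≤ K * Real.exp (symSup X ψ w) * (K * Real.exp (l * P)) := by
          refine mul_le_mul (mul_le_mul_of_nonneg_right h3 (Real.exp_pos _).le) h4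
            (wordSum_nonneg _ _ _) (by positivity)
      _ = K * K / c * Real.exp (symSup X ψ w - w.length * P) *
          (c * Real.exp ((n + N : ℕ) * P)) := by
          have : Real.exp (symSup X ψ w) * Real.exp (l * P) =
              Real.exp (symSup X ψ w - w.length * P) * Real.exp ((n + N : ℕ) * P) := by
            rw [← Real.exp_add, ← Real.exp_add, hl]
            congr 1
            push_cast
            ring
          rw [show ∀ E F : ℝ, K * K / c * E * (c * F) = K * K * (E * F) from fun E F => by field_simp,
            ← this]
          ring
      _ ≤ _ := mul_le_mul_of_nonneg_left h5 (by positivity)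
  -- Along every ultrafilter the limit is invariant and inherits the upper Gibbs bound. It therefore
  -- has full free energy and is μ, so the sequence itself converges.
  have hlim : Tendsto ms atTop (𝓝 ⟨μ, this⟩) := by
    rw [tendsto_iff_ultrafilter]
    intro U hU
    obtain ⟨lam, hlam⟩ := exists_ultralimit U ms
    have heq : (lam : Measure (ℕ → Fin p)) = μ := by
      have hlinv : MeasurePreserving shift (lam : Measure (ℕ → Fin p)) lam :=
        measurePreserving_shift_of_tendsto hlam fun n C hC => by
          have : ∀ i, (ms i : Measure (ℕ → Fin p)).real (shift ⁻¹' C) -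
              (ms i : Measure (ℕ → Fin p)).real C = 0 := fun i =>
            sub_eq_zero.2 (hinv i C hC.measurableSet)
          simp only [this]
          exact tendsto_const_nhds
      have hlX : (lam : Measure (ℕ → Fin p)) Xᶜ = 0 := by
        rw [prob_compl_eq_zero_iff h.isClosed.measurableSet]
        exact le_antisymm prob_le_one
          (measure_closed_of_tendsto hlam h.isClosed fun n => (hmX n).ge)
      refine h.eq_of_le_wordEntropy_add hμ hlinv hlX fun n =>
        le_wordEntropy_add_of_upper hlinv hlX h.continuous h.bound (K := K * K / c)
          (by positivity) (fun w _ => ?_) n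
      refine le_of_tendsto ((isDetermined_cylinder w).tendsto_real hlam) (hU ?_)
      filter_upwards [eventually_ge_atTop w.length] with n hn
      exact hupper w n (hn.trans (Nat.le_add_right _ _))
    have : lam = ⟨μ, this⟩ := Subtype.ext heq
    rw [← this]
    exact hlam
  rw [← tendsto_add_atTop_iff_nat N]
  have hgb : ∃ C, ∀ ξ, |g ξ| ≤ C := by
    obtain ⟨C, hC⟩ := isCompact_univ.exists_bound_of_continuousOn hg.continuousOn
    exact ⟨C, fun ξ => hC ξ (mem_univ ξ)⟩
  obtain ⟨C, hC⟩ := hgb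
  have := ProbabilityMeasure.tendsto_iff_forall_integral_tendsto.1 hlim
    (BoundedContinuousFunction.ofNormedAddCommGroup g hg C hC)
  refine this.congr fun n => ?_
  exact integral_weightedDirac (hw _) g

end GibbsDecomposition

end SymbolicPeriodic

end PMM

/-! ### Convergence of the periodic measures on the interval. -/

namespace PMM

theorem entropy_nonneg {Y : Type*} [MeasurableSpace Y] (T : Y → Y) (μ : Measure Y)
    [IsProbabilityMeasure μ] : 0 ≤ entropy T μ := by
  refine le_iSup_of_le 1 (le_iSup_of_le (fun _ => 0) (le_iSup_of_le measurable_const ?_))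
  refine le_limsup_of_frequently_le (Eventually.of_forall fun n => ?_).frequently
  exact_mod_cast div_nonneg (refinementEntropy_nonneg n) n.cast_nonneg

/-- The periodic orbit measure as a normalised finite sum of point masses. -/
theorem periodicMeasure_eq {Y : Type*} [MeasurableSpace Y] {f : Y → Y} {φ : Y → ℝ} {n : ℕ}
    {F : Finset Y} (hF : ∀ x, x ∈ F ↔ x ∈ perPoints f n) :
    periodicMeasure f φ n =
      weightedDirac F (fun x => Real.exp (birkhoffSum f φ n x)) id := by
  have hraw : rawPeriodicMeasure f φ n =
      ∑ x ∈ F, ENNReal.ofReal (Real.exp (birkhoffSum f φ n x)) • Measure.dirac x := by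
    have hset : perPoints f n = (F : Set Y) := Set.ext fun x => (hF x).symm
    rw [rawPeriodicMeasure, hset]
    rw [Measure.sum_fintype]
    exact Finset.sum_coe_sort F
      fun x => ENNReal.ofReal (Real.exp (birkhoffSum f φ n x)) • Measure.dirac x
  have huniv : rawPeriodicMeasure f φ n univ =
      ENNReal.ofReal (∑ x ∈ F, Real.exp (birkhoffSum f φ n x)) := by
    rw [hraw, Measure.finsetSum_apply, ENNReal.ofReal_sum_of_nonneg fun _ _ => (Real.exp_pos _).le]
    exact Finset.sum_congr rfl fun x _ => by simp
  rw [periodicMeasure, huniv, hraw, weightedDirac, Finset.smul_sum]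
  refine Finset.sum_congr rfl fun x hx => ?_
  have hpos : 0 < ∑ x ∈ F, Real.exp (birkhoffSum f φ n x) :=
    Finset.sum_pos (fun _ _ => Real.exp_pos _) ⟨x, hx⟩
  rw [smul_smul, ENNReal.ofReal_div_of_pos hpos, mul_comm, div_eq_mul_inv]
  rfl

/-- Changes of order o(ρ) in numerator and denominator are negligible when the denominator is at
least cρ. -/
theorem tendsto_div_of_perturbation {a b a' b' ρ : ℕ → ℝ} {L c : ℝ} (hc : 0 < c)
    (hρ : ∀ n, 0 < ρ n) (hb : ∀ᶠ n in atTop, c * ρ n ≤ b n)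
    (hL : Tendsto (fun n => a n / b n) atTop (𝓝 L))
    (ha' : Tendsto (fun n => (a' n - a n) * (ρ n)⁻¹) atTop (𝓝 0))
    (hb' : Tendsto (fun n => (b' n - b n) * (ρ n)⁻¹) atTop (𝓝 0)) :
    Tendsto (fun n => a' n / b' n) atTop (𝓝 L) := by
  have key : ∀ u : ℕ → ℝ, Tendsto (fun n => u n * (ρ n)⁻¹) atTop (𝓝 0) →
      Tendsto (fun n => u n / b n) atTop (𝓝 0) := by
    intro u hu
    refine squeeze_zero_norm' ?_ (by simpa using hu.norm.mul_const c⁻¹)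
    filter_upwards [hb] with n hn
    have h1 : 0 < b n := lt_of_lt_of_le (mul_pos hc (hρ n)) hn
    rw [norm_div, Real.norm_of_nonneg h1.le, abs_of_pos (hρ n), div_eq_mul_inv, mul_assoc,
      ← mul_inv, mul_comm (ρ n)]
    exact mul_le_mul_of_nonneg_left (inv_anti₀ (mul_pos hc (hρ n)) hn) (norm_nonneg _)
  have h := (hL.add (key _ ha')).div ((key _ hb').const_add 1) (by norm_num)
  rw [add_zero, add_zero, div_one] at h
  refine h.congr' ?_
  filter_upwards [hb] with n hn
  have h1 : b n ≠ 0 := (lt_of_lt_of_le (mul_pos hc (hρ n)) hn).ne'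
  simp only [Pi.div_apply]
  rw [← add_div, add_sub_cancel, ← div_self h1, ← add_div, add_sub_cancel, div_div_div_cancel_right₀ h1]

namespace PiecewiseMonotonic

variable {p : ℕ} {f : unitInterval → unitInterval} {a : Fin (p + 1) → unitInterval}
  {φ : unitInterval → ℝ} {B P : ℝ} {π : (ℕ → Fin p) → unitInterval}
  {GM : ℕ → Set (List (Fin p))} {μ : Measure (ℕ → Fin p)}

theorem finite_irregular_periodic :
    {x | x ∉ regularPoints f a ∧ ∃ n > 0, f^[n] x = x}.Finite := by
  refine (finite_periodic_of_hits (T := f) (finite_range a)).subset fun x hx => ⟨?_, hx.2⟩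
  have := hx.1
  simpa [regularPoints] using this

variable (hf : PiecewiseMonotonic f a) (hinj : AdmitsSymbolicDynamics f a)
  (hπ : ∀ ξ ∈ codeSpace f a, π ξ = proj f a ξ) (hπc : Continuous π)
include hf hinj hπ

/-- Outside the endpoints `f` is continuous at the projected point, so it carries the closures of
the cylinders of ξ into those of the shifted sequence. No regularity of later iterates is used. -/
theorem lift_shift_of_notMem_range {ξ : ℕ → Fin p} (hξ : ξ ∈ codeSpace f a)
    (hx : π ξ ∉ range a) : π (shift ξ) = f (π ξ) := by
  rw [hπ _ (mapsTo_codeSpace hξ)]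
  have hmem : ∀ n, π ξ ∈ closure (openCylinder f a ξ n) := fun n => by
    rw [hπ _ hξ]; exact proj_mem (hf.exists_mem_closures hξ) n
  have hpiece : π ξ ∈ piece a (ξ 0) := by
    refine mem_piece_of_mem_closure (closure_mono ?_ (hmem 1)) hx
    exact fun y hy => hy 0 one_pos
  refine hf.proj_eq hinj fun n => ?_
  have hcont : ContinuousAt f (π ξ) :=
    (hf.continuousOn (ξ 0)).continuousAt ((isOpen_piece _).mem_nhds hpiece)
  refine closure_mono ?_ (mem_closure_image hcont (hmem (n + 1)))
  rintro _ ⟨y, hy, rfl⟩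
  rw [openCylinder_succ] at hy
  exact hy.2

/-- If the orbit of ξ never projects to an endpoint, π intertwines the dynamics along it and its
projection is regular. So the codes in question have orbits that meet the finite set of codes over
the endpoints. -/
theorem finite_irregular_periodic_codes :
    {ξ | ξ ∈ codeSpace f a ∧ π ξ ∉ regularPoints f a ∧ ∃ n > 0, shift^[n] ξ = ξ}.Finite := by
  have hfin : {ξ | ξ ∈ codeSpace f a ∧ π ξ ∈ range a}.Finite := by
    refine ((finite_range a).biUnion fun z _ => hf.finite_fiber z).subset ?_
    rintro ξ ⟨hξ, hz⟩
    exact mem_biUnion hz ⟨hξ, (hπ ξ hξ).symm⟩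
  refine (finite_periodic_of_hits (T := shift) hfin).subset ?_
  rintro ξ ⟨hξ, hr, hper⟩
  refine ⟨?_, hper⟩
  by_contra! hne
  refine hr ?_
  have hk : ∀ k, π (shift^[k] ξ) = f^[k] (π ξ) := by
    intro k
    induction k with
    | zero => rfl
    | succ k ih =>
      have hX := shift_iterate_mem mapsTo_codeSpace k hξ
      rw [Function.iterate_succ_apply', Function.iterate_succ_apply', ← ih]
      exact hf.lift_shift_of_notMem_range hinj hπ hX fun h => hne k ⟨hX, h⟩
  intro k hmem
  rw [← hk] at hmem
  exact hne k ⟨shift_iterate_mem mapsTo_codeSpace k hξ, hmem⟩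

variable (h : GibbsDecomposition (codeSpace f a) (φ ∘ π) GM P B)
  (hμ : IsSymbolicGibbs (codeSpace f a) (φ ∘ π) GM P μ)
include hπc h hμ

/-- Otherwise the orbit measure would be the projection of μ, which gives no mass to irregular
points. -/
theorem birkhoffSum_div_lt_of_irregular (hφ : Continuous φ) (hper : CodesPeriodicOrbits f a)
    {x : unitInterval} (hx : x ∉ regularPoints f a) {n : ℕ} (hn : 0 < n) (hnx : f^[n] x = x) :
    birkhoffSum f φ n x / n < P := by
  by_contra! hle
  obtain ⟨ν, hν, hν0, -, hint⟩ := exists_orbit_measure hf.measurable hn hnx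
  have := hν.1
  refine hν0 ?_
  rw [(hf.entropy_add_le hinj hπ hπc h hμ hφ hper hν).2 ?_,
    Measure.map_apply hπc.measurable (measurableSet_singleton x)]
  · refine measure_eq_zero_iff_ae_notMem.2 ?_
    filter_upwards [hf.ae_regular hinj hπ h hμ] with ξ hξ hmem
    exact hx (mem_singleton_iff.1 hmem ▸ hξ.2)
  · rw [hint]
    calc (P : EReal) ≤ ((birkhoffSum f φ n x / n : ℝ) : EReal) := by exact_mod_cast hle
      _ = 0 + ((birkhoffSum f φ n x / n : ℝ) : EReal) := (zero_add _).symm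
      _ ≤ _ := by gcongr; exact entropy_nonneg f ν

/-- The weighted periodic orbit measures of `f` converge to the equilibrium state. -/
theorem tendsto_periodicMeasure (hφ : Continuous φ) (hper : CodesPeriodicOrbits f a)
    (hspec : ∀ M, SpecPer (codeSpace f a) (GM M)) (g : C(unitInterval, ℝ)) :
    Tendsto (fun n : ℕ => ∫ x, g x ∂(periodicMeasure f φ n)) atTop
      (𝓝 (∫ x, g x ∂(μ.map π))) := by
  classical
  set X := codeSpace f a with hX
  -- Regular points of period n correspond bijectively to codes of period n with regular projection
  -- (`R`). What is left, `Qn` on the interval and `E` in the subshift, lies in fixed finite sets.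
  set Q : Finset unitInterval := (finite_irregular_periodic (f := f) (a := a)).toFinset
  let Qn : ℕ → Finset unitInterval := fun n => Q.filter fun x => 0 < n ∧ f^[n] x = x
  let R : ℕ → Finset (ℕ → Fin p) := fun n =>
    (periodicCodes X n).filter fun ξ => π ξ ∈ regularPoints f a
  let E : ℕ → Finset (ℕ → Fin p) := fun n =>
    (periodicCodes X n).filter fun ξ => π ξ ∉ regularPoints f a
  let F : ℕ → Finset unitInterval := fun n => (R n).image π ∪ Qn n
  have hR : ∀ n ξ, ξ ∈ R n → ξ = hf.itinerary (π ξ) ∧ π ξ ∈ regularPoints f a ∧ 0 < n ∧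
      f^[n] (π ξ) = π ξ := by
    intro n ξ hξ
    obtain ⟨h1, h2⟩ := Finset.mem_filter.1 hξ
    obtain ⟨hn, hξX, hξn⟩ := mem_periodicCodes.1 h1
    refine ⟨?_, h2, hn, ?_⟩
    · have h3 := h2
      rw [hπ _ hξX] at h3 ⊢
      exact hf.eq_itinerary_of_proj_regular hξX h3
    · rw [← hf.lift_shift_iterate hinj hπ hξX h2, hξn]
  have hF : ∀ n, 0 < n → ∀ x, x ∈ F n ↔ x ∈ perPoints f n := by
    intro n hn x
    change x ∈ F n ↔ f^[n] x = x
    constructor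
    · intro hx
      rcases Finset.mem_union.1 hx with hx | hx
      · obtain ⟨ξ, hξ, rfl⟩ := Finset.mem_image.1 hx
        exact (hR n ξ hξ).2.2.2
      · exact (Finset.mem_filter.1 hx).2.2
    · intro hx
      by_cases hr : x ∈ regularPoints f a
      · have hxX := hf.itinerary_mem hr
        have hxπ : π (hf.itinerary x) = x := by rw [hπ _ hxX, hf.proj_itinerary hinj hr]
        refine Finset.mem_union_left _ (Finset.mem_image.2 ⟨hf.itinerary x, ?_, hxπ⟩)
        refine Finset.mem_filter.2 ⟨mem_periodicCodes.2 ⟨hn, hxX, ?_⟩, by rwa [hxπ]⟩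
        rw [← itinerary_iterate hf, hx]
      · exact Finset.mem_union_right _ (Finset.mem_filter.2
          ⟨(Set.Finite.mem_toFinset _).2 ⟨hr, n, hn, hx⟩, hn, hx⟩)
  -- The regular parts cancel because the itinerary preserves Birkhoff sums.
  have hsum : ∀ (G : unitInterval → ℝ) n,
      ∑ x ∈ F n, Real.exp (birkhoffSum f φ n x) * G x -
        ∑ ξ ∈ periodicCodes X n, Real.exp (birkhoffSum shift (φ ∘ π) n ξ) * G (π ξ) =
      ∑ x ∈ Qn n, Real.exp (birkhoffSum f φ n x) * G x -
        ∑ ξ ∈ E n, Real.exp (birkhoffSum shift (φ ∘ π) n ξ) * G (π ξ) := by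
    intro G n
    have hdisj : Disjoint ((R n).image π) (Qn n) := by
      rw [Finset.disjoint_left]
      intro x hx hxQ
      obtain ⟨ξ, hξ, rfl⟩ := Finset.mem_image.1 hx
      exact ((Set.Finite.mem_toFinset _).1 (Finset.mem_filter.1 hxQ).1).1 (hR n ξ hξ).2.1
    rw [Finset.sum_union hdisj, Finset.sum_image, ← Finset.sum_filter_add_sum_filter_not
      (periodicCodes X n) fun ξ => π ξ ∈ regularPoints f a]
    · have : ∀ ξ ∈ R n, Real.exp (birkhoffSum f φ n (π ξ)) * G (π ξ) =
          Real.exp (birkhoffSum shift (φ ∘ π) n ξ) * G (π ξ) := by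
        intro ξ hξ
        obtain ⟨h1, h2, -⟩ := hR n ξ hξ
        rw [← hf.birkhoffSum_itinerary hinj hπ h2, ← h1]
      rw [Finset.sum_congr rfl this]
      ring
    · intro ξ hξ η hη he
      rw [(hR n ξ hξ).1, (hR n η hη).1, he]
  have hneg : ∀ (G : unitInterval → ℝ) (C : ℝ), (∀ x, |G x| ≤ C) →
      Tendsto (fun n : ℕ => (∑ x ∈ F n, Real.exp (birkhoffSum f φ n x) * G x -
        ∑ ξ ∈ periodicCodes X n, Real.exp (birkhoffSum shift (φ ∘ π) n ξ) * G (π ξ)) *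
          (Real.exp (n * P))⁻¹) atTop (𝓝 0) := by
    intro G C hC
    have h1 := tendsto_sum_periodic_zero (T := f) (finite_irregular_periodic (f := f) (a := a))
      (φ := φ) (P := P) (g := G) (C := C) (F := Qn)
      (fun x hx n hn hnx => hf.birkhoffSum_div_lt_of_irregular hinj hπ hπc h hμ hφ hper hx.1 hn hnx)
      hC (fun n x hx => ⟨(Set.Finite.mem_toFinset _).1 (Finset.mem_filter.1 hx).1,
        (Finset.mem_filter.1 hx).2⟩)
    have h2 := tendsto_sum_periodic_zero (T := shift)
      (hf.finite_irregular_periodic_codes hinj hπ)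
      (φ := φ ∘ π) (P := P) (g := fun ξ => G (π ξ)) (C := C) (F := E)
      (fun ξ hξ n hn hnξ => h.birkhoffSum_div_lt_of_periodic hμ (hf.infinite_codeSpace hinj)
        hξ.1 hn hnξ)
      (fun ξ => hC _) (fun n ξ hξ => by
        obtain ⟨h1, h2⟩ := Finset.mem_filter.1 hξ
        obtain ⟨hn, hξX, hξn⟩ := mem_periodicCodes.1 h1
        exact ⟨⟨hξX, h2, n, hn, hξn⟩, hn, hξn⟩)
    have h3 := h1.sub h2
    rw [sub_zero] at h3
    refine h3.congr fun n => ?_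
    rw [hsum, Real.exp_neg]
    ring
  obtain ⟨C, hC⟩ := isCompact_univ.exists_bound_of_continuousOn g.continuous.continuousOn
  obtain ⟨c, hc, N, hN⟩ := h.exists_le_periodicSum hspec
  have hone := hneg (fun _ => 1) 1 (by simp)
  simp only [mul_one] at hone
  -- The comparison is at scale e^{nP}, a lower bound for the symbolic periodic sum up to the factor
  -- c.
  have hlim := tendsto_div_of_perturbation hc (fun n : ℕ => Real.exp_pos (n * P))
    (eventually_atTop.2 ⟨N, hN⟩)
    (h.tendsto_periodic hμ hspec (g.continuous.comp hπc))
    (hneg g C fun x => hC x (mem_univ x)) hone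
  rw [integral_map hπc.measurable.aemeasurable g.continuous.aestronglyMeasurable]
  refine hlim.congr' ?_
  filter_upwards [eventually_gt_atTop 0] with n hn
  rw [periodicMeasure_eq (hF n hn), integral_weightedDirac fun _ _ => (Real.exp_pos _).le]
  rfl

end PiecewiseMonotonic
end PMM

theorem mainTheorem8 {p : ℕ} (f : unitInterval → unitInterval) (a : Fin (p + 1) → unitInterval)
    (hf : PMM.PiecewiseMonotonic f a)
    (hinj : PMM.AdmitsSymbolicDynamics f a)
    (hper : PMM.CodesPeriodicOrbits f a)
    (φ : unitInterval → ℝ) (hφ : PMM.LiftContinuous f a φ)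
    (Cp G Cs : Set (List (Fin p)))
    (hCp : Cp ⊆ PMM.language (PMM.codeSpace f a))
    (hG : G ⊆ PMM.language (PMM.codeSpace f a))
    (hCs : Cs ⊆ PMM.language (PMM.codeSpace f a))
    (hdec : PMM.tripleConcat (PMM.language (PMM.codeSpace f a)) Cp G Cs =
      PMM.language (PMM.codeSpace f a))
    (hI : ∀ M : ℕ, PMM.SpecS (PMM.codeSpace f a)
      (PMM.fatten (PMM.language (PMM.codeSpace f a)) Cp G Cs M))
    (hII : PMM.BowenOn f a φ G)
    (hIII : Summable fun n : ℕ => PMM.partitionSum f a φ (Cp ∪ Cs) (n + 1) *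
      Real.exp (-((n + 1 : ℕ) * PMM.pressure f a φ))) :
    ∃ μ : Measure unitInterval,
      PMM.IsEquilibriumState f φ μ ∧
      (∀ ν : Measure unitInterval, PMM.IsEquilibriumState f φ ν → ν = μ) ∧
      μ.support = univ ∧
      PMM.WeakGibbs f a φ
        (PMM.fatten (PMM.language (PMM.codeSpace f a)) Cp G Cs) μ ∧
      ((∀ M : ℕ, PMM.SpecPer (PMM.codeSpace f a)
          (PMM.fatten (PMM.language (PMM.codeSpace f a)) Cp G Cs M)) →
        ∀ g : C(unitInterval, ℝ),
          Tendsto (fun n : ℕ => ∫ x, g x ∂(PMM.periodicMeasure f φ n)) atTop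
            (𝓝 (∫ x, g x ∂μ))) := by
  have hφc := hf.continuous_of_liftContinuous hinj hφ
  obtain ⟨B, hB⟩ := isCompact_univ.exists_bound_of_continuousOn hφc.continuousOn
  replace hB : ∀ x, |φ x| ≤ B := fun x => hB x (mem_univ x)
  obtain ⟨π, hπc, hπ⟩ := hf.exists_continuous_proj hinj
  have h := hf.gibbsDecomposition hinj hπ hφc hπc hB hCp hG hCs hdec hI hII hIII
  obtain ⟨μ, hμ⟩ := h.exists_gibbsMeasure
  exact ⟨μ.map π, hf.isEquilibriumState_map hinj hπ hπc h hμ hφc hper,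
    fun ν hν => hf.eq_map_of_isEquilibriumState hinj hπ hπc h hμ hφc hper hν,
    hf.support_map hinj hπ hπc h hμ,
    hf.weakGibbs_map hinj hπ hπc h hμ hφc hB hII rfl rfl,
    fun hspec g => hf.tendsto_periodicMeasure hinj hπ hπc h hμ hφc hper hspec g⟩
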